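/- **Setting.** All signals are indexed by $t\in\mathbb Z$ on one probability space: noise $e(t)\in\mathbb R^{n_y}$, scheduling $p(t)\in\mathbb R^{n_p}$, input $u(t)\in\mathbb R^{n_u}$, with $n_p\ge 1$. Put $p_0(t)=1$, and for a string $\eta=(\eta_1,\dots,\eta_n)\in\{0,\dots,n_p\}^n$ put $p_\eta(t)=\prod_{j=1}^{n}p_{\eta_j}(t-j+1)$. A parameter $\theta$ of orders $(n_b,n_c)$ consists of matrices $\mathtt g_\eta\in\mathbb R^{n_y\times n_u}$ for all strings $\eta$ of length $1,\dots,n_b+1$ and $\mathtt h_\eta\in\mathbb R^{n_y\times n_y}$ for all strings of length $2,\dots,n_c+1$ (the sub-Markov parameters). It defines the filters $$\mathcal B(\theta)=\sum_{k=0}^{n_b}\Big(\sum_{|\eta|=k+1}\mathtt g_\eta\,p_\eta(t)\Big)q^{-k},\qquad \mathcal C(\theta)=I+\sum_{k=1}^{n_c}\Big(\sum_{|\eta|=k+1}\mathtt h_\eta\,p_\eta(t)\Big)q^{-k}.$$ Let $\Gamma(\theta)=\sum_{i\ge0}\Gamma_i(\theta,p,t)q^{-i}$ be the inverse filter of $\mathcal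 C(\theta)$, $\Gamma_0=I$. Call $\theta$ *stable* if there are $K$ and $0\le\lambda<1$ such that all entries of $\Gamma_i(\theta,p,t)$ have second moment at most $K\lambda^i$, for all $i,t$. The data are generated by $$y=\mathcal B(\theta^*)u+\mathcal C(\theta^*)e$$ with a stable $\theta^*$ of orders $(n_b,n_c)$, $n_b,n_c\ge1$. The model has orders $\hat n_b\ge n_b$, $\hat n_c\ge n_c$; its parameter $\theta$ ranges over the set $\Theta$ of stable parameters of orders $(\hat n_b,\hat n_c)$, and its prediction error is $\varepsilon(\theta)=\Gamma(\theta)\,[\,y-\mathcal B(\theta)u\,]$. Let $\theta_0$ be $\theta^*$ regarded as a parameter of orders $(\hat n_b,\hat n_c)$: the sub-Markov parameters of the lags in common are those of $\theta^*$, the extra ones are zero. **Assumptions.** - $e$ is i.i.d. with mean zero and nonsingular covariance $\Sigma_e$ (for instance Gaussian). - (Input) The second moments of $u(t)$ given the scheduling trajectory $p$ are bounded by a constant not depending on $t$ (as for a bounded deterministic input). - (A1) Given $p$, the input is uncorrelated with the noise: $\mathbb E\{u(t)e(s)^\top\mid p\}=0$ for all $s,t$. (If $u$ is deterministic, or $(u,e)$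 is independent of $p$, this is $\mathbb E\{u(t)e(s)^\top\}=0$.) - (A2) The scheduling signals $p_1,\dots,p_{n_p}$ are mutually independent, each one is an i.i.d. sequence with mean zero, positive finite variance and finite moments up to order $6+\hat n_c$, and the process $p$ is independent of the process $e$. - (A3) The extended input $$\tilde u(t)=\begin{bmatrix}1\\p(t+\hat n_b)\end{bmatrix}\otimes\cdots\otimes\begin{bmatrix}1\\p(t)\end{bmatrix}\otimes u(t)$$ is persistently exciting of order $m=n_y\,n_u\sum_{i=1}^{\hat n_b}(1+n_p)^i$: the limits $R(\tau)=\lim_N\frac1N\sum_{t=1}^N\mathbb E\{\tilde u(t)\tilde u(t-\tau)^\top\}$ exist and the block Toeplitz matrix $[R(j-i)]_{0\le i,j<m}$ is positive definite. - The limit defining the asymptotic loss $V_\infty(\theta)=\lim_{N\to\infty}\frac1N\sum_{t=1}^N\operatorname{Tr}\mathbb E\{\varepsilon(\theta,t)\varepsilon(\theta,t)^\top\}$ exists for every $\theta\in\Theta$. **Theorem.** 1. $\min_{\theta\in\Theta}V_\infty(\theta)=\operatorname{Tr}(\Sigma_e)$. 2. For $\theta\in\Theta$: $V_\infty(\theta)=\operatorname{Tr}(\Sigma_e)$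 if and only if $\theta=\theta_0$. 3. $\theta_0$ is the only stationary point of $V_\infty$ in $\Theta$: for $\theta\in\Theta$, the function $V_\infty$ is differentiable at $\theta$ with derivative zero if and only if $\theta=\theta_0$. 4. Consequently the prediction-error method is consistent: let $V_N(\theta)=\operatorname{Tr}\big(\frac1N\sum_{t=1}^N\varepsilon(\theta,t)\varepsilon(\theta,t)^\top\big)$ and let $D\subseteq\Theta$ be compact with $\theta_0\in D$. If, with probability one, $V_N\to V_\infty$ uniformly on $D$, and for every $N$, with probability one, $\hat\theta_N$ minimizes $V_N$ over $D$, then $\hat\theta_N\to\theta_0$ with probability one. -/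

import Mathlib

open MeasureTheory ProbabilityTheory Filter Topology

noncomputable section

namespace LPVMAX

/-- The parameters of an LPV-MAX model with `ny` outputs, `nu` inputs, `np` scheduling signals,
process order `nb` and noise order `nc`: one `ny × nu` matrix for each lag `k = 0, …, nb` and each
string of `k + 1` characters in `{0, …, np}`, and one `ny × ny` matrix for each lag
`k + 1 = 1, …, nc` and each string of `k + 2` characters (the noise filter is monic, so lag zero
carries no parameter). -/
abbrev Params (ny nu np nb nc : ℕ) : Type :=
  ((k : Fin (nb + 1)) → (Fin ((k : ℕ) + 1) → Fin (np + 1)) → Fin ny → Fin nu → ℝ) ×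
  ((k : Fin nc) → (Fin ((k : ℕ) + 2) → Fin (np + 1)) → Fin ny → Fin ny → ℝ)

/-- The vector `[1; p(t)]`: character `0` stands for the constant signal `1`, and character `i`
for the scheduling signal `p_i`. -/
def extSched {np : ℕ} (p : ℤ → Fin np → ℝ) (t : ℤ) : Fin (np + 1) → ℝ :=
  Fin.cons (1 : ℝ) (p t)

/-- `p_η(t) = p_{η₁}(t) p_{η₂}(t-1) ⋯ p_{η_n}(t-n+1)`. -/
def schedProd {np n : ℕ} (p : ℤ → Fin np → ℝ) (t : ℤ) (η : Fin n → Fin (np + 1)) : ℝ :=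
  ∏ j : Fin n, extSched p (t - (j : ℤ)) (η j)

section Filters

variable {ny nu np nb nc : ℕ}

/-- The coefficient of `q^{-k}` of the process filter at time `t`. -/
def procCoeff (θ : Params ny nu np nb nc) (p : ℤ → Fin np → ℝ) (t : ℤ) (k : ℕ) :
    Matrix (Fin ny) (Fin nu) ℝ :=
  if h : k < nb + 1 then
    ∑ η : Fin (k + 1) → Fin (np + 1), schedProd p t η • Matrix.of (θ.1 ⟨k, h⟩ η)
  else 0

/-- The coefficient of `q^{-k}` of the (monic) noise filter at time `t`. -/
def noiseCoeff (θ : Params ny nu np nb nc) (p : ℤ → Fin np → ℝ) (t : ℤ) :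
    ℕ → Matrix (Fin ny) (Fin ny) ℝ
  | 0 => 1
  | k + 1 =>
    if h : k < nc then
      ∑ η : Fin (k + 2) → Fin (np + 1), schedProd p t η • Matrix.of (θ.2 ⟨k, h⟩ η)
    else 0

/-- The process filter applied to the input. -/
def procOut (θ : Params ny nu np nb nc) (p : ℤ → Fin np → ℝ) (u : ℤ → Fin nu → ℝ) (t : ℤ) :
    Fin ny → ℝ :=
  ∑ k ∈ Finset.range (nb + 1), (procCoeff θ p t k).mulVec (u (t - (k : ℤ)))

/-- The noise filter applied to a signal. -/
def noiseOut (θ : Params ny nu np nb nc) (p : ℤ → Fin np → ℝ) (e : ℤ → Fin ny → ℝ) (t : ℤ) :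
    Fin ny → ℝ :=
  ∑ k ∈ Finset.range (nc + 1), (noiseCoeff θ p t k).mulVec (e (t - (k : ℤ)))

/-- The output of the LPV-MAX system with parameters `θ`. -/
def output (θ : Params ny nu np nb nc) (p : ℤ → Fin np → ℝ) (u : ℤ → Fin nu → ℝ)
    (e : ℤ → Fin ny → ℝ) (t : ℤ) : Fin ny → ℝ :=
  procOut θ p u t + noiseOut θ p e t

/-- The coefficients `Γ_i(t)` of the inverse `Γ = ∑ Γ_i q^{-i}` of the noise filter `C`, from
`Γ C = I` by comparing coefficients:
`Γ_0 = I` and `Γ_i(t) = - ∑_{j = 1}^{i} Γ_{i-j}(t) C_j(t - i + j)`. -/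
def invNoiseCoeff (θ : Params ny nu np nb nc) (p : ℤ → Fin np → ℝ) (t : ℤ) :
    ℕ → Matrix (Fin ny) (Fin ny) ℝ
  | 0 => 1
  | i + 1 =>
    -∑ j : Fin (i + 1),
      invNoiseCoeff θ p t (i - (j : ℕ)) * noiseCoeff θ p (t - (i : ℤ) + (j : ℤ)) ((j : ℕ) + 1)
  termination_by i => i
  decreasing_by omega

/-- The one-step-ahead prediction error `ε(θ) = Γ(θ) [y - B(θ) u]`. -/
def predError (θ : Params ny nu np nb nc) (p : ℤ → Fin np → ℝ) (u : ℤ → Fin nu → ℝ)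
    (y : ℤ → Fin ny → ℝ) (t : ℤ) : Fin ny → ℝ :=
  ∑' r : ℕ, (invNoiseCoeff θ p t r).mulVec (y (t - (r : ℤ)) - procOut θ p u (t - (r : ℤ)))

/-- Parameters of orders `(nb, nc)` regarded as parameters of orders `(nb', nc')`: the parameters
of the lags in common are kept, the extra ones are zero. -/
def pad (nb' nc' : ℕ) (θ : Params ny nu np nb nc) : Params ny nu np nb' nc' :=
  (fun k η => if h : (k : ℕ) < nb + 1 then θ.1 ⟨k, h⟩ η else 0,
   fun k η => if h : (k : ℕ) < nc then θ.2 ⟨k, h⟩ η else 0)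

/-- The extended input
`ũ(t) = [1; p(t+n)] ⊗ ⋯ ⊗ [1; p(t)] ⊗ u(t)`, its entries indexed by strings and input channels. -/
def extInput (n : ℕ) (p : ℤ → Fin np → ℝ) (u : ℤ → Fin nu → ℝ) (t : ℤ)
    (a : (Fin (n + 1) → Fin (np + 1)) × Fin nu) : ℝ :=
  (∏ j : Fin (n + 1), extSched p (t + (j : ℤ)) (a.1 j)) * u t a.2

end Filters

section Probability

variable {Ω : Type*} [MeasurableSpace Ω] (μ : Measure Ω)

/-- The time average `lim_{N → ∞} (1/N) ∑_{t=1}^N x(t)` exists and equals `a`. -/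
def HasTimeAverage (x : ℤ → ℝ) (a : ℝ) : Prop :=
  Tendsto (fun N : ℕ => (1 / (N : ℝ)) * ∑ t ∈ Finset.Icc 1 N, x (t : ℤ)) atTop (𝓝 a)

/-- Persistence of excitation of order `m`: the covariances
`R(τ) = lim (1/N) ∑_{t=1}^N E{s(t) s(t-τ)ᵀ}` exist and the block Toeplitz matrix formed from
`R(τ)`, `|τ| < m`, is positive definite. -/
def PersistentlyExciting {ι : Type*} [Fintype ι] (s : ℤ → Ω → ι → ℝ) (m : ℕ) : Prop :=
  ∃ R : ℤ → Matrix ι ι ℝ,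
    (∀ τ a b, HasTimeAverage (fun t => ∫ ω, s t ω a * s (t - τ) ω b ∂μ) (R τ a b)) ∧
    (Matrix.of fun x y : Fin m × ι => R ((y.1 : ℤ) - (x.1 : ℤ)) x.2 y.2).PosDef

/-- `e` is a zero-mean i.i.d. process with nonsingular covariance matrix `S`. -/
structure IsNoise {ny : ℕ} (e : ℤ → Ω → Fin ny → ℝ) (S : Matrix (Fin ny) (Fin ny) ℝ) : Prop where
  measurable : ∀ t, Measurable (e t)
  indep : iIndepFun e μ
  identDistrib : ∀ t, IdentDistrib (e t) (e 0) μ μ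
  memLp : ∀ t i, MemLp (fun ω => e t ω i) 2 μ
  mean_zero : ∀ t i, ∫ ω, e t ω i ∂μ = 0
  covariance : ∀ t i j, ∫ ω, e t ω i * e t ω j ∂μ = S i j
  posDef : S.PosDef

/-- The scheduling signals `p_1, …, p_np` are mutually independent zero-mean (strictly) white
processes with nonzero variance and finite moments up to order `m`. -/
structure IsWhiteScheduling {np : ℕ} (p : ℤ → Ω → Fin np → ℝ) (m : ℕ) : Prop where
  measurable : ∀ t, Measurable (p t)
  indep : iIndepFun (fun (x : ℤ × Fin np) ω => p x.1 ω x.2) μ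
  identDistrib : ∀ t i, IdentDistrib (fun ω => p t ω i) (fun ω => p 0 ω i) μ μ
  memLp : ∀ t i, MemLp (fun ω => p t ω i) m μ
  mean_zero : ∀ t i, ∫ ω, p t ω i ∂μ = 0
  variance_pos : ∀ t i, 0 < ∫ ω, (p t ω i) ^ 2 ∂μ

/-- The σ-algebra generated by the whole scheduling trajectory. -/
@[reducible] def schedSigma {np : ℕ} (p : ℤ → Ω → Fin np → ℝ) : MeasurableSpace Ω :=
  MeasurableSpace.comap (fun ω (t : ℤ) => p t ω) inferInstance

/-- The input has second moments that are uniformly bounded given the scheduling trajectory. It may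
be deterministic, random and independent of the scheduling, or depend on the scheduling. -/
structure IsInput {nu np : ℕ} (u : ℤ → Ω → Fin nu → ℝ) (p : ℤ → Ω → Fin np → ℝ) : Prop where
  measurable : ∀ t, Measurable (u t)
  memLp : ∀ t a, MemLp (fun ω => u t ω a) 2 μ
  bounded : ∃ K : ℝ, ∀ t a, ∀ᵐ ω ∂μ, (μ[fun ω => (u t ω a) ^ 2 | schedSigma p]) ω ≤ K

/-- Given the scheduling trajectory, the input is uncorrelated with the noise. -/
def Uncorrelated {nu ny np : ℕ} (u : ℤ → Ω → Fin nu → ℝ) (e : ℤ → Ω → Fin ny → ℝ)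
    (p : ℤ → Ω → Fin np → ℝ) : Prop :=
  ∀ t s a b, μ[fun ω => u t ω a * e s ω b | schedSigma p] =ᵐ[μ] 0

variable {ny nu np nb nc : ℕ}

/-- The set of parameters whose noise filter has an inverse that is exponentially stable in mean
square. -/
def stableParams (p : ℤ → Ω → Fin np → ℝ) : Set (Params ny nu np nb nc) :=
  {θ | ∃ K r : ℝ, 0 ≤ r ∧ r < 1 ∧ ∀ (t : ℤ) (k : ℕ) (i j : Fin ny),
    Integrable (fun ω => (invNoiseCoeff θ (fun s => p s ω) t k i j) ^ 2) μ ∧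
    ∫ ω, (invNoiseCoeff θ (fun s => p s ω) t k i j) ^ 2 ∂μ ≤ K * r ^ k}

/-- The prediction error as a random process; `y` is the measured output. -/
def predErrorProc (θ : Params ny nu np nb nc) (p : ℤ → Ω → Fin np → ℝ) (u : ℤ → Ω → Fin nu → ℝ)
    (y : ℤ → Ω → Fin ny → ℝ) (t : ℤ) (ω : Ω) : Fin ny → ℝ :=
  predError θ (fun s => p s ω) (fun s => u s ω) (fun s => y s ω) t

/-- The loss `V_N(θ) = Tr((1/N) ∑_{t=1}^N ε(θ,t) ε(θ,t)ᵀ)` of a data record of length `N`. -/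
def empLoss (p : ℤ → Ω → Fin np → ℝ) (u : ℤ → Ω → Fin nu → ℝ) (y : ℤ → Ω → Fin ny → ℝ)
    (N : ℕ) (θ : Params ny nu np nb nc) (ω : Ω) : ℝ :=
  ((1 / (N : ℝ)) • ∑ t ∈ Finset.Icc 1 N,
    Matrix.vecMulVec (predErrorProc θ p u y (t : ℤ) ω) (predErrorProc θ p u y (t : ℤ) ω)).trace

/-- `V` is the asymptotic loss
`V_∞(θ) = lim_{N → ∞} (1/N) ∑_{t=1}^N Tr E{ε(θ,t) ε(θ,t)ᵀ}` on the set of stable parameters. -/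
def IsAsymptoticLoss (p : ℤ → Ω → Fin np → ℝ) (u : ℤ → Ω → Fin nu → ℝ) (y : ℤ → Ω → Fin ny → ℝ)
    (V : Params ny nu np nb nc → ℝ) : Prop :=
  ∀ θ ∈ stableParams μ p,
    HasTimeAverage (fun t => (Matrix.of fun i j =>
      ∫ ω, predErrorProc θ p u y t ω i * predErrorProc θ p u y t ω j ∂μ).trace) (V θ)

end Probability

end LPVMAX

end

/-! Let `B`, `C`, `Γ = C⁻¹` be the filters of `θ` and `B₀`, `C₀`, `Γ₀` those of the true parameter,
padded to the orders of the model. Since `y = B₀u + C₀e`, the prediction error is `ε = Γ(B₀ - B)u +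
e + Γ(C₀ - C)e`. By (A1) the first term is orthogonal to all the noise, and `C₀ - C` is strictly
causal, so the last term involves only past noise. The three terms are orthogonal, and `V(θ) = Tr Σ
+ noiseLoss + (time average of inLoss)` (`SignalAssumptions.hasTimeAverage_inLoss`). The noise part
is a fixed function of the shifted trajectory of `(p, e)`, hence stationary; the input part need not
be, but inherits a time average from the assumed existence of `V`.

The filter coefficients are unbounded random variables, so calculating with series of filters in
mean square needs an argument. Consecutive coefficients `F_a(t)` and `G_b(t - a)` meet in the
scheduling only at time `t - a`, and both are linear in `[1; p(t - a)]`. Independence of the other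
times then bounds the `L²` norm of the product by a constant times the product of the norms; the
constant comes from fourth moments at one time (`exists_eLpNorm_mul_le`). This makes geometrically
decaying filters composable (`gapp_conv`), the inverse filters true inverses, and the stable set
open with locally uniform decay (`exists_uniform_kBd`).

Minimum. `V ≥ Tr Σ`, with equality at the true parameter. In case of equality the noise part
vanishes; undoing `Γ` gives `(C₀ - C)e = 0`, and whiteness of `e`, orthogonality of the products
`p_η` and `Σ > 0` give `C = C₀` (`eq_of_noiseErr`). The input part vanishes in time average; undoing
`Γ` again, a combination of lags of the extended input vanishes in mean square average, and
persistent excitation gives `B = B₀` (`eq_fst_of_inLoss`).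

Stationary points. With the noise coefficients fixed, the input part is quadratic along the segment
to the true process coefficients, so stationarity forces `B = B₀` (`eq_fst_of_hasFDerivAt`). Then `ε
= ΓC₀e`, and the derivative in a direction `Δ` of the noise coefficients is `-2 E ε·(ΓΔε)`.
Correlating `ε = e + (C₀ - 1)e - (C - 1)ε` with the past of `ε` gives a recursion for the
autocorrelations of `ε`. It is the recursion of the coefficients of `ΓΔ` for one particular `Δ` of
order `nc` (`exists_integral_noisePred_mul`). For this `Δ` the derivative is `-2` times the sum of
the mean squares of all coefficients of `ΓΔ`; so they vanish and `ε` is orthogonal to its own past.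
But `ε - e = Γ₀(C₀ - C)ε` lies in that past and `e` is orthogonal to `ε - e`, so `ε = e` and the
noise coefficients are the true ones (`eq_snd_of_integral_dirErr`).

Conversely both error parts vanish at the true parameter and depend on `θ` in a locally Lipschitz
way in `L²`. So `V - Tr Σ` is of second order there. The same estimates give continuity of `V`, and
consistency is the usual argument for minimizers under uniform convergence. -/

namespace LPVMAX

open scoped ENNReal NNReal

/-! ### Independence and second moments -/

section Independence

variable {Ω : Type*} {m0 : MeasurableSpace Ω} {μ : Measure Ω}

/-- If `m₁ ⊔ m₂` is independent of `m₃` and `m₁` of `m₂`, then `m₁` is independent of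
`m₂ ⊔ m₃`. -/
theorem indep_sup_right_of_indep [IsProbabilityMeasure μ] {m₁ m₂ m₃ : MeasurableSpace Ω}
    (h₁ : m₁ ≤ m0) (h₂ : m₂ ≤ m0) (h₃ : m₃ ≤ m0) (h₁₂ : Indep m₁ m₂ μ)
    (h : Indep (m₁ ⊔ m₂) m₃ μ) : Indep m₁ (m₂ ⊔ m₃) μ := by
  have hgen : m₂ ⊔ m₃ = MeasurableSpace.generateFrom
      {s | ∃ a b, MeasurableSet[m₂] a ∧ MeasurableSet[m₃] b ∧ s = a ∩ b} := by
    apply le_antisymm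
    · refine sup_le (fun s hs => ?_) (fun s hs => ?_)
      · exact MeasurableSpace.measurableSet_generateFrom
          ⟨s, Set.univ, hs, MeasurableSet.univ, by simp⟩
      · exact MeasurableSpace.measurableSet_generateFrom
          ⟨Set.univ, s, MeasurableSet.univ, hs, by simp⟩
    · refine MeasurableSpace.generateFrom_le ?_
      rintro s ⟨a, b, ha, hb, rfl⟩
      exact MeasurableSet.inter ((le_sup_left : m₂ ≤ m₂ ⊔ m₃) _ ha)
        ((le_sup_right : m₃ ≤ m₂ ⊔ m₃) _ hb)
  have hpi : IsPiSystem {s | ∃ a b, MeasurableSet[m₂] a ∧ MeasurableSet[m₃] b ∧ s = a ∩ b} := by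
    rintro s ⟨a, b, ha, hb, rfl⟩ t ⟨a', b', ha', hb', rfl⟩ -
    exact ⟨a ∩ a', b ∩ b', ha.inter ha', hb.inter hb', Set.inter_inter_inter_comm _ _ _ _⟩
  refine IndepSets.indep h₁ (sup_le h₂ h₃) (@MeasurableSpace.isPiSystem_measurableSet Ω m₁) hpi
    (@MeasurableSpace.generateFrom_measurableSet Ω m₁).symm hgen ?_
  rw [IndepSets_iff]
  rintro s t hs ⟨a, b, ha, hb, rfl⟩
  have e1 := (Indep_iff _ _ _).1 h (s ∩ a) b
    (MeasurableSet.inter ((le_sup_left : m₁ ≤ m₁ ⊔ m₂) _ hs) ((le_sup_right : m₂ ≤ m₁ ⊔ m₂) _ ha)) hb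
  have e2 := (Indep_iff _ _ _).1 h a b ((le_sup_right : m₂ ≤ m₁ ⊔ m₂) _ ha) hb
  have e3 := (Indep_iff _ _ _).1 h₁₂ s a hs ha
  rw [← Set.inter_assoc, e1, e2, e3, mul_assoc]

theorem indepFun_of_indep {m₁ m₂ : MeasurableSpace Ω} (h : Indep m₁ m₂ μ) {X Y : Ω → ℝ}
    (hX : Measurable[m₁] X) (hY : Measurable[m₂] Y) : IndepFun X Y μ :=
  indep_of_indep_of_le h hX.comap_le hY.comap_le

theorem integral_mul_of_indep {m₁ m₂ : MeasurableSpace Ω} (h₁ : m₁ ≤ m0) (h₂ : m₂ ≤ m0)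
    (h : Indep m₁ m₂ μ) {X Y : Ω → ℝ} (hX : Measurable[m₁] X) (hY : Measurable[m₂] Y) :
    ∫ ω, X ω * Y ω ∂μ = (∫ ω, X ω ∂μ) * ∫ ω, Y ω ∂μ :=
  (indepFun_of_indep h hX hY).integral_fun_mul_eq_mul_integral
    (hX.mono h₁ le_rfl).aestronglyMeasurable (hY.mono h₂ le_rfl).aestronglyMeasurable

theorem eLpNorm_two_pow_two (X : Ω → ℝ) : eLpNorm X 2 μ ^ 2 = ∫⁻ ω, ‖X ω‖ₑ ^ 2 ∂μ := by
  rw [eLpNorm_eq_lintegral_rpow_enorm_toReal (by norm_num) (by norm_num)]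
  rw [← ENNReal.rpow_natCast, ← ENNReal.rpow_mul]
  norm_num

/-- The squares are independent too, so `E X²Y² = E X² · E Y²`. As an identity in `[0, ∞]` it needs
no integrability and itself proves that products are square integrable. -/
theorem eLpNorm_mul_of_indep {m₁ m₂ : MeasurableSpace Ω} (h₁ : m₁ ≤ m0) (h₂ : m₂ ≤ m0)
    (h : Indep m₁ m₂ μ) {X Y : Ω → ℝ} (hX : Measurable[m₁] X) (hY : Measurable[m₂] Y) :
    eLpNorm (fun ω => X ω * Y ω) 2 μ = eLpNorm X 2 μ * eLpNorm Y 2 μ := by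
  have hinj : ∀ a b : ℝ≥0∞, a ^ 2 = b ^ 2 → a = b := fun a b hab =>
    le_antisymm ((ENNReal.pow_le_pow_left_iff two_ne_zero).1 hab.le)
      ((ENNReal.pow_le_pow_left_iff two_ne_zero).1 hab.ge)
  refine hinj _ _ ?_
  rw [mul_pow, eLpNorm_two_pow_two, eLpNorm_two_pow_two, eLpNorm_two_pow_two]
  simp only [enorm_mul, mul_pow]
  exact lintegral_mul_eq_lintegral_mul_lintegral_of_independent_measurableSpace h₁ h₂ h
    ((measurable_enorm.comp hX).pow_const 2) ((measurable_enorm.comp hY).pow_const 2)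

theorem memLp_mul_of_indep {m₁ m₂ : MeasurableSpace Ω} (h₁ : m₁ ≤ m0) (h₂ : m₂ ≤ m0)
    (h : Indep m₁ m₂ μ) {X Y : Ω → ℝ} (hX : Measurable[m₁] X) (hY : Measurable[m₂] Y)
    (hX2 : MemLp X 2 μ) (hY2 : MemLp Y 2 μ) : MemLp (fun ω => X ω * Y ω) 2 μ := by
  refine ⟨((hX.mono h₁ le_rfl).mul (hY.mono h₂ le_rfl)).aestronglyMeasurable, ?_⟩
  rw [eLpNorm_mul_of_indep h₁ h₂ h hX hY]
  exact ENNReal.mul_lt_top hX2.2 hY2.2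

theorem holderTriple_four_four_two : ENNReal.HolderTriple 4 4 2 := ⟨by
  rw [← two_mul, show (4 : ℝ≥0∞) = 2 * 2 by norm_num,
    ENNReal.mul_inv (by norm_num) (by norm_num), ← mul_assoc,
    ENNReal.mul_inv_cancel (by norm_num) (by norm_num), one_mul]⟩

theorem integrable_mul_of_memLp_two {X Y : Ω → ℝ} (hX : MemLp X 2 μ) (hY : MemLp Y 2 μ) :
    Integrable (fun ω => X ω * Y ω) μ :=
  hX.integrable_mul hY

theorem eLpNorm_finset_sum_le {ι : Type*} (s : Finset ι) {f : ι → Ω → ℝ}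
    (hf : ∀ i ∈ s, AEStronglyMeasurable (f i) μ) :
    eLpNorm (fun ω => ∑ i ∈ s, f i ω) 2 μ ≤ ∑ i ∈ s, eLpNorm (f i) 2 μ := by
  have := eLpNorm_sum_le (p := 2) hf (by norm_num)
  rwa [Finset.sum_fn] at this

theorem ofReal_integral_sq {X : Ω → ℝ} (hX : MemLp X 2 μ) :
    ENNReal.ofReal (∫ ω, X ω ^ 2 ∂μ) = eLpNorm X 2 μ ^ 2 := by
  rw [ofReal_integral_eq_lintegral_ofReal hX.integrable_sq (ae_of_all _ fun _ => sq_nonneg _),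
    eLpNorm_two_pow_two]
  refine lintegral_congr fun ω => ?_
  rw [← enorm_pow, Real.enorm_of_nonneg (sq_nonneg _)]

theorem integral_sq_eq {X : Ω → ℝ} (hX : MemLp X 2 μ) :
    ∫ ω, X ω ^ 2 ∂μ = (eLpNorm X 2 μ).toReal ^ 2 := by
  rw [← ENNReal.toReal_pow, ← ofReal_integral_sq hX, ENNReal.toReal_ofReal
    (integral_nonneg fun _ => sq_nonneg _)]

end Independence

/-! ### The scheduling process and its σ-algebras -/

section Scheduling

variable {Ω : Type*} {m0 : MeasurableSpace Ω} {μ : Measure Ω} {np : ℕ}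
  {p : ℤ → Ω → Fin np → ℝ}

/-- The σ-algebra generated by the scheduling signals at the times in `S`. -/
@[reducible] def sig (p : ℤ → Ω → Fin np → ℝ) (S : Set ℤ) : MeasurableSpace Ω :=
  ⨆ s ∈ S, MeasurableSpace.comap (p s) inferInstance

/-- The `a`-th entry of `[1; p(τ)]` as a random variable. -/
def chr (p : ℤ → Ω → Fin np → ℝ) (τ : ℤ) (a : Fin (np + 1)) (ω : Ω) : ℝ :=
  extSched (fun s => p s ω) τ a

@[simp] theorem chr_zero (τ : ℤ) (ω : Ω) : chr p τ 0 ω = 1 := rfl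

@[simp] theorem chr_succ (τ : ℤ) (i : Fin np) (ω : Ω) : chr p τ i.succ ω = p τ ω i := rfl

theorem sig_mono {S T : Set ℤ} (h : S ⊆ T) : sig p S ≤ sig p T := biSup_mono h

theorem measurable_sig {S : Set ℤ} {τ : ℤ} (h : τ ∈ S) : Measurable[sig p S] (p τ) :=
  Measurable.of_comap_le (le_iSup₂_of_le τ h le_rfl)

theorem measurable_chr_sig {S : Set ℤ} {τ : ℤ} (h : τ ∈ S) (a : Fin (np + 1)) :
    Measurable[sig p S] (chr p τ a) := by
  refine Fin.cases ?_ (fun i => ?_) a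
  · exact measurable_const
  · exact (measurable_pi_apply i).comp (measurable_sig h)

theorem sig_le_schedSigma (S : Set ℤ) : sig p S ≤ schedSigma p := by
  refine iSup₂_le fun s _ => ?_
  have : Measurable[schedSigma p] (p s) :=
    (measurable_pi_apply s).comp (comap_measurable fun ω (t : ℤ) => p t ω)
  exact this.comap_le

variable {m : ℕ} (hp : IsWhiteScheduling μ p m)

include hp

theorem IsWhiteScheduling.schedSigma_le : schedSigma p ≤ m0 :=
  (measurable_pi_lambda _ fun t => hp.measurable t).comap_le

theorem IsWhiteScheduling.sig_le (S : Set ℤ) : sig p S ≤ m0 :=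
  (sig_le_schedSigma S).trans hp.schedSigma_le

theorem IsWhiteScheduling.measurable_chr (τ : ℤ) (a : Fin (np + 1)) : Measurable (chr p τ a) :=
  (measurable_chr_sig (Set.mem_univ τ) a).mono (hp.sig_le _) le_rfl

/-- The independent family is indexed by pairs (time, channel); disjoint sets of times give disjoint
sets of pairs. -/
theorem IsWhiteScheduling.indep_sig {S T : Set ℤ} (h : Disjoint S T) :
    Indep (sig p S) (sig p T) μ := by
  have key : ∀ S : Set ℤ, sig p S ≤ ⨆ x ∈ {x : ℤ × Fin np | x.1 ∈ S},
      MeasurableSpace.comap (fun ω => p x.1 ω x.2) inferInstance := by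
    intro S
    refine iSup₂_le fun s hs => ?_
    refine Measurable.comap_le (@measurable_pi_lambda _ _ _ (_) _ _ fun i => ?_)
    exact Measurable.of_comap_le (le_iSup₂_of_le (s, i) hs le_rfl)
  have hi := (iIndepFun_iff_iIndep _ _ _).1 hp.indep
  refine indep_of_indep_of_le (indep_iSup_of_disjoint (fun x => ?_) hi
    (S := {x | x.1 ∈ S}) (T := {x | x.1 ∈ T}) ?_) (key S) (key T)
  · exact ((measurable_pi_apply x.2).comp (hp.measurable x.1)).comap_le
  · rw [Set.disjoint_left] at h ⊢
    exact fun x hx hx' => h hx hx'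

theorem IsWhiteScheduling.memLp_chr [IsProbabilityMeasure μ] (τ : ℤ) (a : Fin (np + 1)) :
    MemLp (chr p τ a) m μ := by
  refine Fin.cases ?_ (fun i => ?_) a
  · exact memLp_const 1
  · exact hp.memLp τ i

theorem IsWhiteScheduling.eLpNorm_chr [IsProbabilityMeasure μ] (τ : ℤ) (a : Fin (np + 1))
    (q : ℝ≥0∞) : eLpNorm (chr p τ a) q μ = eLpNorm (chr p 0 a) q μ := by
  refine Fin.cases ?_ (fun i => ?_) a
  · rfl
  · exact (hp.identDistrib τ i).eLpNorm_eq q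

/-- The entries of `[1; p(τ)]` are orthogonal: against the constant by zero mean, among themselves
by independence of the channels. -/
theorem IsWhiteScheduling.integral_chr_mul [IsProbabilityMeasure μ] (τ : ℤ)
    (a b : Fin (np + 1)) :
    ∫ ω, chr p τ a ω * chr p τ b ω ∂μ = if a = b then ∫ ω, chr p 0 a ω ^ 2 ∂μ else 0 := by
  rcases eq_or_ne a b with rfl | hab
  · simp only [if_true, ← sq]
    refine Fin.cases ?_ (fun i => ?_) a
    · rfl
    · exact (hp.identDistrib τ i).comp (measurable_id.pow_const 2) |>.integral_eq
  · rw [if_neg hab]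
    revert hab
    refine Fin.cases ?_ (fun i => ?_) a <;> refine Fin.cases ?_ (fun j => ?_) b
    · simp
    · intro _; simpa using hp.mean_zero τ j
    · intro _; simpa using hp.mean_zero τ i
    · intro hij
      have hne : ((τ, i) : ℤ × Fin np) ≠ (τ, j) := fun h => hij (by rw [(Prod.mk.inj h).2])
      have := (hp.indep.indepFun hne).integral_fun_mul_eq_mul_integral
        ((measurable_pi_apply i).comp (hp.measurable τ)).aestronglyMeasurable
        ((measurable_pi_apply j).comp (hp.measurable τ)).aestronglyMeasurable
      simp only [chr_succ]
      rw [this, hp.mean_zero τ i, zero_mul]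

theorem IsWhiteScheduling.integral_chr_sq_pos [IsProbabilityMeasure μ] (a : Fin (np + 1)) :
    0 < ∫ ω, chr p 0 a ω ^ 2 ∂μ := by
  refine Fin.cases ?_ (fun i => ?_) a
  · simp
  · exact hp.variance_pos 0 i

theorem IsWhiteScheduling.mono_order [IsProbabilityMeasure μ] {m' : ℕ} (h : m' ≤ m) :
    IsWhiteScheduling μ p m' :=
  { hp with memLp := fun t i => (hp.memLp t i).mono_exponent (by exact_mod_cast h) }

end Scheduling

/-! ### Fourth moments at a single time -/

section FourthMoments

variable {Ω : Type*} {m0 : MeasurableSpace Ω} {μ : Measure Ω} [IsProbabilityMeasure μ] {np : ℕ}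
  {p : ℤ → Ω → Fin np → ℝ} (hp : IsWhiteScheduling μ p 4)

include hp

theorem IsWhiteScheduling.memLp_two_chr (τ : ℤ) (a : Fin (np + 1)) : MemLp (chr p τ a) 2 μ :=
  (hp.memLp_chr τ a).mono_exponent (by norm_num)

theorem IsWhiteScheduling.eLpNorm_chr_ne_zero (τ : ℤ) (a : Fin (np + 1)) :
    eLpNorm (chr p τ a) 2 μ ≠ 0 := by
  intro h
  have h1 := integral_sq_eq (hp.memLp_two_chr 0 a)
  rw [← hp.eLpNorm_chr τ, h] at h1
  have := hp.integral_chr_sq_pos a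
  simp [h1] at this

theorem IsWhiteScheduling.memLp_four_chr (τ : ℤ) (a : Fin (np + 1)) : MemLp (chr p τ a) 4 μ := by
  simpa only [Nat.cast_ofNat] using hp.memLp_chr τ a

/-- Hölder with exponents 4, 4, 2. This is where fourth moments of the scheduling enter. -/
theorem IsWhiteScheduling.exists_eLpNorm_chr_mul_le :
    ∃ Q : ℝ≥0, 1 ≤ Q ∧ ∀ τ a b, eLpNorm (fun ω => chr p τ a ω * chr p τ b ω) 2 μ ≤ Q := by
  set q : Fin (np + 1) → ℝ≥0 := fun a => (eLpNorm (chr p 0 a) 4 μ).toNNReal with hqdef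
  have hq : ∀ a, eLpNorm (chr p 0 a) 4 μ = q a := fun a =>
    (ENNReal.coe_toNNReal (hp.memLp_four_chr 0 a).2.ne).symm
  clear_value q
  refine ⟨1 + ∑ a, ∑ b, q a * q b, le_self_add, fun τ a b => ?_⟩
  have := holderTriple_four_four_two
  have h1 : eLpNorm (chr p τ a • chr p τ b) 2 μ
      ≤ eLpNorm (chr p τ a) 4 μ * eLpNorm (chr p τ b) 4 μ :=
    eLpNorm_smul_le_mul_eLpNorm (p := 4) (q := 4) (r := 2)
      (hp.measurable_chr τ b).aestronglyMeasurable (hp.measurable_chr τ a).aestronglyMeasurable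
  rw [hp.eLpNorm_chr τ a 4, hp.eLpNorm_chr τ b 4, hq, hq, ← ENNReal.coe_mul] at h1
  change eLpNorm (chr p τ a • chr p τ b) 2 μ ≤ _
  refine h1.trans (ENNReal.coe_le_coe.2 ?_)
  have h2 : q a * q b ≤ ∑ b, q a * q b :=
    Finset.single_le_sum (f := fun b => q a * q b) (fun _ _ => zero_le) (Finset.mem_univ b)
  have h3 : ∑ b, q a * q b ≤ ∑ a, ∑ b, q a * q b :=
    Finset.single_le_sum (f := fun a => ∑ b, q a * q b) (fun _ _ => zero_le)
      (Finset.mem_univ a)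
  exact (h2.trans h3).trans le_add_self

/-- Coefficients of a combination of the signals `[1; p(τ)]` that are independent of `p(τ)` are
dominated by the combination. -/
theorem IsWhiteScheduling.eLpNorm_coeff_le {m : MeasurableSpace Ω} (hm : m ≤ m0) {τ : ℤ}
    (hind : Indep m (sig p {τ}) μ) {c : Fin (np + 1) → Ω → ℝ} (hc : ∀ a, Measurable[m] (c a))
    (hc2 : ∀ a, MemLp (c a) 2 μ) (b : Fin (np + 1)) :
    eLpNorm (c b) 2 μ * eLpNorm (chr p τ b) 2 μ
      ≤ eLpNorm (fun ω => ∑ a, c a ω * chr p τ a ω) 2 μ := by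
  have hχ : ∀ a, Measurable[sig p {τ}] (chr p τ a) :=
    fun a => measurable_chr_sig (Set.mem_singleton τ) a
  have hmem : ∀ a, MemLp (fun ω => c a ω * chr p τ a ω) 2 μ := fun a =>
    memLp_mul_of_indep hm (hp.sig_le _) hind (hc a) (hχ a) (hc2 a) (hp.memLp_two_chr τ a)
  have hX : MemLp (fun ω => ∑ a, c a ω * chr p τ a ω) 2 μ :=
    memLp_finsetSum _ fun a _ => hmem a
  rw [← eLpNorm_mul_of_indep hm (hp.sig_le _) hind (hc b) (hχ b)]
  -- For `a ≠ a'` the factor `c a * c a'` is independent of `chr a * chr a'`, which has mean zero.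
  -- So the terms are orthogonal and, by Pythagoras, each is dominated by the sum.
  have hint : ∀ a a', ∫ ω, (c a ω * chr p τ a ω) * (c a' ω * chr p τ a' ω) ∂μ
      = if a = a' then ∫ ω, (c a ω * chr p τ a ω) ^ 2 ∂μ else 0 := by
    intro a a'
    split_ifs with h
    · subst h; simp only [sq]
    · have e1 : ∀ ω, (c a ω * chr p τ a ω) * (c a' ω * chr p τ a' ω)
          = (c a ω * c a' ω) * (chr p τ a ω * chr p τ a' ω) := fun ω => by ring
      simp only [e1]
      rw [integral_mul_of_indep hm (hp.sig_le {τ}) hind (X := fun ω => c a ω * c a' ω)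
        (Y := fun ω => chr p τ a ω * chr p τ a' ω) ((hc a).mul (hc a')) ((hχ a).mul (hχ a')),
        hp.integral_chr_mul, if_neg h, mul_zero]
  have hsq : ∫ ω, (∑ a, c a ω * chr p τ a ω) ^ 2 ∂μ = ∑ a, ∫ ω, (c a ω * chr p τ a ω) ^ 2 ∂μ := by
    have e1 : ∀ ω, (∑ a, c a ω * chr p τ a ω) ^ 2
        = ∑ a, ∑ a', (c a ω * chr p τ a ω) * (c a' ω * chr p τ a' ω) := fun ω => by
      rw [sq, Finset.sum_mul_sum]
    simp only [e1]
    rw [integral_finsetSum _ fun a _ => integrable_finsetSum _ fun a' _ =>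
      integrable_mul_of_memLp_two (hmem a) (hmem a')]
    refine Finset.sum_congr rfl fun a _ => ?_
    rw [integral_finsetSum _ fun a' _ => integrable_mul_of_memLp_two (hmem a) (hmem a')]
    simp [hint]
  rw [← ENNReal.pow_le_pow_left_iff (n := 2) (by norm_num), ← ofReal_integral_sq (hmem b),
    ← ofReal_integral_sq hX, hsq]
  refine ENNReal.ofReal_le_ofReal ?_
  exact Finset.single_le_sum (f := fun a => ∫ ω, (c a ω * chr p τ a ω) ^ 2 ∂μ)
    (fun a _ => integral_nonneg fun ω => sq_nonneg _) (Finset.mem_univ b)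

end FourthMoments


/-! ### Signals linear in the scheduling at one time -/

section Linear

variable {Ω : Type*} {m m0 : MeasurableSpace Ω} {μ : Measure Ω} {np : ℕ}
  {p : ℤ → Ω → Fin np → ℝ}

/-- `X` is a linear combination of the entries of `[1; p(τ)]` with square-integrable
`m`-measurable coefficients. -/
def Lin (μ : Measure Ω) (p : ℤ → Ω → Fin np → ℝ) (m : MeasurableSpace Ω) (τ : ℤ) (X : Ω → ℝ) :
    Prop :=
  ∃ c : Fin (np + 1) → Ω → ℝ, (∀ a, Measurable[m] (c a)) ∧ (∀ a, MemLp (c a) 2 μ) ∧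
    X = fun ω => ∑ a, c a ω * chr p τ a ω

/-- Linear in `[1; p(τ)]` with coefficients that depend on the scheduling after time `τ`. -/
abbrev RL (μ : Measure Ω) (p : ℤ → Ω → Fin np → ℝ) (τ : ℤ) (X : Ω → ℝ) : Prop :=
  Lin μ p (sig p (Set.Ioi τ)) τ X

/-- Linear in `[1; p(τ)]` with coefficients that depend on the scheduling before time `τ`. -/
abbrev LL (μ : Measure Ω) (p : ℤ → Ω → Fin np → ℝ) (τ : ℤ) (X : Ω → ℝ) : Prop :=
  Lin μ p (sig p (Set.Iio τ)) τ X

variable {τ : ℤ} {X Y : Ω → ℝ}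

theorem Lin.zero : Lin μ p m τ (fun _ => 0) :=
  ⟨fun _ _ => 0, fun _ => measurable_const, fun _ => MemLp.zero, by ext; simp⟩

theorem Lin.single {c : Ω → ℝ} (a : Fin (np + 1)) (hc : Measurable[m] c) (hc2 : MemLp c 2 μ) :
    Lin μ p m τ (fun ω => c ω * chr p τ a ω) := by
  classical
  refine ⟨fun b => if b = a then c else 0, fun b => ?_, fun b => ?_, ?_⟩
  · dsimp only
    split_ifs
    exacts [hc, measurable_const]
  · dsimp only
    split_ifs
    exacts [hc2, MemLp.zero]
  · ext ω
    rw [Finset.sum_eq_single a]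
    · simp
    · intro b _ hb; simp [hb]
    · simp

theorem Lin.one [IsProbabilityMeasure μ] : Lin μ p m τ (fun _ => 1) := by
  simpa using Lin.single (p := p) (τ := τ) (m := m) (μ := μ) (c := fun _ => 1) 0 measurable_const
    (memLp_const 1)

theorem Lin.of_chr [IsProbabilityMeasure μ] (a : Fin (np + 1)) : Lin μ p m τ (chr p τ a) := by
  simpa using Lin.single (p := p) (τ := τ) (m := m) (μ := μ) (c := fun _ => 1) a measurable_const
    (memLp_const 1)

theorem Lin.add (hX : Lin μ p m τ X) (hY : Lin μ p m τ Y) :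
    Lin μ p m τ (fun ω => X ω + Y ω) := by
  obtain ⟨c, hc, hc2, rfl⟩ := hX
  obtain ⟨d, hd, hd2, rfl⟩ := hY
  refine ⟨fun a ω => c a ω + d a ω, fun a => (hc a).add (hd a), fun a => (hc2 a).add (hd2 a), ?_⟩
  ext ω
  simp only [add_mul, Finset.sum_add_distrib]

theorem Lin.const_mul (hX : Lin μ p m τ X) (r : ℝ) : Lin μ p m τ (fun ω => r * X ω) := by
  obtain ⟨c, hc, hc2, rfl⟩ := hX
  refine ⟨fun a ω => r * c a ω, fun a => measurable_const.mul (hc a),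
    fun a => (hc2 a).const_mul r, ?_⟩
  ext ω
  simp only [Finset.mul_sum, mul_assoc]

theorem Lin.neg (hX : Lin μ p m τ X) : Lin μ p m τ (fun ω => -X ω) := by
  simpa using hX.const_mul (-1)

theorem Lin.sum {ι : Type*} (s : Finset ι) {X : ι → Ω → ℝ} (h : ∀ i ∈ s, Lin μ p m τ (X i)) :
    Lin μ p m τ (fun ω => ∑ i ∈ s, X i ω) := by
  classical
  induction s using Finset.induction_on with
  | empty => exact Lin.zero
  | insert i s hi ih =>
    simp only [Finset.sum_insert hi]
    exact (h i (Finset.mem_insert_self i s)).add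
      (ih fun j hj => h j (Finset.mem_insert_of_mem hj))

theorem RL.measurable_sig (hX : RL μ p τ X) {S : Set ℤ} (hS : Set.Ici τ ⊆ S) :
    Measurable[sig p S] X := by
  obtain ⟨c, hc, -, rfl⟩ := hX
  refine Finset.measurable_sum _ fun a _ => ?_
  exact ((hc a).mono (sig_mono (Set.Ioi_subset_Ici_self.trans hS)) le_rfl).mul
    (measurable_chr_sig (hS Set.self_mem_Ici) a)

theorem LL.measurable_sig (hX : LL μ p τ X) {S : Set ℤ} (hS : Set.Iic τ ⊆ S) :
    Measurable[sig p S] X := by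
  obtain ⟨c, hc, -, rfl⟩ := hX
  refine Finset.measurable_sum _ fun a _ => ?_
  exact ((hc a).mono (sig_mono (Set.Iio_subset_Iic_self.trans hS)) le_rfl).mul
    (measurable_chr_sig (hS Set.self_mem_Iic) a)

theorem IsWhiteScheduling.indep_Ioi {n : ℕ} (hp : IsWhiteScheduling μ p n) (τ : ℤ) : Indep (sig p (Set.Ioi τ)) (sig p {τ}) μ :=
  hp.indep_sig (by simp)

theorem IsWhiteScheduling.indep_Iio {n : ℕ} (hp : IsWhiteScheduling μ p n) (τ : ℤ) : Indep (sig p (Set.Iio τ)) (sig p {τ}) μ :=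
  hp.indep_sig (by simp)

theorem IsWhiteScheduling.indep_Ioi_Iic {n : ℕ} (hp : IsWhiteScheduling μ p n) (τ : ℤ) :
    Indep (sig p (Set.Ioi τ)) (sig p (Set.Iic τ)) μ :=
  hp.indep_sig (by rw [Set.disjoint_left]; intro x; simp)

theorem IsWhiteScheduling.indep_Ici_Iio {n : ℕ} (hp : IsWhiteScheduling μ p n) (τ : ℤ) :
    Indep (sig p (Set.Ici τ)) (sig p (Set.Iio τ)) μ :=
  hp.indep_sig (by rw [Set.disjoint_left]; intro x; simp)

variable [IsProbabilityMeasure μ] (hp : IsWhiteScheduling μ p 4)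

include hp

theorem IsWhiteScheduling.memLp_lin (hm : m ≤ m0) (hind : Indep m (sig p {τ}) μ)
    (hX : Lin μ p m τ X) : MemLp X 2 μ := by
  obtain ⟨c, hc, hc2, rfl⟩ := hX
  exact memLp_finsetSum _ fun a _ => memLp_mul_of_indep hm (hp.sig_le _) hind (hc a)
    (measurable_chr_sig (Set.mem_singleton τ) a) (hc2 a) (hp.memLp_two_chr τ a)

theorem IsWhiteScheduling.memLp_rl (hX : RL μ p τ X) : MemLp X 2 μ :=
  hp.memLp_lin (hp.sig_le _) (hp.indep_Ioi τ) hX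

theorem IsWhiteScheduling.memLp_ll (hX : LL μ p τ X) : MemLp X 2 μ :=
  hp.memLp_lin (hp.sig_le _) (hp.indep_Iio τ) hX

/-- The product of a signal that is linear in `[1; p(τ)]` with future coefficients and one with
past coefficients is square integrable. -/
theorem IsWhiteScheduling.exists_eLpNorm_mul_le : ∃ κ : ℝ≥0, 1 ≤ κ ∧ ∀ τ X Y, RL μ p τ X →
    LL μ p τ Y → eLpNorm (fun ω => X ω * Y ω) 2 μ ≤ κ * eLpNorm X 2 μ * eLpNorm Y 2 μ := by
  obtain ⟨Q, -, hQ⟩ := hp.exists_eLpNorm_chr_mul_le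
  set s : Fin (np + 1) → ℝ≥0 := fun a => (eLpNorm (chr p 0 a) 2 μ).toNNReal
  have hs : ∀ τ a, eLpNorm (chr p τ a) 2 μ = s a := fun τ a => by
    rw [hp.eLpNorm_chr τ a, ENNReal.coe_toNNReal (hp.memLp_two_chr 0 a).2.ne]
  have hs0 : ∀ a, s a ≠ 0 := fun a h => hp.eLpNorm_chr_ne_zero 0 a (by rw [hs, h]; rfl)
  clear_value s
  refine ⟨1 + ∑ b, ∑ a, (s b)⁻¹ * Q * (s a)⁻¹, le_self_add, ?_⟩
  rintro τ X Y hX hY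
  obtain ⟨c, hc, hc2, hXe⟩ := hX
  obtain ⟨d, hd, hd2, hYe⟩ := hY
  -- Orthogonality of the entries of `[1; p(τ)]` recovers bounds on the coefficients from the norm
  -- of the combination; this is why linearity at `τ` is required and not only measurability.
  have hcX : ∀ b, eLpNorm (c b) 2 μ ≤ (s b)⁻¹ * eLpNorm X 2 μ := fun b => by
    have := hp.eLpNorm_coeff_le (hp.sig_le _) (hp.indep_Ioi τ) hc hc2 b
    rw [← hXe, hs] at this
    rw [ENNReal.coe_inv (hs0 b), ← ENNReal.div_eq_inv_mul]
    exact (ENNReal.le_div_iff_mul_le (Or.inl (by simpa using hs0 b))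
      (Or.inl ENNReal.coe_ne_top)).2 this
  have hdY : ∀ b, eLpNorm (d b) 2 μ ≤ (s b)⁻¹ * eLpNorm Y 2 μ := fun b => by
    have := hp.eLpNorm_coeff_le (hp.sig_le _) (hp.indep_Iio τ) hd hd2 b
    rw [← hYe, hs] at this
    rw [ENNReal.coe_inv (hs0 b), ← ENNReal.div_eq_inv_mul]
    exact (ENNReal.le_div_iff_mul_le (Or.inl (by simpa using hs0 b))
      (Or.inl ENNReal.coe_ne_top)).2 this
  have hχ : ∀ a S, τ ∈ S → Measurable[sig p S] (chr p τ a) :=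
    fun a S hS => measurable_chr_sig hS a
  -- Three independent factors: a coefficient from the future of `τ`, a product of two entries at
  -- `τ`, a coefficient from the past of `τ`. Only the middle one needs fourth moments.
  have hterm : ∀ b a, eLpNorm (fun ω => c b ω * ((chr p τ b ω * chr p τ a ω) * d a ω)) 2 μ
      ≤ ((s b)⁻¹ * Q * (s a)⁻¹ : ℝ≥0) * eLpNorm X 2 μ * eLpNorm Y 2 μ := fun b a => by
    rw [eLpNorm_mul_of_indep (hp.sig_le _) (hp.sig_le _) (hp.indep_Ioi_Iic τ) (hc b)
      (Y := fun ω => (chr p τ b ω * chr p τ a ω) * d a ω)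
      (((hχ b _ Set.self_mem_Iic).mul (hχ a _ Set.self_mem_Iic)).mul
        ((hd a).mono (sig_mono Set.Iio_subset_Iic_self) le_rfl)),
      eLpNorm_mul_of_indep (hp.sig_le {τ}) (hp.sig_le _) (hp.indep_Iio τ).symm
        (X := fun ω => chr p τ b ω * chr p τ a ω)
        ((hχ b _ (Set.mem_singleton τ)).mul (hχ a _ (Set.mem_singleton τ))) (hd a)]
    calc _ ≤ ((s b)⁻¹ * eLpNorm X 2 μ) * (Q * ((s a)⁻¹ * eLpNorm Y 2 μ)) := by
          gcongr
          exacts [hcX b, hQ τ b a, hdY a]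
      _ = _ := by push_cast; ring
  have hmeas : ∀ b a, AEStronglyMeasurable
      (fun ω => c b ω * ((chr p τ b ω * chr p τ a ω) * d a ω)) μ := fun b a =>
    ((hc2 b).1.mul ((((hp.measurable_chr τ b).mul (hp.measurable_chr τ a)).aestronglyMeasurable).mul
      (hd2 a).1))
  have hexp : (fun ω => X ω * Y ω) = fun ω => ∑ b, ∑ a,
      c b ω * ((chr p τ b ω * chr p τ a ω) * d a ω) := by
    ext ω
    rw [hXe, hYe]
    simp only [Finset.sum_mul_sum]
    exact Finset.sum_congr rfl fun b _ => Finset.sum_congr rfl fun a _ => by ring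
  rw [hexp]
  calc _ ≤ ∑ b, eLpNorm (fun ω => ∑ a, c b ω * ((chr p τ b ω * chr p τ a ω) * d a ω)) 2 μ :=
        eLpNorm_finset_sum_le _ fun b _ => by
          have := Finset.aestronglyMeasurable_sum Finset.univ fun a _ => hmeas b a
          rwa [Finset.sum_fn] at this
    _ ≤ ∑ b, ∑ a, ((s b)⁻¹ * Q * (s a)⁻¹ : ℝ≥0) * eLpNorm X 2 μ * eLpNorm Y 2 μ :=
        Finset.sum_le_sum fun b _ => (eLpNorm_finset_sum_le _ fun a _ => hmeas b a).trans
          (Finset.sum_le_sum fun a _ => hterm b a)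
    _ = ((∑ b, ∑ a, (s b)⁻¹ * Q * (s a)⁻¹ : ℝ≥0) : ℝ≥0∞) * eLpNorm X 2 μ * eLpNorm Y 2 μ := by
        simp only [ENNReal.ofNNReal_finsetSum, Finset.sum_mul]
    _ ≤ _ := by
        gcongr
        exact le_add_self

end Linear

/-! ### Products of the scheduling along strings -/

section Strings

variable {Ω : Type*} {m0 : MeasurableSpace Ω} {μ : Measure Ω} {np : ℕ}
  {p : ℤ → Ω → Fin np → ℝ}

/-- The signal `p_η(t)` as a random variable. -/
def sprod (p : ℤ → Ω → Fin np → ℝ) (t : ℤ) {n : ℕ} (η : Fin n → Fin (np + 1)) (ω : Ω) : ℝ :=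
  schedProd (fun s => p s ω) t η

theorem sprod_eq_prod (t : ℤ) {n : ℕ} (η : Fin n → Fin (np + 1)) (ω : Ω) :
    sprod p t η ω = ∏ j : Fin n, chr p (t - (j : ℤ)) (η j) ω := rfl

@[simp] theorem sprod_nil (t : ℤ) (η : Fin 0 → Fin (np + 1)) (ω : Ω) : sprod p t η ω = 1 := by
  simp [sprod_eq_prod]

theorem sprod_succ (t : ℤ) {n : ℕ} (η : Fin (n + 1) → Fin (np + 1)) (ω : Ω) :
    sprod p t η ω = chr p t (η 0) ω * sprod p (t - 1) (Fin.tail η) ω := by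
  simp only [sprod_eq_prod, Fin.prod_univ_succ, Fin.tail]
  congr 1
  · simp
  · refine Finset.prod_congr rfl fun j _ => ?_
    congr 1
    push_cast [Fin.val_succ]
    ring

theorem sprod_last (t : ℤ) {n : ℕ} (η : Fin (n + 1) → Fin (np + 1)) (ω : Ω) :
    sprod p t η ω = sprod p t (Fin.init η) ω * chr p (t - n) (η (Fin.last n)) ω := by
  simp only [sprod_eq_prod, Fin.prod_univ_castSucc, Fin.init]
  simp

theorem measurable_sprod_sig {S : Set ℤ} {t : ℤ} {n : ℕ} (η : Fin n → Fin (np + 1))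
    (h : ∀ j : ℕ, j < n → t - j ∈ S) : Measurable[sig p S] (sprod p t η) :=
  Finset.measurable_fun_prod (f := fun (j : Fin n) => chr p (t - (j : ℤ)) (η j)) Finset.univ
    fun j _ => measurable_chr_sig (h j j.2) (η j)

theorem IsWhiteScheduling.measurable_sprod {m : ℕ} (hp : IsWhiteScheduling μ p m) (t : ℤ) {n : ℕ} (η : Fin n → Fin (np + 1)) :
    Measurable (sprod p t η) :=
  (measurable_sprod_sig η fun _ _ => Set.mem_univ _).mono (hp.sig_le _) le_rfl

variable [IsProbabilityMeasure μ] (hp : IsWhiteScheduling μ p 4)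

include hp

theorem IsWhiteScheduling.eLpNorm_sprod (t : ℤ) {n : ℕ} (η : Fin n → Fin (np + 1)) :
    eLpNorm (sprod p t η) 2 μ = ∏ j, eLpNorm (chr p 0 (η j)) 2 μ := by
  induction n generalizing t with
  | zero =>
    have : sprod p t η = fun _ => 1 := by ext; simp
    rw [this]
    rw [eLpNorm_const _ two_ne_zero (IsProbabilityMeasure.ne_zero μ)]
    simp
  | succ n ih =>
    have : sprod p t η = fun ω => chr p t (η 0) ω * sprod p (t - 1) (Fin.tail η) ω := by
      ext ω
      rw [sprod_succ]
    rw [this, eLpNorm_mul_of_indep (hp.sig_le _) (hp.sig_le _) (hp.indep_Ici_Iio t)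
      (measurable_chr_sig Set.self_mem_Ici _) (measurable_sprod_sig _ fun j _ => ?_), ih,
      Fin.prod_univ_succ, hp.eLpNorm_chr t]
    · rfl
    · simp only [Set.mem_Iio]
      omega

theorem IsWhiteScheduling.memLp_sprod (t : ℤ) {n : ℕ} (η : Fin n → Fin (np + 1)) :
    MemLp (sprod p t η) 2 μ := by
  induction n generalizing t with
  | zero =>
    have : sprod p t η = fun _ => 1 := by ext; simp
    rw [this]
    exact memLp_const 1
  | succ n ih =>
    have : sprod p t η = fun ω => sprod p (t - 1) (Fin.tail η) ω * chr p t (η 0) ω := by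
      ext ω
      rw [sprod_succ, mul_comm]
    rw [this]
    refine hp.memLp_ll (Lin.single (τ := t) (η 0) (measurable_sprod_sig _ fun j _ => ?_) (ih _ _))
    simp only [Set.mem_Iio]
    omega

theorem IsWhiteScheduling.ll_sprod (t : ℤ) {n : ℕ} (η : Fin (n + 1) → Fin (np + 1)) :
    LL μ p t (sprod p t η) := by
  have : sprod p t η = fun ω => sprod p (t - 1) (Fin.tail η) ω * chr p t (η 0) ω := by
    ext ω
    rw [sprod_succ, mul_comm]
  rw [this]
  refine Lin.single (τ := t) (η 0) (measurable_sprod_sig _ fun j _ => ?_) (hp.memLp_sprod _ _)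
  simp only [Set.mem_Iio]
  omega

theorem IsWhiteScheduling.memLp_mul {τ : ℤ} {X Y : Ω → ℝ} (hX : RL μ p τ X) (hY : LL μ p τ Y) :
    MemLp (fun ω => X ω * Y ω) 2 μ := by
  obtain ⟨κ, -, hκ⟩ := hp.exists_eLpNorm_mul_le
  refine ⟨(hp.memLp_rl hX).1.mul (hp.memLp_ll hY).1, (hκ τ X Y hX hY).trans_lt ?_⟩
  exact ENNReal.mul_lt_top (ENNReal.mul_lt_top ENNReal.coe_lt_top (hp.memLp_rl hX).2)
    (hp.memLp_ll hY).2

/-- The string meets `X` only at time `t`. Once its last character is split off, the product of `X`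
with the rest is square integrable by `memLp_mul` and lives strictly after `t'`; it becomes the
coefficient of that last character. Length at least two keeps the two ends at different times. -/
theorem IsWhiteScheduling.rl_mul_sprod {t t' : ℤ} {X : Ω → ℝ} (hX : RL μ p t X) {n : ℕ}
    (η : Fin (n + 2) → Fin (np + 1)) (ht : t' = t - (n + 1)) :
    RL μ p t' (fun ω => X ω * sprod p t η ω) := by
  subst ht
  have : (fun ω => X ω * sprod p t η ω)
      = fun ω => X ω * sprod p t (Fin.init η) ω * chr p (t - (n + 1)) (η (Fin.last _)) ω := by
    ext ω
    rw [sprod_last, mul_assoc]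
    push_cast
    rfl
  rw [this]
  refine Lin.single (τ := t - (n + 1)) (η (Fin.last _)) ?_ (hp.memLp_mul hX (hp.ll_sprod t _))
  refine (hX.measurable_sig fun s hs => ?_).mul (measurable_sprod_sig _ fun j hj => ?_)
  · simp only [Set.mem_Ici, Set.mem_Ioi] at hs ⊢
    omega
  · simp only [Set.mem_Ioi]
    omega

theorem IsWhiteScheduling.rl_sprod {t t' : ℤ} {n : ℕ} (η : Fin (n + 1) → Fin (np + 1))
    (ht : t' = t - n) : RL μ p t' (sprod p t η) := by
  subst ht
  cases n with
  | zero =>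
    have : sprod p t η = chr p (t - (0 : ℕ)) (η 0) := by
      ext ω
      rw [sprod_succ]
      simp
    rw [this]
    exact Lin.of_chr _
  | succ n =>
    simpa using hp.rl_mul_sprod (t := t) (X := fun _ => 1) Lin.one η
      (t' := t - (n + 1 : ℕ)) (by push_cast; ring)

/-- Mirror image of `rl_mul_sprod`: the first character is split off instead of the last. -/
theorem IsWhiteScheduling.ll_sprod_mul {t t' : ℤ} {Y : Ω → ℝ} {n : ℕ}
    (η : Fin (n + 2) → Fin (np + 1)) (ht : t' = t - (n + 1)) (hY : LL μ p t' Y) :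
    LL μ p t (fun ω => sprod p t η ω * Y ω) := by
  have : (fun ω => sprod p t η ω * Y ω)
      = fun ω => sprod p (t - 1) (Fin.tail η) ω * Y ω * chr p t (η 0) ω := by
    ext ω
    rw [sprod_succ]
    ring
  rw [this]
  refine Lin.single (τ := t) (η 0) ?_
    (hp.memLp_mul (hp.rl_sprod (Fin.tail η) (by rw [ht]; ring)) hY)
  refine (measurable_sprod_sig _ fun j hj => ?_).mul (hY.measurable_sig fun s hs => ?_)
  · simp only [Set.mem_Iio]
    omega
  · simp only [Set.mem_Iic, Set.mem_Iio] at hs ⊢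
    omega

end Strings


/-! ### The algebra of time-varying causal filters -/

section Kernels

variable {ny : ℕ}

/-- Causal time-varying filters, given by their coefficients at each time and lag. -/
abbrev Ker (ny : ℕ) : Type := ℤ → ℕ → Matrix (Fin ny) (Fin ny) ℝ

/-- Composition of filters. -/
def conv (F G : Ker ny) : Ker ny := fun t n =>
  ∑ x ∈ Finset.HasAntidiagonal.antidiagonal n, F t x.1 * G (t - x.1) x.2

/-- The identity filter. -/
def kone (ny : ℕ) : Ker ny := fun _ n => if n = 0 then 1 else 0

@[simp] theorem conv_kone (F : Ker ny) : conv F (kone ny) = F := by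
  ext t n : 2
  rw [conv, Finset.sum_eq_single (n, 0)]
  · simp [kone]
  · rintro ⟨a, b⟩ hab hne
    have : b ≠ 0 := fun h => hne (by simp [h] at hab; simp [h, hab])
    simp [kone, this]
  · simp

@[simp] theorem kone_conv (F : Ker ny) : conv (kone ny) F = F := by
  ext t n : 2
  rw [conv, Finset.sum_eq_single (0, n)]
  · simp [kone]
  · rintro ⟨a, b⟩ hab hne
    have : a ≠ 0 := fun h => hne (by simp [h] at hab; simp [h, hab])
    simp [kone, this]
  · simp

theorem conv_assoc (F G H : Ker ny) : conv (conv F G) H = conv F (conv G H) := by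
  ext t n : 2
  simp only [conv, Finset.sum_mul, Finset.mul_sum]
  rw [Finset.sum_sigma', Finset.sum_sigma']
  refine Finset.sum_nbij' (fun x => ⟨(x.2.1, x.2.2 + x.1.2), (x.2.2, x.1.2)⟩)
    (fun x => ⟨(x.1.1 + x.2.1, x.2.2), (x.1.1, x.2.1)⟩) ?_ ?_ ?_ ?_ ?_
  · rintro ⟨⟨a, b⟩, ⟨c, d⟩⟩ h
    simp only [Finset.mem_sigma, Finset.HasAntidiagonal.mem_antidiagonal, and_true] at h ⊢
    omega
  · rintro ⟨⟨a, b⟩, ⟨c, d⟩⟩ h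
    simp only [Finset.mem_sigma, Finset.HasAntidiagonal.mem_antidiagonal, and_true] at h ⊢
    omega
  · rintro ⟨⟨a, b⟩, ⟨c, d⟩⟩ h
    simp only [Finset.mem_sigma, Finset.HasAntidiagonal.mem_antidiagonal] at h
    simp [h.2]
  · rintro ⟨⟨a, b⟩, ⟨c, d⟩⟩ h
    simp only [Finset.mem_sigma, Finset.HasAntidiagonal.mem_antidiagonal] at h
    simp [h.2]
  · rintro ⟨⟨a, b⟩, ⟨c, d⟩⟩ h
    simp only [Finset.mem_sigma, Finset.HasAntidiagonal.mem_antidiagonal] at h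
    simp only [← h.2, Matrix.mul_assoc]
    push_cast
    rw [sub_sub]

theorem conv_sub (F G H : Ker ny) : conv F (G - H) = conv F G - conv F H := by
  ext t n : 2
  simp [conv, mul_sub]

theorem sub_conv (F G H : Ker ny) : conv (F - G) H = conv F H - conv G H := by
  ext t n : 2
  simp [conv, sub_mul]

/-- The coefficient of lag `n` of the composition is `F t n` plus terms with lower lags of `F`,
which vanish by induction. -/
theorem eq_zero_of_conv_eq_zero {F G : Ker ny} (hG : ∀ t, G t 0 = 1) (h : conv F G = 0) :
    F = 0 := by
  ext t n : 2
  induction n using Nat.strong_induction_on with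
  | _ n ih =>
    have h1 := congrFun (congrFun h t) n
    rw [conv, Finset.sum_eq_single (n, 0)] at h1
    · simpa [hG] using h1
    · rintro ⟨a, b⟩ hab hne
      simp only [Finset.HasAntidiagonal.mem_antidiagonal] at hab
      have hb : b ≠ 0 := fun hb => hne (by simp [hb] at hab; simp [hb, hab])
      have h2 := ih a (by omega)
      simp only [Pi.zero_apply] at h2
      simp [h2]
    · simp

/-- `(GF - 1)G = G(FG) - G = 0`, and a monic `G` cancels on the right. Hence a left inverse is also
a right inverse. -/
theorem conv_eq_kone_comm {F G : Ker ny} (hG : ∀ t, G t 0 = 1) (h : conv F G = kone ny) :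
    conv G F = kone ny := by
  have h1 : conv (conv G F - kone ny) G = 0 := by
    rw [sub_conv, conv_assoc, h, conv_kone, kone_conv, sub_self]
  exact sub_eq_zero.1 (eq_zero_of_conv_eq_zero hG h1)

theorem conv_succ_right (F G : Ker ny) (t : ℤ) (n : ℕ) :
    conv F G t (n + 1) = F t (n + 1) * G (t - (n + 1 : ℕ)) 0
      + ∑ x ∈ Finset.HasAntidiagonal.antidiagonal n, F t x.1 * G (t - x.1) (x.2 + 1) := by
  rw [conv, Finset.Nat.sum_antidiagonal_succ', add_comm]

theorem conv_succ_left (F G : Ker ny) (t : ℤ) (n : ℕ) :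
    conv F G t (n + 1) = F t 0 * G t (n + 1)
      + ∑ x ∈ Finset.HasAntidiagonal.antidiagonal n, F t (x.1 + 1) * G (t - (x.1 + 1 : ℕ)) x.2 := by
  rw [conv, Finset.Nat.sum_antidiagonal_succ]
  simp

end Kernels

/-! ### Filters of the model and the resolvent identity -/

section ModelKernels

variable {ny nu np nb nc : ℕ}

/-- The sub-Markov parameters of the noise filter. -/
abbrev NoisePar (ny np nc : ℕ) : Type :=
  (k : Fin nc) → (Fin ((k : ℕ) + 2) → Fin (np + 1)) → Fin ny → Fin ny → ℝ

/-- The strictly causal filter with sub-Markov parameters `h`. -/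
def sker (h : NoisePar ny np nc) (p : ℤ → Fin np → ℝ) : Ker ny
  | _, 0 => 0
  | t, k + 1 =>
    if hk : k < nc then
      ∑ η : Fin (k + 2) → Fin (np + 1), schedProd p t η • Matrix.of (h ⟨k, hk⟩ η)
    else 0

theorem sker_zero_lag (h : NoisePar ny np nc) (p : ℤ → Fin np → ℝ) (t : ℤ) : sker h p t 0 = 0 := rfl

theorem noiseCoeff_eq (θ : Params ny nu np nb nc) (p : ℤ → Fin np → ℝ) :
    noiseCoeff θ p = kone ny + sker θ.2 p := by
  ext t n : 2
  cases n with
  | zero => simp [noiseCoeff, kone, sker]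
  | succ n => simp [noiseCoeff, kone, sker]

theorem sker_sub (h h' : NoisePar ny np nc) (p : ℤ → Fin np → ℝ) :
    sker (h - h') p = sker h p - sker h' p := by
  ext t n i j
  cases n with
  | zero => simp [sker]
  | succ n =>
    simp only [sker, Pi.sub_apply]
    split_ifs
    · simp [Matrix.sum_apply, mul_sub]
    · simp

theorem sker_smul (r : ℝ) (h : NoisePar ny np nc) (p : ℤ → Fin np → ℝ) (t : ℤ) (n : ℕ) :
    sker (r • h) p t n = r • sker h p t n := by
  ext i j
  cases n with
  | zero => simp [sker]
  | succ n =>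
    simp only [sker, Pi.smul_apply]
    split_ifs
    · simp [Matrix.sum_apply, Finset.mul_sum, mul_left_comm]
    · simp

theorem sker_eq_zero (h : NoisePar ny np nc) (p : ℤ → Fin np → ℝ) (t : ℤ) {n : ℕ} (hn : nc < n) :
    sker h p t n = 0 := by
  cases n with
  | zero => simp [sker]
  | succ n => simp [sker, show ¬ n < nc by omega]

theorem noiseCoeff_zero_lag (θ : Params ny nu np nb nc) (p : ℤ → Fin np → ℝ) (t : ℤ) :
    noiseCoeff θ p t 0 = 1 := by
  simp [noiseCoeff]

theorem invNoiseCoeff_conv_noiseCoeff (θ : Params ny nu np nb nc) (p : ℤ → Fin np → ℝ) :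
    conv (invNoiseCoeff θ p) (noiseCoeff θ p) = kone ny := by
  ext t n : 2
  cases n with
  | zero => simp [conv, noiseCoeff_zero_lag, invNoiseCoeff, kone]
  | succ n =>
    rw [conv_succ_right, noiseCoeff_zero_lag, mul_one, invNoiseCoeff,
      Finset.Nat.sum_antidiagonal_eq_sum_range_succ
        (fun a b => invNoiseCoeff θ p t a * noiseCoeff θ p (t - a) (b + 1)),
      ← Finset.sum_range_reflect, Finset.sum_range]
    simp only [kone, Nat.add_eq_zero_iff, one_ne_zero, and_false, if_false]
    rw [neg_add_eq_zero]
    refine Finset.sum_congr rfl fun j _ => ?_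
    have hj := j.2
    have e1 : n + 1 - 1 - (j : ℕ) = n - j := by omega
    have e2 : n - (n - (j : ℕ)) = j := by omega
    have e3 : t - (n : ℤ) + (j : ℤ) = t - ((n - (j : ℕ) : ℕ) : ℤ) := by omega
    rw [e1, e2, e3]

theorem noiseCoeff_conv_invNoiseCoeff (θ : Params ny nu np nb nc) (p : ℤ → Fin np → ℝ) :
    conv (noiseCoeff θ p) (invNoiseCoeff θ p) = kone ny :=
  conv_eq_kone_comm (noiseCoeff_zero_lag θ p) (invNoiseCoeff_conv_noiseCoeff θ p)

theorem invNoiseCoeff_zero_lag (θ : Params ny nu np nb nc) (p : ℤ → Fin np → ℝ) (t : ℤ) :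
    invNoiseCoeff θ p t 0 = 1 := by
  rw [invNoiseCoeff]

theorem invNoiseCoeff_succ_right (θ : Params ny nu np nb nc) (p : ℤ → Fin np → ℝ) (t : ℤ)
    (n : ℕ) : invNoiseCoeff θ p t (n + 1) =
      -∑ x ∈ Finset.HasAntidiagonal.antidiagonal n, invNoiseCoeff θ p t x.1 * sker θ.2 p (t - x.1) (x.2 + 1) := by
  have h := congrFun (congrFun (invNoiseCoeff_conv_noiseCoeff θ p) t) (n + 1)
  rw [conv_succ_right, noiseCoeff_zero_lag, mul_one] at h
  simp only [noiseCoeff_eq, kone, Pi.add_apply, Nat.add_eq_zero_iff, one_ne_zero, and_false,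
    if_false, zero_add] at h
  exact eq_neg_of_add_eq_zero_left h

theorem invNoiseCoeff_succ_left (θ : Params ny nu np nb nc) (p : ℤ → Fin np → ℝ) (t : ℤ)
    (n : ℕ) : invNoiseCoeff θ p t (n + 1) =
      -∑ x ∈ Finset.HasAntidiagonal.antidiagonal n,
        sker θ.2 p t (x.1 + 1) * invNoiseCoeff θ p (t - (x.1 + 1 : ℕ)) x.2 := by
  have h := congrFun (congrFun (noiseCoeff_conv_invNoiseCoeff θ p) t) (n + 1)
  rw [conv_succ_left, noiseCoeff_zero_lag, one_mul] at h
  simp only [noiseCoeff_eq, kone, Pi.add_apply, Nat.add_eq_zero_iff, one_ne_zero, and_false,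
    if_false, zero_add] at h
  exact eq_neg_of_add_eq_zero_left h

/-- The resolvent identity for inverse noise filters. -/
theorem invNoiseCoeff_eq_sub (θ θ' : Params ny nu np nb nc) (p : ℤ → Fin np → ℝ) :
    invNoiseCoeff θ' p = invNoiseCoeff θ p
      - conv (conv (invNoiseCoeff θ' p) (sker (θ'.2 - θ.2) p)) (invNoiseCoeff θ p) := by
  have h : sker (θ'.2 - θ.2) p = noiseCoeff θ' p - noiseCoeff θ p := by
    rw [sker_sub, noiseCoeff_eq, noiseCoeff_eq]
    abel
  -- `Γ'(C' - C)Γ = Γ - Γ'`, using `Γ'C' = 1` and `CΓ = 1`.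
  rw [h, conv_sub, invNoiseCoeff_conv_noiseCoeff, sub_conv, kone_conv, conv_assoc,
    noiseCoeff_conv_invNoiseCoeff, conv_kone]
  abel

end ModelKernels


/-! ### Filters with random coefficients in mean square -/

section RandomKernels

variable {Ω : Type*} {m0 : MeasurableSpace Ω} {μ : Measure Ω} {ny nu np nb nc : ℕ}
  {p : ℤ → Ω → Fin np → ℝ}

/-- The scheduling trajectory of the outcome `ω`. -/
abbrev sched (p : ℤ → Ω → Fin np → ℝ) (ω : Ω) : ℤ → Fin np → ℝ := fun s => p s ω

/-- The coefficients of `F` propagate linearity in the scheduling from the left end of a string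
to its right end. -/
def RKer (μ : Measure Ω) (p : ℤ → Ω → Fin np → ℝ) (F : Ω → Ker ny) : Prop :=
  ∀ (t : ℤ) (k : ℕ) i l (X : Ω → ℝ), RL μ p t X →
    RL μ p (t - k) (fun ω => X ω * F ω t k i l)

/-- The coefficients of `F` propagate linearity in the scheduling from the right end of a string
to its left end. -/
def LKer (μ : Measure Ω) (p : ℤ → Ω → Fin np → ℝ) (F : Ω → Ker ny) : Prop :=
  ∀ (t : ℤ) (k : ℕ) i l (Y : Ω → ℝ), LL μ p (t - k) Y →
    LL μ p t (fun ω => F ω t k i l * Y ω)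

/-- Geometric decay in mean square of the coefficients of a filter. -/
def KBd (μ : Measure Ω) (F : Ω → Ker ny) (K r : ℝ≥0) : Prop :=
  ∀ (t : ℤ) (k : ℕ) i l, eLpNorm (fun ω => F ω t k i l) 2 μ ≤ (K * r ^ k : ℝ≥0)

/-- `κ` bounds the mean square of products of future and past signals sharing one time. -/
def Junction (μ : Measure Ω) (p : ℤ → Ω → Fin np → ℝ) (κ : ℝ≥0) : Prop :=
  ∀ τ X Y, RL μ p τ X → LL μ p τ Y →
    eLpNorm (fun ω => X ω * Y ω) 2 μ ≤ κ * eLpNorm X 2 μ * eLpNorm Y 2 μ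

theorem sker_apply_succ (h : NoisePar ny np nc) (t : ℤ) (k : ℕ) (i l : Fin ny) (ω : Ω) :
    sker h (sched p ω) t (k + 1) i l = if hk : k < nc then
      ∑ η : Fin (k + 2) → Fin (np + 1), h ⟨k, hk⟩ η i l * sprod p t η ω else 0 := by
  simp only [sker]
  split_ifs
  · simp [Matrix.sum_apply, sprod, mul_comm]
  · simp

theorem RKer.one : RKer μ p (fun _ => kone ny) := by
  intro t k i l X hX
  simp only [kone]
  split_ifs with hk
  · subst hk
    simp only [mul_comm (X _)]
    simpa using hX.const_mul _
  · simpa using Lin.zero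

theorem LKer.one : LKer μ p (fun _ => kone ny) := by
  intro t k i l X hX
  simp only [kone]
  split_ifs with hk
  · subst hk
    simpa using hX.const_mul _
  · simpa using Lin.zero

theorem RKer.add {F G : Ω → Ker ny} (hF : RKer μ p F) (hG : RKer μ p G) :
    RKer μ p (fun ω => F ω + G ω) := by
  intro t k i l X hX
  have := (hF t k i l X hX).add (hG t k i l X hX)
  simpa [mul_add] using this

theorem LKer.add {F G : Ω → Ker ny} (hF : LKer μ p F) (hG : LKer μ p G) :
    LKer μ p (fun ω => F ω + G ω) := by
  intro t k i l X hX
  have := (hF t k i l X hX).add (hG t k i l X hX)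
  simpa [add_mul] using this

theorem RKer.conv {F G : Ω → Ker ny} (hF : RKer μ p F) (hG : RKer μ p G) :
    RKer μ p (fun ω => conv (F ω) (G ω)) := by
  intro t k i l X hX
  have : ∀ x ∈ Finset.HasAntidiagonal.antidiagonal k, RL μ p (t - k)
      (fun ω => ∑ q, X ω * F ω t x.1 i q * G ω (t - x.1) x.2 q l) := by
    intro x hx
    rw [Finset.HasAntidiagonal.mem_antidiagonal] at hx
    refine Lin.sum _ fun q _ => ?_
    have h := hG (t - x.1) x.2 q l _ (hF t x.1 i q X hX)
    have e : t - (x.1 : ℤ) - (x.2 : ℤ) = t - k := by omega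
    rwa [e] at h
  have h2 := Lin.sum _ this
  convert h2 using 2 with ω
  simp only [LPVMAX.conv, Matrix.sum_apply, Matrix.mul_apply, Finset.mul_sum, mul_assoc]

variable [IsProbabilityMeasure μ] (hp : IsWhiteScheduling μ p 4)

theorem RKer.rl {F : Ω → Ker ny} (hF : RKer μ p F) (t : ℤ) (k : ℕ) (i l : Fin ny) :
    RL μ p (t - k) (fun ω => F ω t k i l) := by
  simpa using hF t k i l (fun _ => 1) Lin.one

theorem LKer.ll {F : Ω → Ker ny} (hF : LKer μ p F) (t : ℤ) (k : ℕ) (i l : Fin ny) :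
    LL μ p t (fun ω => F ω t k i l) := by
  simpa using hF t k i l (fun _ => 1) Lin.one

include hp

theorem RKer.memLp {F : Ω → Ker ny} (hF : RKer μ p F) (t : ℤ) (k : ℕ) (i l : Fin ny) :
    MemLp (fun ω => F ω t k i l) 2 μ := hp.memLp_rl (hF.rl t k i l)

theorem RKer.measurable {F : Ω → Ker ny} (hF : RKer μ p F) (t : ℤ) (k : ℕ) (i l : Fin ny) :
    Measurable (fun ω => F ω t k i l) :=
  ((hF.rl t k i l).measurable_sig (Set.subset_univ _)).mono (hp.sig_le _) le_rfl

theorem IsWhiteScheduling.rker_sker (h : NoisePar ny np nc) :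
    RKer μ p (fun ω => sker h (sched p ω)) := by
  intro t k i l X hX
  cases k with
  | zero => simpa [sker] using Lin.zero
  | succ k =>
    simp only [sker_apply_succ]
    split_ifs with hk
    · have := Lin.sum Finset.univ (fun (η : Fin (k + 2) → Fin (np + 1)) _ =>
        (hp.rl_mul_sprod hX η (t' := t - (k + 1 : ℕ)) (by push_cast; ring)).const_mul
          (h ⟨k, hk⟩ η i l))
      convert this using 2 with ω
      rw [Finset.mul_sum]
      exact Finset.sum_congr rfl fun η _ => by ring
    · simpa using Lin.zero

theorem IsWhiteScheduling.lker_sker (h : NoisePar ny np nc) :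
    LKer μ p (fun ω => sker h (sched p ω)) := by
  intro t k i l Y hY
  cases k with
  | zero => simpa [sker] using Lin.zero
  | succ k =>
    simp only [sker_apply_succ]
    split_ifs with hk
    · have := Lin.sum Finset.univ (fun (η : Fin (k + 2) → Fin (np + 1)) _ =>
        (hp.ll_sprod_mul η (t := t) (t' := t - (k + 1 : ℕ)) (by push_cast; ring) hY).const_mul
          (h ⟨k, hk⟩ η i l))
      convert this using 2 with ω
      rw [Finset.sum_mul]
      exact Finset.sum_congr rfl fun η _ => by ring
    · simpa using Lin.zero

theorem IsWhiteScheduling.rker_noiseCoeff (θ : Params ny nu np nb nc) :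
    RKer μ p (fun ω => noiseCoeff θ (sched p ω)) := by
  simp only [noiseCoeff_eq]
  exact RKer.one.add (hp.rker_sker θ.2)

theorem IsWhiteScheduling.lker_noiseCoeff (θ : Params ny nu np nb nc) :
    LKer μ p (fun ω => noiseCoeff θ (sched p ω)) := by
  simp only [noiseCoeff_eq]
  exact LKer.one.add (hp.lker_sker θ.2)

/-- The recursion `ΓC = 1` writes a coefficient of `Γ` as lower coefficients followed on the right
by a coefficient of `C`, so linearity is passed on to the right end by `rker_sker`. For `lker_inv`
the recursion `CΓ = 1` plays this role on the left. -/
theorem IsWhiteScheduling.rker_inv (θ : Params ny nu np nb nc) :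
    RKer μ p (fun ω => invNoiseCoeff θ (sched p ω)) := by
  intro t k
  induction k using Nat.strong_induction_on generalizing t with
  | _ k ih =>
    intro i l X hX
    cases k with
    | zero =>
      simp only [invNoiseCoeff_zero_lag, mul_comm (X _)]
      simpa using hX.const_mul _
    | succ k =>
      have : ∀ x ∈ Finset.HasAntidiagonal.antidiagonal k, RL μ p (t - (k + 1 : ℕ))
          (fun ω => ∑ q, X ω * invNoiseCoeff θ (sched p ω) t x.1 i q *
            sker θ.2 (sched p ω) (t - x.1) (x.2 + 1) q l) := by
        intro x hx
        rw [Finset.HasAntidiagonal.mem_antidiagonal] at hx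
        refine Lin.sum _ fun q _ => ?_
        have h := hp.rker_sker θ.2 (t - x.1) (x.2 + 1) q l _ (ih x.1 (by omega) t i q X hX)
        have e : t - (x.1 : ℤ) - ((x.2 + 1 : ℕ) : ℤ) = t - (k + 1 : ℕ) := by push_cast; omega
        rwa [e] at h
      convert (Lin.sum _ this).neg using 2 with ω
      simp only [invNoiseCoeff_succ_right, Matrix.neg_apply, Matrix.sum_apply, Matrix.mul_apply,
        Finset.mul_sum, mul_assoc, mul_neg]

theorem IsWhiteScheduling.lker_inv (θ : Params ny nu np nb nc) :
    LKer μ p (fun ω => invNoiseCoeff θ (sched p ω)) := by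
  intro t k
  induction k using Nat.strong_induction_on generalizing t with
  | _ k ih =>
    intro i l Y hY
    cases k with
    | zero =>
      simp only [invNoiseCoeff_zero_lag]
      simpa using hY.const_mul _
    | succ k =>
      have : ∀ x ∈ Finset.HasAntidiagonal.antidiagonal k, LL μ p t
          (fun ω => ∑ q, sker θ.2 (sched p ω) t (x.1 + 1) i q *
            (invNoiseCoeff θ (sched p ω) (t - (x.1 + 1 : ℕ)) x.2 q l * Y ω)) := by
        intro x hx
        rw [Finset.HasAntidiagonal.mem_antidiagonal] at hx
        refine Lin.sum _ fun q _ => ?_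
        refine hp.lker_sker θ.2 t (x.1 + 1) i q _ (ih x.2 (by omega) _ q l Y ?_)
        have e : t - ((x.1 + 1 : ℕ) : ℤ) - (x.2 : ℤ) = t - (k + 1 : ℕ) := by push_cast; omega
        rwa [e]
      convert (Lin.sum _ this).neg using 2 with ω
      simp only [invNoiseCoeff_succ_left, Matrix.neg_apply, Matrix.sum_apply, Matrix.mul_apply,
        Finset.sum_mul, mul_assoc, neg_mul]

theorem IsWhiteScheduling.mem_stableParams_iff (θ : Params ny nu np nb nc) :
    θ ∈ stableParams μ p ↔
      ∃ K r : ℝ≥0, 0 < r ∧ r < 1 ∧ KBd μ (fun ω => invNoiseCoeff θ (sched p ω)) K r := by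
  have hmem := fun t k i l => (hp.rker_inv θ).memLp hp t k i l
  constructor
  · rintro ⟨K, r, hr0, hr1, h⟩
    -- Norms decay at the square root of the rate of second moments. Taking `(r + 1) / 2` instead of
    -- `r` makes the rate positive even when `r = 0`.
    set ρ : ℝ := Real.sqrt ((r + 1) / 2) with hρ
    have hρ2 : ρ ^ 2 = (r + 1) / 2 := Real.sq_sqrt (by linarith)
    have hρ0 : 0 < ρ := Real.sqrt_pos.2 (by linarith)
    have hρ1 : ρ < 1 := by
      have : ρ ^ 2 < 1 := by rw [hρ2]; linarith
      nlinarith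
    refine ⟨⟨Real.sqrt (max K 0), Real.sqrt_nonneg _⟩, ⟨ρ, hρ0.le⟩, hρ0, hρ1, fun t k i l => ?_⟩
    have h1 : ∫ ω, (invNoiseCoeff θ (sched p ω) t k i l) ^ 2 ∂μ
        ≤ (Real.sqrt (max K 0) * ρ ^ k) ^ 2 := by
      refine (h t k i l).2.trans ?_
      rw [mul_pow, Real.sq_sqrt (le_max_right _ _), ← pow_mul, mul_comm k 2, pow_mul, hρ2]
      gcongr
      · exact le_max_left _ _
      · linarith
    have h2 := ENNReal.ofReal_le_ofReal h1
    rw [ofReal_integral_sq (hmem t k i l), ENNReal.ofReal_pow (by positivity),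
      ENNReal.pow_le_pow_left_iff two_ne_zero] at h2
    refine h2.trans (le_of_eq ?_)
    rw [ENNReal.ofReal, Real.toNNReal_of_nonneg (by positivity)]
    congr 1
  · rintro ⟨K, r, hr0, hr1, h⟩
    refine ⟨(K : ℝ) ^ 2, (r : ℝ) ^ 2, by positivity, ?_, fun t k i l =>
      ⟨(hmem t k i l).integrable_sq, ?_⟩⟩
    · have : (r : ℝ) < 1 := by exact_mod_cast hr1
      exact pow_lt_one₀ r.2 this two_ne_zero
    · rw [integral_sq_eq (hmem t k i l)]
      have := ENNReal.toReal_mono ENNReal.coe_ne_top (h t k i l)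
      rw [ENNReal.coe_toReal] at this
      calc _ ≤ ((K * r ^ k : ℝ≥0) : ℝ) ^ 2 := by gcongr
        _ = _ := by push_cast; ring

/-- `F t a` ends at time `t - a`, where `G (t - a) b` begins, so each product is a junction and
costs the factor `κ`. The hypothesis `h` bounds products of norms, not each factor: in the induction
of `exists_uniform_kBd` the bound on `F` at the top lag is not yet known, but there `G` has lag zero
and vanishes. -/
theorem Junction.eLpNorm_conv_le {κ : ℝ≥0} (hκ : Junction μ p κ) {F G : Ω → Ker ny}
    (hF : RKer μ p F) (hG : LKer μ p G) (hG' : RKer μ p G) {A B ρ r S : ℝ≥0}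
    (hS : ∀ n, ∑ x ∈ Finset.HasAntidiagonal.antidiagonal n, ρ ^ x.1 * r ^ x.2 ≤ S * ρ ^ n)
    (t : ℤ) (n : ℕ) (i l : Fin ny)
    (h : ∀ x ∈ Finset.HasAntidiagonal.antidiagonal n, ∀ q,
      eLpNorm (fun ω => F ω t x.1 i q) 2 μ * eLpNorm (fun ω => G ω (t - x.1) x.2 q l) 2 μ
        ≤ (A * ρ ^ x.1 * (B * r ^ x.2) : ℝ≥0)) :
    eLpNorm (fun ω => conv (F ω) (G ω) t n i l) 2 μ ≤ (ny * κ * A * B * S * ρ ^ n : ℝ≥0) := by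
  have e : (fun ω => conv (F ω) (G ω) t n i l) = fun ω =>
      ∑ x ∈ Finset.HasAntidiagonal.antidiagonal n, ∑ q, F ω t x.1 i q * G ω (t - x.1) x.2 q l := by
    ext ω
    simp only [conv, Matrix.sum_apply, Matrix.mul_apply]
  have hm : ∀ x : ℕ × ℕ, ∀ q, AEStronglyMeasurable
      (fun ω => F ω t x.1 i q * G ω (t - x.1) x.2 q l) μ := fun x q =>
    (hF.memLp hp t x.1 i q).1.mul (hG'.memLp hp _ x.2 q l).1
  rw [e]
  calc _ ≤ ∑ x ∈ Finset.HasAntidiagonal.antidiagonal n,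
        eLpNorm (fun ω => ∑ q, F ω t x.1 i q * G ω (t - x.1) x.2 q l) 2 μ :=
        eLpNorm_finset_sum_le _ fun x _ => by
          have := Finset.aestronglyMeasurable_sum Finset.univ fun q _ => hm x q
          rwa [Finset.sum_fn] at this
    _ ≤ ∑ x ∈ Finset.HasAntidiagonal.antidiagonal n, ∑ q : Fin ny,
          ((κ * (A * ρ ^ x.1 * (B * r ^ x.2)) : ℝ≥0) : ℝ≥0∞) := by
        refine Finset.sum_le_sum fun x hx => (eLpNorm_finset_sum_le _ fun q _ => hm x q).trans ?_
        refine Finset.sum_le_sum fun q _ => ?_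
        refine (hκ _ _ _ (hF.rl t x.1 i q) (hG.ll _ x.2 q l)).trans ?_
        rw [mul_assoc, ENNReal.coe_mul]
        gcongr
        exact h x hx q
    _ = ((ny * κ * A * B * ∑ x ∈ Finset.HasAntidiagonal.antidiagonal n, ρ ^ x.1 * r ^ x.2 : ℝ≥0)
          : ℝ≥0∞) := by
        simp only [Finset.sum_const, Finset.card_univ, Fintype.card_fin, nsmul_eq_mul,
          Finset.mul_sum, ENNReal.ofNNReal_finsetSum]
        refine Finset.sum_congr rfl fun x _ => ?_
        push_cast
        ring
    _ ≤ _ := by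
        refine ENNReal.coe_le_coe.2 ?_
        rw [mul_assoc _ S]
        gcongr
        exact hS n

end RandomKernels


/-! ### Stability is an open condition -/

section Openness

variable {Ω : Type*} {m0 : MeasurableSpace Ω} {μ : Measure Ω} {ny nu np nb nc : ℕ}
  {p : ℤ → Ω → Fin np → ℝ}

/-- Convolving two geometric sequences of equal rate costs a factor `n + 1`; with distinct rates,
the sum is `ρ ^ n` times a partial geometric series of ratio `r / ρ < 1`. -/
theorem exists_geom_antidiagonal_le {r ρ : ℝ≥0} (hr : 0 < r) (h : r < ρ) : ∃ S : ℝ≥0, ∀ n : ℕ,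
    ∑ x ∈ Finset.HasAntidiagonal.antidiagonal n, ρ ^ x.1 * r ^ x.2 ≤ S * ρ ^ n := by
  have hρ : 0 < ρ := hr.trans h
  have hq : r / ρ < 1 := (div_lt_one hρ).2 h
  refine ⟨∑' k, (r / ρ) ^ k, fun n => ?_⟩
  have : ∑ x ∈ Finset.HasAntidiagonal.antidiagonal n, ρ ^ x.1 * r ^ x.2
      = (∑ x ∈ Finset.HasAntidiagonal.antidiagonal n, (r / ρ) ^ x.2) * ρ ^ n := by
    rw [Finset.sum_mul]
    refine Finset.sum_congr rfl fun x hx => ?_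
    rw [Finset.HasAntidiagonal.mem_antidiagonal] at hx
    rw [← hx, pow_add, div_pow]
    field_simp
  rw [this, Finset.Nat.sum_antidiagonal_eq_sum_range_succ (fun _ b => (r / ρ) ^ b)]
  have hrefl := Finset.sum_range_reflect (fun b => (r / ρ) ^ b) (n + 1)
  simp only [Nat.add_sub_cancel] at hrefl
  rw [Nat.succ_eq_add_one, hrefl]
  gcongr
  exact (NNReal.summable_geometric hq).sum_le_tsum _ fun _ _ => by positivity

theorem abs_noisePar_le (h : NoisePar ny np nc) (k η i l) : ‖h k η i l‖₊ ≤ ‖h‖₊ :=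
  (((nnnorm_le_pi_nnnorm (h k η i) l).trans (nnnorm_le_pi_nnnorm (h k η) i)).trans
    (nnnorm_le_pi_nnnorm (h k) η)).trans (nnnorm_le_pi_nnnorm h k)

variable [IsProbabilityMeasure μ] (hp : IsWhiteScheduling μ p 4)

include hp

theorem IsWhiteScheduling.exists_eLpNorm_sker_le (ny nc : ℕ) : ∃ c : ℝ≥0,
    ∀ (h : NoisePar ny np nc) t k i l,
      eLpNorm (fun ω => sker h (sched p ω) t k i l) 2 μ ≤ (c * ‖h‖₊ : ℝ≥0) := by
  have hs : ∀ {n : ℕ} (η : Fin n → Fin (np + 1)), ∃ s : ℝ≥0, ∀ t,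
      eLpNorm (sprod p t η) 2 μ = s := fun {n} η => by
    refine ⟨(eLpNorm (sprod p 0 η) 2 μ).toNNReal, fun t => ?_⟩
    rw [ENNReal.coe_toNNReal (hp.memLp_sprod 0 η).2.ne, hp.eLpNorm_sprod, hp.eLpNorm_sprod]
  choose s hs using @hs
  refine ⟨∑ k ∈ Finset.range nc, ∑ η : Fin (k + 2) → Fin (np + 1), s η, fun h t k i l => ?_⟩
  cases k with
  | zero => simp [sker]
  | succ k =>
    simp only [sker_apply_succ]
    split_ifs with hk
    · calc _ ≤ ∑ η : Fin (k + 2) → Fin (np + 1),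
            eLpNorm (fun ω => h ⟨k, hk⟩ η i l * sprod p t η ω) 2 μ :=
            eLpNorm_finset_sum_le _ fun η _ =>
              (hp.memLp_sprod t η).1.const_mul _
        _ ≤ ∑ η : Fin (k + 2) → Fin (np + 1), ((‖h‖₊ * s η : ℝ≥0) : ℝ≥0∞) := by
            refine Finset.sum_le_sum fun η _ => ?_
            have : (fun ω => h ⟨k, hk⟩ η i l * sprod p t η ω) = h ⟨k, hk⟩ η i l • sprod p t η := rfl
            rw [this, eLpNorm_const_smul, hs, ENNReal.coe_mul, enorm_eq_nnnorm]
            gcongr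
            exact abs_noisePar_le h _ _ _ _
        _ = ((‖h‖₊ * ∑ η : Fin (k + 2) → Fin (np + 1), s η : ℝ≥0) : ℝ≥0∞) := by
            rw [Finset.mul_sum, ENNReal.ofNNReal_finsetSum]
        _ ≤ _ := by
            rw [mul_comm]
            refine ENNReal.coe_le_coe.2 ?_
            gcongr
            exact Finset.single_le_sum (f := fun k => ∑ η : Fin (k + 2) → Fin (np + 1), s η)
              (fun _ _ => by positivity) (Finset.mem_range.2 hk)
    · simp

/-- Mean-square exponential stability is preserved under small perturbations, with uniform
constants. -/
theorem IsWhiteScheduling.exists_uniform_kBd {θ : Params ny nu np nb nc}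
    (hθ : θ ∈ stableParams μ p) : ∃ δ > 0, ∃ K ρ : ℝ≥0, ρ < 1 ∧
      ∀ θ' : Params ny nu np nb nc, ‖θ' - θ‖ < δ →
        KBd μ (fun ω => invNoiseCoeff θ' (sched p ω)) K ρ := by
  obtain ⟨K, r, hr0, hr1, hK⟩ := (hp.mem_stableParams_iff θ).1 hθ
  obtain ⟨κ, -, hκ⟩ := hp.exists_eLpNorm_mul_le
  have hκ : Junction μ p κ := hκ
  obtain ⟨c, hc⟩ := hp.exists_eLpNorm_sker_le ny nc
  obtain ⟨ρ, hrρ, hρ1⟩ := exists_between hr1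
  obtain ⟨S, hS⟩ := exists_geom_antidiagonal_le hr0 hrρ
  have hρ0 : 0 < ρ := hr0.trans hrρ
  -- The two nested convolutions in the resolvent identity turn a bound `2K` on `Γ'` into the bound
  -- `M * d * K * ρ ^ n` on `Γ - Γ'`. If `d` is so small that `M * d ≤ 1`, the bound `2K` reproduces
  -- itself.
  set M : ℝ≥0 := ny * κ * (ny * κ * (2 * K) * (c / r ^ nc) * S) * S with hM
  refine ⟨((M + 1 : ℝ≥0) : ℝ)⁻¹, by positivity, 2 * K, ρ, hρ1, fun θ' hθ' => ?_⟩
  set d := ‖θ'.2 - θ.2‖₊ with hd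
  have hdM : M * d ≤ 1 := by
    have h1 : (d : ℝ) ≤ ‖θ' - θ‖ := norm_snd_le (θ' - θ)
    have h2 : (d : ℝ) < ((M + 1 : ℝ≥0) : ℝ)⁻¹ := h1.trans_lt hθ'
    have h3 : ((M + 1 : ℝ≥0) : ℝ) * d < 1 := by
      rwa [← lt_inv_mul_iff₀ (by positivity), mul_one]
    have h4 : ((M * d : ℝ≥0) : ℝ) ≤ 1 := by
      push_cast at h3 ⊢
      nlinarith [d.2]
    exact_mod_cast h4
  -- A filter of finite order obeys any geometric rate; the factor `1 / r ^ nc` pays for the lags up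
  -- to `nc`.
  have hΔ : ∀ t k i l, eLpNorm (fun ω => sker (θ'.2 - θ.2) (sched p ω) t k i l) 2 μ
      ≤ (c / r ^ nc * d * r ^ k : ℝ≥0) := fun t k i l => by
    by_cases hk : nc < k
    · simp [sker_eq_zero _ _ _ hk]
    · refine (hc _ t k i l).trans (ENNReal.coe_le_coe.2 ?_)
      rw [← hd, div_mul_eq_mul_div, div_mul_eq_mul_div, le_div_iff₀ (by positivity)]
      exact mul_le_mul_of_nonneg_left
        (pow_le_pow_of_le_one (by positivity) hr1.le (by omega)) (by positivity)
  intro t n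
  induction n using Nat.strong_induction_on generalizing t with
  | _ n ih =>
    intro i l
    have hR' := hp.rker_inv θ'
    have hRΔ := hp.rker_sker (θ'.2 - θ.2)
    have hin : ∀ a ≤ n, ∀ i l, eLpNorm (fun ω => conv (invNoiseCoeff θ' (sched p ω))
        (sker (θ'.2 - θ.2) (sched p ω)) t a i l) 2 μ
        ≤ (ny * κ * (2 * K) * (c / r ^ nc * d) * S * ρ ^ a : ℝ≥0) := by
      intro a ha i l
      refine hκ.eLpNorm_conv_le hp hR' (hp.lker_sker _) hRΔ hS t a i l fun x hx q => ?_
      -- The perturbation is strictly causal, so only lags of `Γ'` below `n` occur and the induction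
      -- hypothesis applies.
      rw [Finset.HasAntidiagonal.mem_antidiagonal] at hx
      rcases Nat.eq_zero_or_pos x.2 with h0 | h0
      · simp [h0, sker_zero_lag]
      · rw [ENNReal.coe_mul]
        exact mul_le_mul' (ih x.1 (by omega) t i q) (hΔ _ _ _ _)
    have hout := hκ.eLpNorm_conv_le hp (hR'.conv hRΔ) (hp.lker_inv θ) (hp.rker_inv θ)
      (A := ny * κ * (2 * K) * (c / r ^ nc * d) * S) (B := K) hS t n i l fun x hx q => by
        rw [Finset.HasAntidiagonal.mem_antidiagonal] at hx
        rw [ENNReal.coe_mul]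
        exact mul_le_mul' (hin x.1 (by omega) i q) (hK _ _ _ _)
    have e : (fun ω => invNoiseCoeff θ' (sched p ω) t n i l) =
        (fun ω => invNoiseCoeff θ (sched p ω) t n i l)
        - fun ω => conv (conv (invNoiseCoeff θ' (sched p ω)) (sker (θ'.2 - θ.2) (sched p ω)))
          (invNoiseCoeff θ (sched p ω)) t n i l := by
      ext ω
      rw [Pi.sub_apply]
      conv_lhs => rw [invNoiseCoeff_eq_sub θ θ']
      simp
    rw [e]
    refine (eLpNorm_sub_le ((hp.rker_inv θ).memLp hp t n i l).1
      (((hR'.conv hRΔ).conv (hp.rker_inv θ)).memLp hp t n i l).1 (by norm_num)).trans ?_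
    refine (add_le_add (hK t n i l) hout).trans ?_
    rw [← ENNReal.coe_add]
    refine ENNReal.coe_le_coe.2 ?_
    calc _ = K * r ^ n + (M * d) * K * ρ ^ n := by rw [hM]; ring
      _ ≤ K * ρ ^ n + 1 * K * ρ ^ n := by gcongr
      _ = _ := by ring

end Openness


/-! ### Series in mean square -/

section Series

variable {Ω : Type*} {m0 : MeasurableSpace Ω} {μ : Measure Ω}

theorem ae_summable_of_eLpNorm_le {ι : Type*} [Countable ι] {f : ι → Ω → ℝ} {a : ι → ℝ≥0}
    (hf : ∀ r, AEStronglyMeasurable (f r) μ) (ha : Summable a)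
    (h : ∀ r, eLpNorm (f r) 2 μ ≤ a r) : ∀ᵐ ω ∂μ, Summable fun r => f r ω := by
  have h1 : ∑' r, eLpNorm (f r) 2 μ ≠ ⊤ := by
    refine ne_top_of_le_ne_top ?_ (ENNReal.tsum_le_tsum h)
    exact ENNReal.tsum_coe_ne_top_iff_summable.2 ha
  filter_upwards [summable_norm_of_tsum_eLpNorm_ne_top (by norm_num) hf h1] with ω hω
  exact hω.of_norm

/-- The partial sums stay in a ball of `L²` and converge almost everywhere; by Fatou the limit lies
in the same ball. -/
theorem eLpNorm_tsum_le {f : ℕ → Ω → ℝ} {a : ℕ → ℝ≥0}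
    (hf : ∀ r, AEStronglyMeasurable (f r) μ) (ha : Summable a)
    (h : ∀ r, eLpNorm (f r) 2 μ ≤ a r) :
    eLpNorm (fun ω => ∑' r, f r ω) 2 μ ≤ (∑' r, a r : ℝ≥0) := by
  have hm : ∀ n, AEStronglyMeasurable (fun ω => ∑ r ∈ Finset.range n, f r ω) μ := fun n => by
    have := Finset.aestronglyMeasurable_sum (Finset.range n) fun r _ => hf r
    rwa [Finset.sum_fn] at this
  refine Lp.eLpNorm_le_of_ae_tendsto (u := atTop)
    (f := fun n ω => ∑ r ∈ Finset.range n, f r ω) (Eventually.of_forall fun n => ?_) hm ?_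
  · refine (eLpNorm_finset_sum_le _ fun r _ => hf r).trans ?_
    refine (Finset.sum_le_sum fun r _ => h r).trans ?_
    rw [← ENNReal.ofNNReal_finsetSum]
    exact ENNReal.coe_le_coe.2 (ha.sum_le_tsum _ fun _ _ => by positivity)
  · filter_upwards [ae_summable_of_eLpNorm_le hf ha h] with ω hω
    exact hω.hasSum.tendsto_sum_nat

theorem abs_integral_mul_le {f g : Ω → ℝ} (hf : MemLp f 2 μ) (hg : MemLp g 2 μ) :
    ∫ ω, |f ω * g ω| ∂μ ≤ (eLpNorm f 2 μ).toReal * (eLpNorm g 2 μ).toReal := by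
  have h1 : eLpNorm (f • g) 1 μ ≤ eLpNorm f 2 μ * eLpNorm g 2 μ :=
    eLpNorm_smul_le_mul_eLpNorm (p := 2) (q := 2) (r := 1) hg.1 hf.1
  have h2 : ∫ ω, |f ω * g ω| ∂μ = (eLpNorm (f • g) 1 μ).toReal := by
    rw [eLpNorm_one_eq_lintegral_enorm, ← integral_norm_eq_lintegral_enorm (hf.1.smul hg.1)]
    rfl
  rw [h2, ← ENNReal.toReal_mul]
  exact ENNReal.toReal_mono (ENNReal.mul_ne_top hf.2.ne hg.2.ne) h1

/-- By Cauchy–Schwarz the `L¹` norms of `g * f r` are summable, which permits interchanging sum and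
expectation. All orthogonality relations for filtered processes are obtained term by term from this.
-/
theorem hasSum_integral_mul_tsum {f : ℕ → Ω → ℝ} {a : ℕ → ℝ≥0} {g : Ω → ℝ} (hg : MemLp g 2 μ)
    (hf : ∀ r, AEStronglyMeasurable (f r) μ) (ha : Summable a)
    (h : ∀ r, eLpNorm (f r) 2 μ ≤ a r) :
    HasSum (fun r => ∫ ω, g ω * f r ω ∂μ) (∫ ω, g ω * ∑' r, f r ω ∂μ) := by
  have hmem : ∀ r, MemLp (f r) 2 μ := fun r => ⟨hf r, (h r).trans_lt ENNReal.coe_lt_top⟩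
  simp only [← tsum_mul_left]
  refine hasSum_integral_of_summable_integral_norm
    (fun r => integrable_mul_of_memLp_two hg (hmem r)) ?_
  refine Summable.of_nonneg_of_le (fun r => integral_nonneg fun ω => norm_nonneg _)
    (fun r => (abs_integral_mul_le hg (hmem r)).trans ?_)
    ((NNReal.summable_coe.2 ha).mul_left (eLpNorm g 2 μ).toReal)
  gcongr
  have := ENNReal.toReal_mono ENNReal.coe_ne_top (h r)
  rwa [ENNReal.coe_toReal] at this

end Series

/-! ### Filters acting on processes -/

section Processes

variable {Ω : Type*} {m0 : MeasurableSpace Ω} {μ : Measure Ω} {ny nu np nb nc : ℕ}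
  {p : ℤ → Ω → Fin np → ℝ}

/-- A filter whose coefficients decay geometrically in mean square. -/
structure GoodKer (μ : Measure Ω) (p : ℤ → Ω → Fin np → ℝ) (F : Ω → Ker ny) (K ρ : ℝ≥0) :
    Prop where
  rker : RKer μ p F
  lker : LKer μ p F
  bound : KBd μ F K ρ
  rate : ρ < 1

/-- A process that remains square integrable, uniformly in time, when multiplied by signals that
are linear in the current scheduling and depend on the future scheduling only. -/
structure Adm (μ : Measure Ω) (p : ℤ → Ω → Fin np → ℝ) (z : ℤ → Ω → Fin ny → ℝ) (M : ℝ≥0) :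
    Prop where
  measurable : ∀ t, Measurable (z t)
  bound : ∀ t i X, RL μ p t X →
    eLpNorm (fun ω => X ω * z t ω i) 2 μ ≤ M * eLpNorm X 2 μ

/-- `g` is orthogonal to the values up to time `τ` of the process `z`, multiplied by functions
of the scheduling. -/
def OrthUpTo (μ : Measure Ω) (p : ℤ → Ω → Fin np → ℝ) (g : Ω → ℝ) (τ : ℤ)
    (z : ℤ → Ω → Fin ny → ℝ) : Prop :=
  ∀ s ≤ τ, ∀ i X, RL μ p s X → ∫ ω, g ω * (X ω * z s ω i) ∂μ = 0

/-- The filter `F` applied to the process `z`. -/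
noncomputable def gapp (F : Ω → Ker ny) (z : ℤ → Ω → Fin ny → ℝ) (t : ℤ) (ω : Ω) : Fin ny → ℝ :=
  ∑' r : ℕ, (F ω t r).mulVec (z (t - r) ω)

variable {z z' : ℤ → Ω → Fin ny → ℝ} {F G : Ω → Ker ny} {M M' K K' ρ ρ' κ : ℝ≥0}

theorem Adm.measurable_apply (hz : Adm μ p z M) (t : ℤ) (i : Fin ny) :
    Measurable fun ω => z t ω i := (measurable_pi_apply i).comp (hz.measurable t)

variable [IsProbabilityMeasure μ]

theorem Adm.eLpNorm_le (hz : Adm μ p z M) (t : ℤ) (i : Fin ny) :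
    eLpNorm (fun ω => z t ω i) 2 μ ≤ M := by
  have h := hz.bound t i (fun _ => 1) Lin.one
  rw [eLpNorm_const _ two_ne_zero (IsProbabilityMeasure.ne_zero μ)] at h
  simpa using h

theorem Adm.memLp (hz : Adm μ p z M) (t : ℤ) (i : Fin ny) : MemLp (fun ω => z t ω i) 2 μ :=
  ⟨(hz.measurable_apply t i).aestronglyMeasurable,
    (hz.eLpNorm_le t i).trans_lt ENNReal.coe_lt_top⟩

variable (hp : IsWhiteScheduling μ p 4)

include hp

theorem Adm.memLp_mul (hz : Adm μ p z M) {t : ℤ} {X : Ω → ℝ} (hX : RL μ p t X) (i : Fin ny) :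
    MemLp (fun ω => X ω * z t ω i) 2 μ :=
  ⟨(hp.memLp_rl hX).1.mul (hz.memLp t i).1, (hz.bound t i X hX).trans_lt
    (ENNReal.mul_lt_top ENNReal.coe_lt_top (hp.memLp_rl hX).2)⟩

theorem Adm.add (hz : Adm μ p z M) (hz' : Adm μ p z' M') :
    Adm μ p (fun t ω => z t ω + z' t ω) (M + M') := by
  refine ⟨fun t => (hz.measurable t).add (hz'.measurable t), fun t i X hX => ?_⟩
  simp only [Pi.add_apply, mul_add, ENNReal.coe_add, add_mul]
  exact (eLpNorm_add_le (hz.memLp_mul hp hX i).1 (hz'.memLp_mul hp hX i).1 (by norm_num)).trans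
    (add_le_add (hz.bound t i X hX) (hz'.bound t i X hX))

omit [IsProbabilityMeasure μ] hp in
theorem Adm.const_smul (hz : Adm μ p z M) (c : ℝ) :
    Adm μ p (fun t ω => c • z t ω) (‖c‖₊ * M) := by
  refine ⟨fun t => (hz.measurable t).const_smul c, fun t i X hX => ?_⟩
  have : (fun ω => X ω * (c • z t ω) i) = c • fun ω => X ω * z t ω i := by
    ext ω
    simp only [Pi.smul_apply, smul_eq_mul]
    ring
  rw [this, eLpNorm_const_smul, ENNReal.coe_mul, mul_assoc, enorm_eq_nnnorm]
  gcongr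
  exact hz.bound t i X hX

theorem Adm.mul_lag_memLp (hz : Adm μ p z M) (hF : RKer μ p F) {t : ℤ} {X : Ω → ℝ}
    (hX : RL μ p t X) (r : ℕ) (i q : Fin ny) :
    MemLp (fun ω => X ω * F ω t r i q * z (t - r) ω q) 2 μ :=
  hz.memLp_mul hp (hF t r i q X hX) q

theorem Adm.term_memLp (hz : Adm μ p z M) (hF : RKer μ p F) {t : ℤ} {X : Ω → ℝ}
    (hX : RL μ p t X) (r : ℕ) (i : Fin ny) :
    MemLp (fun ω => X ω * (F ω t r).mulVec (z (t - r) ω) i) 2 μ := by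
  have : (fun ω => X ω * (F ω t r).mulVec (z (t - r) ω) i)
      = fun ω => ∑ q, X ω * F ω t r i q * z (t - r) ω q := by
    ext ω
    simp only [Matrix.mulVec, dotProduct, Finset.mul_sum, mul_assoc]
  rw [this]
  exact memLp_finsetSum _ fun q _ => hz.mul_lag_memLp hp hF hX r i q

/-- `X * F t r` is again linear at time `t - r`, with norm controlled by the junction constant, so
it is an allowed multiplier of `z (t - r)`. -/
theorem Adm.term_le (hκ : Junction μ p κ) (hz : Adm μ p z M) (hF : RKer μ p F)
    (hF' : LKer μ p F) {t : ℤ} {X : Ω → ℝ} (hX : RL μ p t X) (r : ℕ) (i : Fin ny) {b : ℝ≥0}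
    (hb : ∀ q, eLpNorm (fun ω => F ω t r i q) 2 μ ≤ b) :
    eLpNorm (fun ω => X ω * (F ω t r).mulVec (z (t - r) ω) i) 2 μ
      ≤ (ny * κ * M * b : ℝ≥0) * eLpNorm X 2 μ := by
  have : (fun ω => X ω * (F ω t r).mulVec (z (t - r) ω) i)
      = fun ω => ∑ q, X ω * F ω t r i q * z (t - r) ω q := by
    ext ω
    simp only [Matrix.mulVec, dotProduct, Finset.mul_sum, mul_assoc]
  rw [this]
  calc _ ≤ ∑ q : Fin ny, eLpNorm (fun ω => X ω * F ω t r i q * z (t - r) ω q) 2 μ :=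
        eLpNorm_finset_sum_le _ fun q _ => (hz.mul_lag_memLp hp hF hX r i q).1
    _ ≤ ∑ _q : Fin ny, M * (κ * eLpNorm X 2 μ * b) := by
        refine Finset.sum_le_sum fun q _ => (hz.bound _ q _ (hF t r i q X hX)).trans ?_
        gcongr
        refine (hκ _ _ _ hX (hF'.ll t r i q)).trans ?_
        gcongr
        exact hb q
    _ = _ := by
        simp only [Finset.sum_const, Finset.card_univ, Fintype.card_fin, nsmul_eq_mul]
        push_cast
        ring

omit hp [IsProbabilityMeasure μ] in
theorem summable_const_mul_geom (c : ℝ≥0) (h : ρ < 1) : Summable fun r : ℕ => c * ρ ^ r :=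
  (NNReal.summable_geometric h).mul_left c

theorem Adm.term_le_geom (hκ : Junction μ p κ) (hz : Adm μ p z M) (hF : GoodKer μ p F K ρ)
    {t : ℤ} {X : Ω → ℝ} (hX : RL μ p t X) (r : ℕ) (i : Fin ny) :
    eLpNorm (fun ω => X ω * (F ω t r).mulVec (z (t - r) ω) i) 2 μ
      ≤ (ny * κ * M * K * (eLpNorm X 2 μ).toNNReal * ρ ^ r : ℝ≥0) := by
  refine (hz.term_le hp hκ hF.rker hF.lker hX r i fun q => hF.bound t r i q).trans ?_
  nth_rw 1 [← ENNReal.coe_toNNReal (hp.memLp_rl hX).2.ne]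
  rw [← ENNReal.coe_mul]
  refine ENNReal.coe_le_coe.2 (le_of_eq ?_)
  ring

theorem Adm.ae_summable (hκ : Junction μ p κ) (hz : Adm μ p z M) (hF : GoodKer μ p F K ρ)
    (t : ℤ) : ∀ᵐ ω ∂μ, Summable fun r : ℕ => (F ω t r).mulVec (z (t - r) ω) := by
  have h : ∀ i, ∀ᵐ ω ∂μ, Summable fun r : ℕ => (F ω t r).mulVec (z (t - r) ω) i := by
    intro i
    have h1 : RL μ p t (fun _ => 1) := Lin.one
    have := ae_summable_of_eLpNorm_le
      (fun r => (hz.term_memLp hp hF.rker h1 r i).1)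
      (summable_const_mul_geom _ hF.rate) (hz.term_le_geom hp hκ hF h1 · i)
    simpa using this
  filter_upwards [ae_all_iff.2 h] with ω hω
  exact Pi.summable.2 hω

theorem Adm.ae_mul_gapp (hκ : Junction μ p κ) (hz : Adm μ p z M) (hF : GoodKer μ p F K ρ)
    (t : ℤ) (i : Fin ny) (X : Ω → ℝ) : (fun ω => X ω * gapp F z t ω i) =ᵐ[μ]
      fun ω => ∑' r : ℕ, X ω * (F ω t r).mulVec (z (t - r) ω) i := by
  filter_upwards [hz.ae_summable hp hκ hF t] with ω hω
  rw [gapp, tsum_apply hω, tsum_mul_left]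

theorem measurable_mulVec_lag (hz : Adm μ p z M) (hF : RKer μ p F) (t : ℤ) (r : ℕ) :
    Measurable fun ω => (F ω t r).mulVec (z (t - r) ω) := by
  refine measurable_pi_lambda _ fun i => ?_
  simp only [Matrix.mulVec, dotProduct]
  exact Finset.measurable_sum _ fun q _ =>
    (hF.measurable hp t r i q).mul (hz.measurable_apply _ q)

/-- Admissibility is built to be stable under filtering, because its multipliers absorb filter
coefficients. Uniformly bounded second moments alone would not be inherited. -/
theorem Adm.gapp (hκ : Junction μ p κ) (hz : Adm μ p z M) (hF : GoodKer μ p F K ρ) :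
    Adm μ p (gapp F z) (ny * κ * M * K * ∑' r : ℕ, ρ ^ r) := by
  refine ⟨fun t => Measurable.tsum fun r => measurable_mulVec_lag hp hz hF.rker t r,
    fun t i X hX => ?_⟩
  rw [eLpNorm_congr_ae (hz.ae_mul_gapp hp hκ hF t i X)]
  refine (eLpNorm_tsum_le (fun r => (hz.term_memLp hp hF.rker hX r i).1)
    (summable_const_mul_geom _ hF.rate) (hz.term_le_geom hp hκ hF hX · i)).trans (le_of_eq ?_)
  rw [NNReal.tsum_mul_left]
  nth_rw 2 [← ENNReal.coe_toNNReal (hp.memLp_rl hX).2.ne]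
  rw [← ENNReal.coe_mul]
  congr 1
  ring

theorem Adm.hasSum_integral_gapp (hκ : Junction μ p κ) (hz : Adm μ p z M)
    (hF : GoodKer μ p F K ρ) {g : Ω → ℝ} (hg : MemLp g 2 μ) {t : ℤ} {X : Ω → ℝ}
    (hX : RL μ p t X) (i : Fin ny) :
    HasSum (fun r : ℕ => ∑ q, ∫ ω, g ω * (X ω * F ω t r i q * z (t - r) ω q) ∂μ)
      (∫ ω, g ω * (X ω * LPVMAX.gapp F z t ω i) ∂μ) := by
  have h := hasSum_integral_mul_tsum hg (fun r => (hz.term_memLp hp hF.rker hX r i).1)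
    (summable_const_mul_geom _ hF.rate) (hz.term_le_geom hp hκ hF hX · i)
  have e1 : ∫ ω, g ω * (X ω * LPVMAX.gapp F z t ω i) ∂μ
      = ∫ ω, g ω * ∑' r : ℕ, X ω * (F ω t r).mulVec (z (t - r) ω) i ∂μ := by
    refine integral_congr_ae ?_
    filter_upwards [hz.ae_mul_gapp hp hκ hF t i X] with ω hω
    rw [hω]
  rw [e1]
  convert h using 2 with r
  rw [← integral_finsetSum _ fun q _ =>
    integrable_mul_of_memLp_two hg (hz.mul_lag_memLp hp hF.rker hX r i q)]
  refine integral_congr_ae (ae_of_all _ fun ω => ?_)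
  simp only [Matrix.mulVec, dotProduct, Finset.mul_sum, mul_assoc]

/-- Each term of the filtered series is an earlier value of `z` times the multiplier `X * F s r`,
and that multiplier is covered by the hypothesis. -/
theorem OrthUpTo.gapp (hκ : Junction μ p κ) (hz : Adm μ p z M) (hF : GoodKer μ p F K ρ)
    {g : Ω → ℝ} (hg : MemLp g 2 μ) {τ : ℤ} (h : OrthUpTo μ p g τ z) :
    OrthUpTo μ p g τ (gapp F z) := by
  intro s hs i X hX
  refine (hz.hasSum_integral_gapp hp hκ hF hg hX i).unique ?_
  convert (hasSum_zero : HasSum (fun _ : ℕ => (0 : ℝ)) 0) using 2 with r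
  refine Finset.sum_eq_zero fun q _ => ?_
  exact h (s - r) (by omega) q _ (hF.rker s r i q X hX)

/-- A strictly causal filter delays orthogonality by one step. -/
theorem OrthUpTo.gapp_strict (hκ : Junction μ p κ) (hz : Adm μ p z M) (hF : GoodKer μ p F K ρ)
    (hF0 : ∀ ω t, F ω t 0 = 0)
    {g : Ω → ℝ} (hg : MemLp g 2 μ) {τ : ℤ} (h : OrthUpTo μ p g τ z) :
    OrthUpTo μ p g (τ + 1) (LPVMAX.gapp F z) := by
  intro s hs i X hX
  refine (hz.hasSum_integral_gapp hp hκ hF hg hX i).unique ?_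
  convert (hasSum_zero : HasSum (fun _ : ℕ => (0 : ℝ)) 0) using 2 with r
  refine Finset.sum_eq_zero fun q _ => ?_
  rcases Nat.eq_zero_or_pos r with rfl | hr
  · simp [hF0]
  · exact h (s - r) (by omega) q _ (hF.rker s r i q X hX)

omit hp [IsProbabilityMeasure μ] in
theorem gapp_congr (h : ∀ s, z s =ᵐ[μ] z' s) (t : ℤ) : gapp F z t =ᵐ[μ] gapp F z' t := by
  filter_upwards [ae_all_iff.2 h] with ω hω
  simp only [gapp, hω]

theorem gapp_add (hκ : Junction μ p κ) (hz : Adm μ p z M) (hz' : Adm μ p z' M')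
    (hF : GoodKer μ p F K ρ) (t : ℤ) : gapp F (fun t ω => z t ω + z' t ω) t =ᵐ[μ]
      fun ω => gapp F z t ω + gapp F z' t ω := by
  filter_upwards [hz.ae_summable hp hκ hF t, hz'.ae_summable hp hκ hF t] with ω h h'
  simp only [gapp, Matrix.mulVec_add]
  exact h.tsum_add h'

omit hp [IsProbabilityMeasure μ] in
theorem gapp_smul (c : ℝ) (t : ℤ) (ω : Ω) :
    gapp F (fun t ω => c • z t ω) t ω = c • gapp F z t ω := by
  simp only [gapp, Matrix.mulVec_smul]
  exact tsum_const_smul'' c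

theorem GoodKer.eLpNorm_conv_lag_le (hκ : Junction μ p κ) (hz : Adm μ p z M)
    (hF : GoodKer μ p F K ρ) (hG : GoodKer μ p G K' ρ') (t : ℤ) (r j : ℕ) (i : Fin ny) :
    eLpNorm (fun ω => (F ω t r * G ω (t - r) j).mulVec (z (t - r - j) ω) i) 2 μ
      ≤ (ny * (ny * κ * M * K') * K * (ρ ^ r * ρ' ^ j) : ℝ≥0) := by
  have e : (fun ω => (F ω t r * G ω (t - r) j).mulVec (z (t - r - j) ω) i)
      = fun ω => ∑ q, F ω t r i q * (G ω (t - r) j).mulVec (z (t - r - j) ω) q := by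
    ext ω
    rw [← Matrix.mulVec_mulVec]
    rfl
  rw [e]
  have hX := fun q => hF.rker.rl t r i q
  calc _ ≤ ∑ q : Fin ny, eLpNorm
        (fun ω => F ω t r i q * (G ω (t - r) j).mulVec (z (t - r - j) ω) q) 2 μ :=
        eLpNorm_finset_sum_le _ fun q _ => (hz.term_memLp hp hG.rker (hX q) j q).1
    _ ≤ ∑ _q : Fin ny, ((ny * κ * M * (K' * ρ' ^ j) : ℝ≥0) : ℝ≥0∞) * (K * ρ ^ r : ℝ≥0) := by
        refine Finset.sum_le_sum fun q _ =>
          (hz.term_le hp hκ hG.rker hG.lker (hX q) j q fun q' => hG.bound _ j q q').trans ?_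
        gcongr
        exact hF.bound t r i q
    _ = _ := by
        simp only [Finset.sum_const, Finset.card_univ, Fintype.card_fin, nsmul_eq_mul]
        push_cast
        ring

omit [IsProbabilityMeasure μ] hp in
theorem tsum_antidiagonal {T : ℕ × ℕ → Fin ny → ℝ} (hT : Summable T) :
    ∑' x, T x = ∑' n, ∑ x ∈ Finset.HasAntidiagonal.antidiagonal n, T x := by
  have h := Finset.HasAntidiagonal.sigmaAntidiagonalEquivProd.summable_iff.2 hT
  rw [← Finset.HasAntidiagonal.sigmaAntidiagonalEquivProd.tsum_eq]
  refine (Summable.tsum_sigma h).trans (tsum_congr fun n => ?_)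
  rw [tsum_fintype]
  exact Finset.sum_coe_sort (Finset.HasAntidiagonal.antidiagonal n) T

omit [IsProbabilityMeasure μ] hp in
theorem mulVec_tsum (A : Matrix (Fin ny) (Fin ny) ℝ) {f : ℕ → Fin ny → ℝ} (hf : Summable f) :
    A.mulVec (∑' j, f j) = ∑' j, A.mulVec (f j) :=
  (LinearMap.toContinuousLinearMap A.mulVecLin).map_tsum hf

/-- Composition of filters. -/
theorem gapp_conv (hκ : Junction μ p κ) (hz : Adm μ p z M)
    (hF : GoodKer μ p F K ρ) (hG : GoodKer μ p G K' ρ') (t : ℤ) :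
    LPVMAX.gapp (fun ω => conv (F ω) (G ω)) z t =ᵐ[μ] LPVMAX.gapp F (LPVMAX.gapp G z) t := by
  set T : ℕ × ℕ → Ω → Fin ny → ℝ := fun x ω =>
    (F ω t x.1 * G ω (t - x.1) x.2).mulVec (z (t - x.1 - x.2) ω) with hTdef
  -- Almost sure summability of the double series over all pairs of lags; it allows summation along
  -- antidiagonals (the composite filter) and row by row (successive filtering).
  have hsum : ∀ᵐ ω ∂μ, Summable fun x => T x ω := by
    have h : ∀ i, ∀ᵐ ω ∂μ, Summable fun x => T x ω i := by
      intro i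
      refine ae_summable_of_eLpNorm_le
        (a := fun x => ny * (ny * κ * M * K') * K * (ρ ^ x.1 * ρ' ^ x.2)) (fun x => ?_) ?_
        fun x => hF.eLpNorm_conv_lag_le hp hκ hz hG t x.1 x.2 i
      · have e : (fun ω => T x ω i) = fun ω => ∑ q, F ω t x.1 i q *
            (G ω (t - x.1) x.2).mulVec (z (t - x.1 - x.2) ω) q := by
          ext ω
          rw [hTdef]
          simp only
          rw [← Matrix.mulVec_mulVec]
          rfl
        rw [e]
        exact (memLp_finsetSum _ fun q _ =>
          hz.term_memLp hp hG.rker (hF.rker.rl t x.1 i q) x.2 q).1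
      · refine Summable.mul_left _ ?_
        rw [← NNReal.summable_coe]
        push_cast
        exact Summable.mul_of_nonneg (f := fun r : ℕ => (ρ : ℝ) ^ r) (g := fun j : ℕ => (ρ' : ℝ) ^ j)
          (by exact_mod_cast NNReal.summable_geometric hF.rate)
          (by exact_mod_cast NNReal.summable_geometric hG.rate)
          (fun _ => by positivity) (fun _ => by positivity)
    filter_upwards [ae_all_iff.2 h] with ω hω
    exact Pi.summable.2 hω
  have hinner : ∀ᵐ ω ∂μ, ∀ r : ℕ, Summable fun j : ℕ =>
      (G ω (t - r) j).mulVec (z (t - r - j) ω) :=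
    ae_all_iff.2 fun r => hz.ae_summable hp hκ hG (t - r)
  filter_upwards [hsum, hinner] with ω h1 h2
  have e1 : LPVMAX.gapp (fun ω => conv (F ω) (G ω)) z t ω
      = ∑' n, ∑ x ∈ Finset.HasAntidiagonal.antidiagonal n, T x ω := by
    refine tsum_congr fun n => ?_
    simp only [conv, Matrix.sum_mulVec]
    refine Finset.sum_congr rfl fun x hx => ?_
    rw [Finset.HasAntidiagonal.mem_antidiagonal] at hx
    have e : t - (x.1 : ℤ) - (x.2 : ℤ) = t - n := by omega
    simp only [hTdef, e]
  have e2 : LPVMAX.gapp F (LPVMAX.gapp G z) t ω = ∑' r : ℕ, ∑' j : ℕ, T (r, j) ω := by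
    refine tsum_congr fun r => ?_
    rw [LPVMAX.gapp, mulVec_tsum _ (h2 r)]
    refine tsum_congr fun j => ?_
    simp only [hTdef, Matrix.mulVec_mulVec]
  rw [e1, e2, ← tsum_antidiagonal h1, h1.tsum_prod]

end Processes


/-! ### Composition and inversion of filters on processes -/

section Filters

variable {Ω : Type*} {m0 : MeasurableSpace Ω} {μ : Measure Ω} {ny nu np nb nc : ℕ}
  {p : ℤ → Ω → Fin np → ℝ} {z z' : ℤ → Ω → Fin ny → ℝ} {F G : Ω → Ker ny}
  {M M' K K' ρ ρ' κ : ℝ≥0}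

theorem LKer.conv {F G : Ω → Ker ny} (hF : LKer μ p F) (hG : LKer μ p G) :
    LKer μ p (fun ω => conv (F ω) (G ω)) := by
  intro t k i l Y hY
  have : ∀ x ∈ Finset.HasAntidiagonal.antidiagonal k, LL μ p t
      (fun ω => ∑ q, F ω t x.1 i q * (G ω (t - x.1) x.2 q l * Y ω)) := by
    intro x hx
    rw [Finset.HasAntidiagonal.mem_antidiagonal] at hx
    refine Lin.sum _ fun q _ => hF t x.1 i q _ (hG (t - x.1) x.2 q l _ ?_)
    have e : t - (x.1 : ℤ) - (x.2 : ℤ) = t - k := by omega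
    rwa [e]
  have h2 := Lin.sum _ this
  convert h2 using 2 with ω
  simp only [LPVMAX.conv, Matrix.sum_apply, Matrix.mul_apply, Finset.sum_mul, mul_assoc]

theorem gapp_kone (t : ℤ) (ω : Ω) : gapp (fun _ => kone ny) z t ω = z t ω := by
  rw [gapp, tsum_eq_single 0]
  · simp [kone]
  · intro r hr
    simp [kone, hr]

theorem gapp_sker (h : NoisePar ny np nc) (t : ℤ) (ω : Ω) :
    gapp (fun ω => sker h (sched p ω)) z t ω
      = ∑ k ∈ Finset.range (nc + 1), (sker h (sched p ω) t k).mulVec (z (t - k) ω) := by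
  refine tsum_eq_sum fun k hk => ?_
  rw [Finset.mem_range] at hk
  beta_reduce
  rw [sker_eq_zero h _ _ (by omega), Matrix.zero_mulVec]

theorem gapp_sker_sub (h h' : NoisePar ny np nc) (t : ℤ) (ω : Ω) :
    gapp (fun ω => sker (h - h') (sched p ω)) z t ω
      = gapp (fun ω => sker h (sched p ω)) z t ω - gapp (fun ω => sker h' (sched p ω)) z t ω := by
  rw [gapp_sker, gapp_sker, gapp_sker]
  simp only [sker_sub, Pi.sub_apply, Matrix.sub_mulVec, Finset.sum_sub_distrib]

theorem gapp_sker_smul (c : ℝ) (h : NoisePar ny np nc) (t : ℤ) (ω : Ω) :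
    gapp (fun ω => sker (c • h) (sched p ω)) z t ω
      = c • gapp (fun ω => sker h (sched p ω)) z t ω := by
  simp only [gapp_sker, sker_smul, Matrix.smul_mulVec, Finset.smul_sum]

theorem noiseOut_eq (θ : Params ny nu np nb nc) (t : ℤ) (ω : Ω) :
    noiseOut θ (sched p ω) (fun s => z s ω) t
      = z t ω + gapp (fun ω => sker θ.2 (sched p ω)) z t ω := by
  rw [gapp_sker, noiseOut]
  simp only [noiseCoeff_eq, Pi.add_apply, Matrix.add_mulVec, Finset.sum_add_distrib]
  congr 1
  rw [Finset.sum_eq_single 0]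
  · simp [kone]
  · intro k _ hk
    simp [kone, hk]
  · simp

theorem gapp_noiseCoeff (θ : Params ny nu np nb nc) (t : ℤ) (ω : Ω) :
    gapp (fun ω => noiseCoeff θ (sched p ω)) z t ω
      = z t ω + gapp (fun ω => sker θ.2 (sched p ω)) z t ω := by
  rw [← noiseOut_eq, noiseOut]
  refine tsum_eq_sum fun k hk => ?_
  rw [Finset.mem_range] at hk
  beta_reduce
  rw [noiseCoeff_eq, Pi.add_apply, Pi.add_apply, sker_eq_zero _ _ _ (by omega), kone,
    if_neg (by omega), add_zero, Matrix.zero_mulVec]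

variable [IsProbabilityMeasure μ] (hp : IsWhiteScheduling μ p 4)

include hp

theorem GoodKer.conv (hκ : Junction μ p κ) (hF : GoodKer μ p F K ρ) (hG : GoodKer μ p G K' ρ') :
    ∃ K'' ρ'' : ℝ≥0, GoodKer μ p (fun ω => conv (F ω) (G ω)) K'' ρ'' := by
  -- The entry `1 / 2` keeps the common rate positive, as `exists_geom_antidiagonal_le` demands; `σ`
  -- is then strictly larger.
  have hr1 : max (max ρ ρ') (1 / 2) < 1 :=
    max_lt (max_lt hF.rate hG.rate) (by rw [div_lt_one (by norm_num)]; norm_num)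
  have hr0 : 0 < max (max ρ ρ') (1 / 2) := lt_max_of_lt_right (by norm_num)
  obtain ⟨σ, hσ, hσ1⟩ := exists_between hr1
  obtain ⟨S, hS⟩ := exists_geom_antidiagonal_le hr0 hσ
  have h1 : ρ ≤ max (max ρ ρ') (1 / 2) := (le_max_left _ _).trans (le_max_left _ _)
  have h2 : ρ' ≤ max (max ρ ρ') (1 / 2) := (le_max_right _ _).trans (le_max_left _ _)
  refine ⟨ny * κ * K * K' * S, σ, hF.rker.conv hG.rker, hF.lker.conv hG.lker,
    fun t n i l => ?_, hσ1⟩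
  refine hκ.eLpNorm_conv_le hp hF.rker hG.lker hG.rker hS t n i l fun x _ q => ?_
  rw [ENNReal.coe_mul]
  refine mul_le_mul' ((hF.bound _ _ _ _).trans (ENNReal.coe_le_coe.2 ?_))
    ((hG.bound _ _ _ _).trans (ENNReal.coe_le_coe.2 ?_))
  · gcongr
    exact h1.trans hσ.le
  · gcongr

theorem IsWhiteScheduling.exists_goodKer_sker (ny nc : ℕ) : ∃ c : ℝ≥0,
    ∀ h : NoisePar ny np nc, GoodKer μ p (fun ω => sker h (sched p ω)) (c * ‖h‖₊) (1 / 2) := by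
  obtain ⟨c, hc⟩ := hp.exists_eLpNorm_sker_le ny nc
  have h1 : (1 / 2 : ℝ≥0) < 1 := by rw [div_lt_one (by norm_num)]; norm_num
  refine ⟨c * 2 ^ nc, fun h => ⟨hp.rker_sker h, hp.lker_sker h, fun t k i l => ?_, h1⟩⟩
  by_cases hk : nc < k
  · simp [sker_eq_zero _ _ _ hk]
  · refine (hc h t k i l).trans (ENNReal.coe_le_coe.2 ?_)
    calc c * ‖h‖₊ = c * ‖h‖₊ * 1 := (mul_one _).symm
      _ ≤ c * ‖h‖₊ * (2 ^ (nc - k)) := by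
          gcongr
          exact one_le_pow₀ (by norm_num)
      _ = _ := by
          have h2 : (2 : ℝ≥0) ^ nc = 2 ^ (nc - k) * 2 ^ k := by
            rw [← pow_add]
            congr 1
            omega
          rw [h2, one_div, inv_pow]
          field_simp

theorem IsWhiteScheduling.exists_goodKer_noiseCoeff (θ : Params ny nu np nb nc) :
    ∃ K : ℝ≥0, GoodKer μ p (fun ω => noiseCoeff θ (sched p ω)) K (1 / 2) := by
  obtain ⟨c, hc⟩ := hp.exists_goodKer_sker ny nc
  refine ⟨1 + c * ‖θ.2‖₊, hp.rker_noiseCoeff θ, hp.lker_noiseCoeff θ, fun t k i l => ?_,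
    (hc 0).rate⟩
  have e : (fun ω => noiseCoeff θ (sched p ω) t k i l)
      = (fun _ => kone ny t k i l) + fun ω => sker θ.2 (sched p ω) t k i l := by
    ext ω
    simp [noiseCoeff_eq]
  rw [e, add_mul, ENNReal.coe_add]
  refine (eLpNorm_add_le aestronglyMeasurable_const ((hc θ.2).rker.memLp hp t k i l).1
    (by norm_num)).trans (add_le_add ?_ ((hc θ.2).bound t k i l))
  rw [eLpNorm_const _ two_ne_zero (IsProbabilityMeasure.ne_zero μ)]
  rcases Nat.eq_zero_or_pos k with rfl | hk
  · simp only [kone, if_true, measure_univ, ENNReal.one_rpow, mul_one, pow_zero, ENNReal.coe_one,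
      Matrix.one_apply]
    split_ifs <;> simp
  · simp [kone, hk.ne']

theorem IsWhiteScheduling.goodKer_inv {θ : Params ny nu np nb nc}
    (h : KBd μ (fun ω => invNoiseCoeff θ (sched p ω)) K ρ) (hρ : ρ < 1) :
    GoodKer μ p (fun ω => invNoiseCoeff θ (sched p ω)) K ρ :=
  ⟨hp.rker_inv θ, hp.lker_inv θ, h, hρ⟩

theorem gapp_inv_gapp (hκ : Junction μ p κ) (hz : Adm μ p z M) {θ : Params ny nu np nb nc}
    (h : GoodKer μ p (fun ω => invNoiseCoeff θ (sched p ω)) K ρ) (t : ℤ) :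
    gapp (fun ω => invNoiseCoeff θ (sched p ω)) (gapp (fun ω => noiseCoeff θ (sched p ω)) z) t
      =ᵐ[μ] z t := by
  obtain ⟨K', hK'⟩ := hp.exists_goodKer_noiseCoeff θ
  refine (gapp_conv hp hκ hz h hK' t).symm.trans (ae_of_all _ fun ω => ?_)
  simp only [invNoiseCoeff_conv_noiseCoeff]
  exact gapp_kone t ω

theorem gapp_gapp_inv (hκ : Junction μ p κ) (hz : Adm μ p z M) {θ : Params ny nu np nb nc}
    (h : GoodKer μ p (fun ω => invNoiseCoeff θ (sched p ω)) K ρ) (t : ℤ) :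
    gapp (fun ω => noiseCoeff θ (sched p ω)) (gapp (fun ω => invNoiseCoeff θ (sched p ω)) z) t
      =ᵐ[μ] z t := by
  obtain ⟨K', hK'⟩ := hp.exists_goodKer_noiseCoeff θ
  refine (gapp_conv hp hκ hz hK' h t).symm.trans (ae_of_all _ fun ω => ?_)
  simp only [noiseCoeff_conv_invNoiseCoeff]
  exact gapp_kone t ω

/-- Perturbation of the inverse noise filter. -/
theorem gapp_inv_eq (hκ : Junction μ p κ) (hz : Adm μ p z M) {θ θ' : Params ny nu np nb nc}
    (h : GoodKer μ p (fun ω => invNoiseCoeff θ (sched p ω)) K ρ)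
    (h' : GoodKer μ p (fun ω => invNoiseCoeff θ' (sched p ω)) K' ρ') (t : ℤ) :
    gapp (fun ω => invNoiseCoeff θ (sched p ω)) z t =ᵐ[μ] fun ω =>
      gapp (fun ω => invNoiseCoeff θ' (sched p ω)) z t ω
      + gapp (fun ω => invNoiseCoeff θ' (sched p ω)) (gapp (fun ω => sker (θ'.2 - θ.2) (sched p ω))
          (gapp (fun ω => invNoiseCoeff θ (sched p ω)) z)) t ω := by
  have hw := hz.gapp hp hκ h
  obtain ⟨c, hc⟩ := hp.exists_goodKer_sker (μ := μ) (p := p) ny nc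
  -- `C'(Γz) = C(Γz) + (C' - C)Γz = z + (C' - C)Γz`. Applying `Γ'` to both sides gives the claim.
  have h1 : ∀ s, gapp (fun ω => noiseCoeff θ' (sched p ω))
      (gapp (fun ω => invNoiseCoeff θ (sched p ω)) z) s =ᵐ[μ] fun ω => z s ω +
        gapp (fun ω => sker (θ'.2 - θ.2) (sched p ω))
          (gapp (fun ω => invNoiseCoeff θ (sched p ω)) z) s ω := by
    intro s
    filter_upwards [gapp_gapp_inv hp hκ hz h s] with ω hω
    rw [gapp_noiseCoeff] at hω ⊢
    rw [gapp_sker_sub, ← hω]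
    abel
  refine (gapp_inv_gapp hp hκ hw h' t).symm.trans ?_
  exact (gapp_congr h1 t).trans (gapp_add hp hκ hz (hw.gapp hp hκ (hc _)) h' t)

end Filters


/-! ### White noise -/

section Noise

variable {Ω : Type*} {m0 : MeasurableSpace Ω} {μ : Measure Ω} {ny np : ℕ}
  {p : ℤ → Ω → Fin np → ℝ} {e : ℤ → Ω → Fin ny → ℝ} {S : Matrix (Fin ny) (Fin ny) ℝ}

/-- The σ-algebra generated by the noise. -/
@[reducible] def noiseSigma (e : ℤ → Ω → Fin ny → ℝ) : MeasurableSpace Ω :=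
  MeasurableSpace.comap (fun ω (t : ℤ) => e t ω) inferInstance

theorem measurable_noiseSigma (t : ℤ) (i : Fin ny) :
    Measurable[noiseSigma e] fun ω => e t ω i :=
  (measurable_pi_apply i).comp
    ((measurable_pi_apply t).comp (comap_measurable fun ω (t : ℤ) => e t ω))

theorem RL.measurable_schedSigma {τ : ℤ} {X : Ω → ℝ} (hX : RL μ p τ X) :
    Measurable[schedSigma p] X :=
  (hX.measurable_sig (Set.subset_univ _)).mono (sig_le_schedSigma _) le_rfl

theorem IsNoise.noiseSigma_le (he : IsNoise μ e S) : noiseSigma e ≤ m0 :=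
  (measurable_pi_lambda _ fun t => he.measurable t).comap_le

theorem IsNoise.eLpNorm_eq (he : IsNoise μ e S) (t : ℤ) (i : Fin ny) :
    eLpNorm (fun ω => e t ω i) 2 μ = eLpNorm (fun ω => e 0 ω i) 2 μ :=
  ((he.identDistrib t).comp (measurable_pi_apply i)).eLpNorm_eq 2

theorem IsNoise.integral_mul_of_ne (he : IsNoise μ e S) {t s : ℤ} (h : t ≠ s) (i j : Fin ny) :
    ∫ ω, e t ω i * e s ω j ∂μ = 0 := by
  have h1 : IndepFun (fun ω => e t ω i) (fun ω => e s ω j) μ :=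
    (he.indep.indepFun h).comp (measurable_pi_apply i) (measurable_pi_apply j)
  rw [h1.integral_fun_mul_eq_mul_integral (he.memLp t i).1 (he.memLp s j).1, he.mean_zero,
    zero_mul]

theorem IsNoise.eLpNorm_le (he : IsNoise μ e S) (t : ℤ) (i : Fin ny) :
    eLpNorm (fun ω => e t ω i) 2 μ
      ≤ (∑ j, (eLpNorm (fun ω => e 0 ω j) 2 μ).toNNReal : ℝ≥0) := by
  rw [he.eLpNorm_eq, ← ENNReal.coe_toNNReal (he.memLp 0 i).2.ne]
  exact ENNReal.coe_le_coe.2 (Finset.single_le_sum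
    (f := fun j => (eLpNorm (fun ω => e 0 ω j) 2 μ).toNNReal)
    (fun _ _ => by positivity) (Finset.mem_univ i))

variable (he : IsNoise μ e S) (hps : schedSigma p ≤ m0)
  (hpe : Indep (schedSigma p) (noiseSigma e) μ)

include he hps hpe

theorem IsNoise.eLpNorm_mul {X : Ω → ℝ} (hX : Measurable[schedSigma p] X) (t : ℤ) (i : Fin ny) :
    eLpNorm (fun ω => X ω * e t ω i) 2 μ = eLpNorm X 2 μ * eLpNorm (fun ω => e t ω i) 2 μ :=
  eLpNorm_mul_of_indep hps he.noiseSigma_le hpe hX (measurable_noiseSigma t i)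

theorem IsNoise.memLp_mul {X : Ω → ℝ} (hX : Measurable[schedSigma p] X) (hX2 : MemLp X 2 μ)
    (t : ℤ) (i : Fin ny) : MemLp (fun ω => X ω * e t ω i) 2 μ :=
  memLp_mul_of_indep hps he.noiseSigma_le hpe hX (measurable_noiseSigma t i) hX2 (he.memLp t i)

/-- Scheduling and noise are independent, so the norm of the product is exactly the product of the
norms. -/
theorem IsNoise.exists_adm : ∃ M, Adm μ p e M := by
  refine ⟨∑ j, (eLpNorm (fun ω => e 0 ω j) 2 μ).toNNReal, he.measurable, fun t i X hX => ?_⟩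
  rw [he.eLpNorm_mul hps hpe hX.measurable_schedSigma, mul_comm]
  gcongr
  exact he.eLpNorm_le t i

theorem IsNoise.integral_mul_mul {F G : Ω → ℝ} (hF : Measurable[schedSigma p] F)
    (hG : Measurable[schedSigma p] G) (t s : ℤ) (i j : Fin ny) :
    ∫ ω, F ω * e t ω i * (G ω * e s ω j) ∂μ
      = (∫ ω, F ω * G ω ∂μ) * ∫ ω, e t ω i * e s ω j ∂μ := by
  refine Eq.trans (integral_congr_ae (ae_of_all _ fun ω => ?_))
    (integral_mul_of_indep hps he.noiseSigma_le hpe (hF.mul hG)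
      ((measurable_noiseSigma t i).mul (measurable_noiseSigma s j)))
  beta_reduce
  ring

theorem IsNoise.orthUpTo {F : Ω → ℝ} (hF : Measurable[schedSigma p] F) (t : ℤ) (i : Fin ny) :
    OrthUpTo μ p (fun ω => F ω * e t ω i) (t - 1) e := by
  intro s hs j X hX
  rw [he.integral_mul_mul hps hpe hF hX.measurable_schedSigma,
    he.integral_mul_of_ne (by omega), mul_zero]

end Noise

/-- The bound on the conditional second moment says that the measure with density `v²`, restricted
to `m`, is at most `K²` times `μ`. Integrating the `m`-measurable function `X²` against both gives
the claim, with no integrability assumed for `X`. -/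
theorem eLpNorm_mul_le_of_condExp_le {Ω : Type*} {m m0 : MeasurableSpace Ω} {μ : Measure Ω}
    [IsProbabilityMeasure μ] (hm : m ≤ m0) {v : Ω → ℝ}
    (hv : Measurable v) (hv2 : MemLp v 2 μ) {K : ℝ≥0}
    (hK : ∀ᵐ ω ∂μ, (μ[fun ω => v ω ^ 2 | m]) ω ≤ (K ^ 2 : ℝ≥0)) {X : Ω → ℝ}
    (hX : Measurable[m] X) :
    eLpNorm (fun ω => X ω * v ω) 2 μ ≤ K * eLpNorm X 2 μ := by
  have h1 : (μ.withDensity fun ω => ‖v ω‖ₑ ^ 2).trim hm ≤ ((K ^ 2 : ℝ≥0) : ℝ≥0∞) • μ.trim hm := by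
    refine Measure.le_iff.2 fun s hs => ?_
    rw [trim_measurableSet_eq hm hs, withDensity_apply _ (hm s hs), Measure.smul_apply,
      trim_measurableSet_eq hm hs, smul_eq_mul]
    have h2 : ∫⁻ ω in s, ‖v ω‖ₑ ^ 2 ∂μ = ENNReal.ofReal (∫ ω in s, v ω ^ 2 ∂μ) := by
      rw [ofReal_integral_eq_lintegral_ofReal hv2.integrable_sq.integrableOn
        (ae_of_all _ fun _ => sq_nonneg _)]
      refine lintegral_congr fun ω => ?_
      rw [← enorm_pow, Real.enorm_of_nonneg (sq_nonneg _)]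
    rw [h2, ← setIntegral_condExp hm hv2.integrable_sq hs]
    have h3 : ∫ ω in s, (μ[fun ω => v ω ^ 2 | m]) ω ∂μ ≤ ∫ _ω in s, ((K ^ 2 : ℝ≥0) : ℝ) ∂μ :=
      setIntegral_mono_ae integrable_condExp.integrableOn (integrable_const _).integrableOn hK
    rw [setIntegral_const, smul_eq_mul, mul_comm] at h3
    refine (ENNReal.ofReal_le_ofReal h3).trans (le_of_eq ?_)
    rw [ENNReal.ofReal_mul (by positivity), ENNReal.ofReal_coe_nnreal, ofReal_measureReal]
  have hXm : Measurable X := hX.mono hm le_rfl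
  have hXe : Measurable[m] fun ω => ‖X ω‖ₑ ^ 2 :=
    (continuous_enorm.measurable.pow_const 2).comp hX
  have h4 : eLpNorm (fun ω => X ω * v ω) 2 μ ^ 2 ≤ (K * eLpNorm X 2 μ) ^ 2 := by
    rw [mul_pow, eLpNorm_two_pow_two, eLpNorm_two_pow_two]
    calc ∫⁻ ω, ‖X ω * v ω‖ₑ ^ 2 ∂μ = ∫⁻ ω, ‖v ω‖ₑ ^ 2 * ‖X ω‖ₑ ^ 2 ∂μ := by
          refine lintegral_congr fun ω => ?_
          rw [enorm_mul, mul_pow, mul_comm]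
      _ = ∫⁻ ω, ‖X ω‖ₑ ^ 2 ∂(μ.withDensity fun ω => ‖v ω‖ₑ ^ 2) :=
          (lintegral_withDensity_eq_lintegral_mul μ (hv.enorm.pow_const 2)
            (hXm.enorm.pow_const 2)).symm
      _ = ∫⁻ ω, ‖X ω‖ₑ ^ 2 ∂(μ.withDensity fun ω => ‖v ω‖ₑ ^ 2).trim hm :=
          (lintegral_trim hm hXe).symm
      _ ≤ ∫⁻ ω, ‖X ω‖ₑ ^ 2 ∂(((K ^ 2 : ℝ≥0) : ℝ≥0∞) • μ.trim hm) := lintegral_mono' h1 le_rfl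
      _ = _ := by
          rw [lintegral_smul_measure, smul_eq_mul, lintegral_trim hm hXe, ENNReal.coe_pow]
  exact (ENNReal.pow_le_pow_left_iff two_ne_zero).1 h4

/-! ### The input -/

section Input

variable {Ω : Type*} {m0 : MeasurableSpace Ω} {μ : Measure Ω} [IsProbabilityMeasure μ]
  {ny nu np nb nc : ℕ}
  {p : ℤ → Ω → Fin np → ℝ} {e : ℤ → Ω → Fin ny → ℝ} {S : Matrix (Fin ny) (Fin ny) ℝ}
  {u : ℤ → Ω → Fin nu → ℝ}

/-- `c` bounds the root mean square of the input given the scheduling. -/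
def InputBound (μ : Measure Ω) (p : ℤ → Ω → Fin np → ℝ) (u : ℤ → Ω → Fin nu → ℝ) (c : ℝ≥0) :
    Prop :=
  ∀ t a (X : Ω → ℝ), Measurable[schedSigma p] X →
    eLpNorm (fun ω => X ω * u t ω a) 2 μ ≤ c * eLpNorm X 2 μ

theorem IsInput.exists_inputBound (hu : IsInput μ u p) (hps : schedSigma p ≤ m0) :
    ∃ c, InputBound μ p u c := by
  obtain ⟨K, hK⟩ := hu.bounded
  refine ⟨NNReal.sqrt K.toNNReal, fun t a X hX => ?_⟩
  refine eLpNorm_mul_le_of_condExp_le hps ((measurable_pi_apply a).comp (hu.measurable t))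
    (hu.memLp t a) ?_ hX
  filter_upwards [hK t a] with ω hω
  rw [NNReal.sq_sqrt, Real.coe_toNNReal']
  exact hω.trans (le_max_left _ _)

omit [IsProbabilityMeasure μ] in
theorem IsInput.memLp_mul (hu : IsInput μ u p) {c : ℝ≥0} (hc : InputBound μ p u c)
    (hps : schedSigma p ≤ m0) {X : Ω → ℝ}
    (hX : Measurable[schedSigma p] X) (hX2 : MemLp X 2 μ) (t : ℤ) (a : Fin nu) :
    MemLp (fun ω => X ω * u t ω a) 2 μ :=
  ⟨((hX.mono hps le_rfl).mul
    ((measurable_pi_apply a).comp (hu.measurable t))).aestronglyMeasurable,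
    (hc t a X hX).trans_lt (ENNReal.mul_lt_top ENNReal.coe_lt_top hX2.2)⟩

/-- `F * G` depends on the scheduling only and is pulled out of the conditional expectation of `u *
e`, which vanishes. -/
theorem Uncorrelated.integral_mul_eq_zero (hue : Uncorrelated μ u e p) (hu : IsInput μ u p)
    (he : IsNoise μ e S) (hps : schedSigma p ≤ m0) {F G : Ω → ℝ}
    (hF : Measurable[schedSigma p] F) (hG : Measurable[schedSigma p] G) {t s : ℤ}
    {a : Fin nu} {b : Fin ny} (h1 : MemLp (fun ω => F ω * e s ω b) 2 μ)
    (h2 : MemLp (fun ω => G ω * u t ω a) 2 μ) :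
    ∫ ω, F ω * e s ω b * (G ω * u t ω a) ∂μ = 0 := by
  have e1 : (fun ω => F ω * e s ω b * (G ω * u t ω a))
      = (F * G) * fun ω => u t ω a * e s ω b := by
    ext ω
    simp only [Pi.mul_apply]
    ring
  have hint : Integrable ((F * G) * fun ω => u t ω a * e s ω b) μ := by
    rw [← e1]
    exact integrable_mul_of_memLp_two h1 h2
  have h3 := condExp_mul_of_stronglyMeasurable_left (m := schedSigma p)
    (hF.mul hG).stronglyMeasurable hint
    (integrable_mul_of_memLp_two (hu.memLp t a) (he.memLp s b))
  rw [e1, ← integral_condExp hps]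
  refine integral_eq_zero_of_ae ?_
  filter_upwards [h3, hue t s a b] with ω h4 h5
  rw [h4, Pi.mul_apply, h5]
  simp

/-- Coefficients of a process filter. -/
abbrev ProcPar (ny nu np nb : ℕ) : Type :=
  (k : Fin (nb + 1)) → (Fin ((k : ℕ) + 1) → Fin (np + 1)) → Fin ny → Fin nu → ℝ

/-- The process filter with coefficients `g` applied to the input `u`. -/
def inOut (p : ℤ → Ω → Fin np → ℝ) (u : ℤ → Ω → Fin nu → ℝ) (g : ProcPar ny nu np nb) (t : ℤ)
    (ω : Ω) : Fin ny → ℝ := fun i =>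
  ∑ k : Fin (nb + 1), ∑ η : Fin ((k : ℕ) + 1) → Fin (np + 1), ∑ a,
    g k η i a * (sprod p t η ω * u (t - (k : ℕ)) ω a)

theorem procOut_eq_inOut (θ : Params ny nu np nb nc) (t : ℤ) (ω : Ω) :
    procOut θ (sched p ω) (fun s => u s ω) t = inOut p u θ.1 t ω := by
  ext i
  simp only [procOut, inOut, Finset.sum_apply]
  rw [← Fin.sum_univ_eq_sum_range
    (fun k => (procCoeff θ (sched p ω) t k).mulVec (u (t - (k : ℤ)) ω) i)]
  refine Finset.sum_congr rfl fun k _ => ?_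
  simp only [procCoeff, dif_pos k.2, Matrix.sum_mulVec, Finset.sum_apply, Matrix.smul_mulVec]
  refine Finset.sum_congr rfl fun η _ => ?_
  simp only [Pi.smul_apply, Matrix.mulVec, dotProduct, Matrix.of_apply, smul_eq_mul,
    Finset.mul_sum]
  refine Finset.sum_congr rfl fun a _ => ?_
  change schedProd (fun s => p s ω) t η * _ = _ * (schedProd (fun s => p s ω) t η * _)
  ring

theorem inOut_sub (g g' : ProcPar ny nu np nb) (t : ℤ) (ω : Ω) :
    inOut p u (g - g') t ω = inOut p u g t ω - inOut p u g' t ω := by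
  ext i
  simp only [inOut, Pi.sub_apply, sub_mul, Finset.sum_sub_distrib]

theorem inOut_smul (c : ℝ) (g : ProcPar ny nu np nb) (t : ℤ) (ω : Ω) :
    inOut p u (c • g) t ω = c • inOut p u g t ω := by
  ext i
  simp only [inOut, Pi.smul_apply, smul_eq_mul, Finset.mul_sum, mul_assoc]

theorem abs_procPar_le (g : ProcPar ny nu np nb) (k : Fin (nb + 1))
    (η : Fin ((k : ℕ) + 1) → Fin (np + 1)) (i : Fin ny) (a : Fin nu) : ‖g k η i a‖₊ ≤ ‖g‖₊ :=
  (nnnorm_le_pi_nnnorm _ a).trans <| (nnnorm_le_pi_nnnorm _ i).trans <|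
    (nnnorm_le_pi_nnnorm _ η).trans (nnnorm_le_pi_nnnorm g k)

theorem measurable_sprod_schedSigma (t : ℤ) {n : ℕ} (η : Fin n → Fin (np + 1)) :
    Measurable[schedSigma p] (sprod p t η) :=
  (measurable_sprod_sig η fun _ _ => Set.mem_univ _).mono (sig_le_schedSigma Set.univ) le_rfl

/-- `X * p_η(t)` is a function of the scheduling, with norm controlled by the junction at `t`; the
conditional bound on the input then applies. The constant is linear in the size of `g`, as needed
for Lipschitz estimates in the parameter. -/
theorem IsInput.exists_adm_inOut (hu : IsInput μ u p) (hp : IsWhiteScheduling μ p 4)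
    (ny nb : ℕ) : ∃ c : ℝ≥0, ∀ g : ProcPar ny nu np nb, Adm μ p (inOut p u g) (c * ‖g‖₊) := by
  have hps := hp.schedSigma_le
  obtain ⟨cu, hcu⟩ := hu.exists_inputBound hps
  obtain ⟨κ, -, hκ⟩ := hp.exists_eLpNorm_mul_le
  refine ⟨∑ k : Fin (nb + 1), ∑ η : Fin ((k : ℕ) + 1) → Fin (np + 1), ∑ _a : Fin nu,
    cu * κ * (eLpNorm (sprod p 0 η) 2 μ).toNNReal, fun g => ⟨fun t => ?_, fun t i X hX => ?_⟩⟩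
  · refine measurable_pi_lambda _ fun i => ?_
    refine Finset.measurable_sum _ fun k _ => Finset.measurable_sum _ fun η _ =>
      Finset.measurable_sum _ fun a _ => Measurable.const_mul ?_ _
    exact (hp.measurable_sprod t η).mul ((measurable_pi_apply a).comp (hu.measurable _))
  have hX' := hX.measurable_schedSigma
  have e1 : (fun ω => X ω * inOut p u g t ω i) = fun ω => ∑ k : Fin (nb + 1),
      ∑ η : Fin ((k : ℕ) + 1) → Fin (np + 1), ∑ a,
        (g k η i a • fun ω => X ω * sprod p t η ω * u (t - (k : ℕ)) ω a) ω := by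
    ext ω
    simp only [inOut, Finset.mul_sum, Pi.smul_apply, smul_eq_mul]
    refine Finset.sum_congr rfl fun k _ => Finset.sum_congr rfl fun η _ =>
      Finset.sum_congr rfl fun a _ => by ring
  have hm : ∀ (k : Fin (nb + 1)) (η : Fin ((k : ℕ) + 1) → Fin (np + 1)) a, AEStronglyMeasurable
      (g k η i a • fun ω => X ω * sprod p t η ω * u (t - (k : ℕ)) ω a) μ := fun k η a =>
    ((((hX'.mono hps le_rfl).mul (hp.measurable_sprod t η)).mul
      ((measurable_pi_apply a).comp (hu.measurable _))).const_smul _).aestronglyMeasurable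
  have hm2 : ∀ (k : Fin (nb + 1)) (η : Fin ((k : ℕ) + 1) → Fin (np + 1)), AEStronglyMeasurable
      (fun ω => ∑ a, (g k η i a • fun ω => X ω * sprod p t η ω * u (t - (k : ℕ)) ω a) ω) μ :=
    fun k η => Finset.aestronglyMeasurable_fun_sum _ fun a _ => hm k η a
  rw [e1]
  refine (eLpNorm_finset_sum_le _ fun k _ =>
    Finset.aestronglyMeasurable_fun_sum _ fun η _ => hm2 k η).trans ?_
  simp only [Finset.sum_mul, ENNReal.ofNNReal_finsetSum]
  refine Finset.sum_le_sum fun k _ => (eLpNorm_finset_sum_le _ fun η _ => hm2 k η).trans <|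
    Finset.sum_le_sum fun η _ => (eLpNorm_finset_sum_le _ fun a _ => hm k η a).trans <|
    Finset.sum_le_sum fun a _ => ?_
  rw [eLpNorm_const_smul]
  have h1 : eLpNorm (fun ω => X ω * sprod p t η ω * u (t - (k : ℕ)) ω a) 2 μ
      ≤ cu * (κ * eLpNorm X 2 μ * eLpNorm (sprod p t η) 2 μ) :=
    (hcu _ a _ (hX'.mul (measurable_sprod_schedSigma t η))).trans
      (by gcongr; exact hκ t X _ hX (hp.ll_sprod t η))
  have h2 : eLpNorm (sprod p t η) 2 μ = (eLpNorm (sprod p 0 η) 2 μ).toNNReal := by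
    rw [hp.eLpNorm_sprod t, ← hp.eLpNorm_sprod 0, ENNReal.coe_toNNReal (hp.memLp_sprod 0 η).2.ne]
  rw [h2] at h1
  have h3 : ‖g k η i a‖ₑ ≤ ‖g‖₊ := ENNReal.coe_le_coe.2 (abs_procPar_le g k η i a)
  refine (mul_le_mul' h3 h1).trans (le_of_eq ?_)
  push_cast
  ring

theorem Uncorrelated.orthUpTo_inOut (hue : Uncorrelated μ u e p) (hu : IsInput μ u p)
    (he : IsNoise μ e S) (hp : IsWhiteScheduling μ p 4)
    (hpe : Indep (schedSigma p) (noiseSigma e) μ) (g : ProcPar ny nu np nb) {F : Ω → ℝ}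
    (hF : Measurable[schedSigma p] F) (hF2 : MemLp F 2 μ) (s : ℤ) (b : Fin ny) (τ : ℤ) :
    OrthUpTo μ p (fun ω => F ω * e s ω b) τ (inOut p u g) := by
  intro t _ i X hX
  have hps := hp.schedSigma_le
  obtain ⟨cu, hcu⟩ := hu.exists_inputBound hps
  have hX' := hX.measurable_schedSigma
  have hFe := he.memLp_mul hps hpe hF hF2 s b
  have h2 : ∀ (k : Fin (nb + 1)) (η : Fin ((k : ℕ) + 1) → Fin (np + 1)) a,
      MemLp (fun ω => X ω * sprod p t η ω * u (t - (k : ℕ)) ω a) 2 μ := fun k η a =>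
    hu.memLp_mul hcu hps (hX'.mul (measurable_sprod_schedSigma t η))
      (hp.memLp_mul hX (hp.ll_sprod t η)) _ a
  have e1 : ∀ ω, F ω * e s ω b * (X ω * inOut p u g t ω i) = ∑ k : Fin (nb + 1),
      ∑ η : Fin ((k : ℕ) + 1) → Fin (np + 1), ∑ a, g k η i a *
        (F ω * e s ω b * (X ω * sprod p t η ω * u (t - (k : ℕ)) ω a)) := by
    intro ω
    simp only [inOut, Finset.mul_sum]
    refine Finset.sum_congr rfl fun k _ => Finset.sum_congr rfl fun η _ =>
      Finset.sum_congr rfl fun a _ => by ring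
  have hint := fun (k : Fin (nb + 1)) (η : Fin ((k : ℕ) + 1) → Fin (np + 1)) a =>
    (integrable_mul_of_memLp_two hFe (h2 k η a)).const_mul (g k η i a)
  simp only [e1]
  rw [integral_finsetSum _ fun k _ => integrable_finsetSum _ fun η _ =>
    integrable_finsetSum _ fun a _ => hint k η a]
  refine Finset.sum_eq_zero fun k _ => ?_
  rw [integral_finsetSum _ fun η _ => integrable_finsetSum _ fun a _ => hint k η a]
  refine Finset.sum_eq_zero fun η _ => ?_
  rw [integral_finsetSum _ fun a _ => hint k η a]
  refine Finset.sum_eq_zero fun a _ => ?_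
  have h3 := hue.integral_mul_eq_zero (G := fun ω => X ω * sprod p t η ω) hu he hps hF
    (hX'.mul (measurable_sprod_schedSigma t η)) hFe (h2 k η a)
  rw [integral_const_mul, h3, mul_zero]

end Input


/-! ### Embedding the true parameter into the model orders -/

section Padding

variable {ny nu np nb nc nb' nc' : ℕ}

/-- Uniqueness of inverses. The two parameters may have different orders, so their recursions cannot
be compared literally. -/
theorem invNoiseCoeff_congr {θ : Params ny nu np nb nc} {θ' : Params ny nu np nb' nc'}
    {q : ℤ → Fin np → ℝ} (h : noiseCoeff θ q = noiseCoeff θ' q) :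
    invNoiseCoeff θ q = invNoiseCoeff θ' q := by
  rw [← conv_kone (invNoiseCoeff θ q), ← noiseCoeff_conv_invNoiseCoeff θ' q, ← conv_assoc, ← h,
    invNoiseCoeff_conv_noiseCoeff, kone_conv]

theorem noiseCoeff_congr {θ : Params ny nu np nb nc} {θ' : Params ny nu np nb' nc}
    (h : θ.2 = θ'.2) (q : ℤ → Fin np → ℝ) : noiseCoeff θ q = noiseCoeff θ' q := by
  rw [noiseCoeff_eq, noiseCoeff_eq, h]

theorem noiseCoeff_pad (θ : Params ny nu np nb nc) (hc : nc ≤ nc') (q : ℤ → Fin np → ℝ) :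
    noiseCoeff (pad nb' nc' θ) q = noiseCoeff θ q := by
  ext t k : 2
  cases k with
  | zero => rfl
  | succ k =>
    by_cases hk : k < nc
    · simp [noiseCoeff, pad, hk, hk.trans_le hc]
    · have h0 : Matrix.of (0 : Fin ny → Fin ny → ℝ) = 0 := rfl
      simp [noiseCoeff, pad, hk, h0]

theorem procCoeff_pad (θ : Params ny nu np nb nc) (hb : nb ≤ nb') (q : ℤ → Fin np → ℝ) (t : ℤ)
    (k : ℕ) : procCoeff (pad nb' nc' θ) q t k = procCoeff θ q t k := by
  by_cases hk : k < nb + 1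
  · simp only [procCoeff, pad, dif_pos hk, dif_pos (show k < nb' + 1 by omega)]
  · have h0 : Matrix.of (0 : Fin ny → Fin nu → ℝ) = 0 := rfl
    simp only [procCoeff, pad, dif_neg hk, h0, smul_zero, Finset.sum_const_zero, dite_eq_ite,
      ite_self]

theorem output_pad (θ : Params ny nu np nb nc) (hb : nb ≤ nb') (hc : nc ≤ nc')
    (q : ℤ → Fin np → ℝ) (u : ℤ → Fin nu → ℝ) (e : ℤ → Fin ny → ℝ) (t : ℤ) :
    output (pad nb' nc' θ) q u e t = output θ q u e t := by
  simp only [output, procOut, noiseOut, procCoeff_pad θ hb, noiseCoeff_pad θ hc]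
  congr 1
  · refine (Finset.sum_subset (Finset.range_mono (by omega)) fun k _ hk => ?_).symm
    rw [Finset.mem_range] at hk
    rw [procCoeff, dif_neg hk, Matrix.zero_mulVec]
  · refine (Finset.sum_subset (Finset.range_mono (by omega)) fun k _ hk => ?_).symm
    rw [Finset.mem_range] at hk
    obtain ⟨k, rfl⟩ := Nat.exists_eq_succ_of_ne_zero (show k ≠ 0 by omega)
    rw [noiseCoeff, dif_neg (by omega), Matrix.zero_mulVec]

theorem pad_mem_stableParams {Ω : Type*} [MeasurableSpace Ω] {μ : Measure Ω}
    {p : ℤ → Ω → Fin np → ℝ} {θ : Params ny nu np nb nc} (hc : nc ≤ nc')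
    (h : θ ∈ stableParams μ p) : pad nb' nc' θ ∈ stableParams μ p := by
  simp only [stableParams, Set.mem_ofPred_eq,
    invNoiseCoeff_congr (noiseCoeff_pad (nb' := nb') θ hc _)]
  exact h

theorem stableParams_congr {Ω : Type*} [MeasurableSpace Ω] {μ : Measure Ω}
    {p : ℤ → Ω → Fin np → ℝ} {θ θ' : Params ny nu np nb nc} (hθ : θ.2 = θ'.2)
    (h : θ ∈ stableParams μ p) : θ' ∈ stableParams μ p := by
  simp only [stableParams, Set.mem_ofPred_eq,
    invNoiseCoeff_congr (noiseCoeff_congr hθ.symm _)]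
  exact h

end Padding

/-! ### Orthogonal decomposition of the prediction error -/

section Decomposition

variable {Ω : Type*} {m0 : MeasurableSpace Ω} {μ : Measure Ω}
  {ny nu np nb nc : ℕ}
  {p : ℤ → Ω → Fin np → ℝ} {e : ℤ → Ω → Fin ny → ℝ} {S : Matrix (Fin ny) (Fin ny) ℝ}
  {u : ℤ → Ω → Fin nu → ℝ}

/-- The assumptions on noise, input and scheduling. -/
structure SignalAssumptions (μ : Measure Ω) (p : ℤ → Ω → Fin np → ℝ) (e : ℤ → Ω → Fin ny → ℝ)
    (S : Matrix (Fin ny) (Fin ny) ℝ) (u : ℤ → Ω → Fin nu → ℝ) : Prop where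
  white : IsWhiteScheduling μ p 4
  noise : IsNoise μ e S
  input : IsInput μ u p
  uncorrelated : Uncorrelated μ u e p
  indep : Indep (schedSigma p) (noiseSigma e) μ

/-- The contribution of the input to the prediction error of `θ` when `θ₀` generates the data. -/
noncomputable def inErr (p : ℤ → Ω → Fin np → ℝ) (u : ℤ → Ω → Fin nu → ℝ)
    (θ₀ θ : Params ny nu np nb nc) : ℤ → Ω → Fin ny → ℝ :=
  gapp (fun ω => invNoiseCoeff θ (sched p ω)) (inOut p u (θ₀.1 - θ.1))

/-- The contribution of the past noise to the prediction error of `θ` when `θ₀` generates the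
data. -/
noncomputable def noiseErr (p : ℤ → Ω → Fin np → ℝ) (e : ℤ → Ω → Fin ny → ℝ)
    (θ₀ θ : Params ny nu np nb nc) : ℤ → Ω → Fin ny → ℝ :=
  gapp (fun ω => invNoiseCoeff θ (sched p ω))
    (gapp (fun ω => sker (θ₀.2 - θ.2) (sched p ω)) e)

variable [IsProbabilityMeasure μ]

theorem IsWhiteScheduling.exists_goodKer_inv (hp : IsWhiteScheduling μ p 4)
    {θ : Params ny nu np nb nc} (hθ : θ ∈ stableParams μ p) :
    ∃ K ρ : ℝ≥0, GoodKer μ p (fun ω => invNoiseCoeff θ (sched p ω)) K ρ := by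
  obtain ⟨K, ρ, -, h1, h⟩ := (hp.mem_stableParams_iff θ).1 hθ
  exact ⟨K, ρ, hp.goodKer_inv h h1⟩

theorem IsWhiteScheduling.exists_junction (hp : IsWhiteScheduling μ p 4) :
    ∃ κ : ℝ≥0, Junction μ p κ := by
  obtain ⟨κ, -, hκ⟩ := hp.exists_eLpNorm_mul_le
  exact ⟨κ, hκ⟩

theorem integral_zero_of_orthUpTo {g : Ω → ℝ} {τ s : ℤ} {z : ℤ → Ω → Fin ny → ℝ}
    (h : OrthUpTo μ p g τ z) (hs : s ≤ τ) (i : Fin ny) : ∫ ω, g ω * z s ω i ∂μ = 0 := by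
  simpa using h s hs i (fun _ => 1) Lin.one

omit [IsProbabilityMeasure μ] in
theorem integral_add_sq {f g : Ω → ℝ} (hf : MemLp f 2 μ) (hg : MemLp g 2 μ)
    (e : ∫ ω, f ω * g ω ∂μ = 0) :
    ∫ ω, (f ω + g ω) ^ 2 ∂μ = ∫ ω, f ω ^ 2 ∂μ + ∫ ω, g ω ^ 2 ∂μ := by
  have e1 : ∀ ω, (f ω + g ω) ^ 2 = f ω ^ 2 + (g ω ^ 2 + 2 * (f ω * g ω)) := fun ω => by ring
  have h3 := (integrable_mul_of_memLp_two hf hg).const_mul 2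
  have h4 : Integrable (fun ω => g ω ^ 2 + 2 * (f ω * g ω)) μ := hg.integrable_sq.add h3
  simp only [e1]
  rw [integral_add hf.integrable_sq h4, integral_add hg.integrable_sq h3,
    integral_const_mul, e, mul_zero, add_zero]

variable (H : SignalAssumptions μ p e S u) {θ₀ θ : Params ny nu np nb nc}
  (hθ : θ ∈ stableParams μ p)

include H

omit [IsProbabilityMeasure μ] in
theorem SignalAssumptions.orthUpTo_noise (t : ℤ) (i : Fin ny) :
    OrthUpTo μ p (fun ω => e t ω i) (t - 1) e := by
  simpa using H.noise.orthUpTo H.white.schedSigma_le H.indep (F := fun _ => 1) measurable_const t i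

theorem SignalAssumptions.orthUpTo_inOut {F : Ω → ℝ} (hF : Measurable[schedSigma p] F)
    (hF2 : MemLp F 2 μ) (g : ProcPar ny nu np nb) (s : ℤ) (b : Fin ny) (τ : ℤ) :
    OrthUpTo μ p (fun ω => F ω * e s ω b) τ (inOut p u g) :=
  H.uncorrelated.orthUpTo_inOut H.input H.noise H.white H.indep g hF hF2 s b τ

/-- The roles are exchanged: `X * e s` is held fixed and is orthogonal to the unfiltered input part
at every time, hence to the filtered one by `OrthUpTo.gapp`. -/
theorem SignalAssumptions.orthUpTo_gapp_inOut {F : Ω → Ker ny} {K ρ : ℝ≥0}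
    (hF : GoodKer μ p F K ρ) (g : ProcPar ny nu np nb) (t : ℤ) (i : Fin ny) (τ : ℤ) :
    OrthUpTo μ p (fun ω => gapp F (inOut p u g) t ω i) τ e := by
  intro s _ j X hX
  obtain ⟨κ, hκ⟩ := H.white.exists_junction
  obtain ⟨c, hc⟩ := H.input.exists_adm_inOut H.white ny nb
  have hX' := hX.measurable_schedSigma
  have h := (H.orthUpTo_inOut hX' (H.white.memLp_rl hX) g s j t).gapp H.white hκ (hc g) hF
    (H.noise.memLp_mul H.white.schedSigma_le H.indep hX' (H.white.memLp_rl hX) s j)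
  rw [← integral_zero_of_orthUpTo h le_rfl i]
  refine integral_congr_ae (ae_of_all _ fun ω => ?_)
  exact mul_comm _ _

omit [IsProbabilityMeasure μ] in
theorem SignalAssumptions.adm_noise : ∃ M, Adm μ p e M :=
  H.noise.exists_adm H.white.schedSigma_le H.indep

theorem SignalAssumptions.adm_gapp_sker (h : NoisePar ny np nc) :
    ∃ M, Adm μ p (gapp (fun ω => sker h (sched p ω)) e) M := by
  obtain ⟨κ, hκ⟩ := H.white.exists_junction
  obtain ⟨M, hM⟩ := H.adm_noise
  obtain ⟨c, hc⟩ := H.white.exists_goodKer_sker ny nc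
  exact ⟨_, hM.gapp H.white hκ (hc h)⟩

include hθ

theorem SignalAssumptions.adm_noiseErr : ∃ M, Adm μ p (noiseErr p e θ₀ θ) M := by
  obtain ⟨κ, hκ⟩ := H.white.exists_junction
  obtain ⟨M, hM⟩ := H.adm_gapp_sker (θ₀.2 - θ.2)
  obtain ⟨K, ρ, hK⟩ := H.white.exists_goodKer_inv hθ
  exact ⟨_, hM.gapp H.white hκ hK⟩

theorem SignalAssumptions.adm_inErr : ∃ M, Adm μ p (inErr p u θ₀ θ) M := by
  obtain ⟨κ, hκ⟩ := H.white.exists_junction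
  obtain ⟨c, hc⟩ := H.input.exists_adm_inOut H.white ny nb
  obtain ⟨K, ρ, hK⟩ := H.white.exists_goodKer_inv hθ
  exact ⟨_, (hc _).gapp H.white hκ hK⟩

/-- A variable orthogonal to the noise up to time `τ` is orthogonal to the noise part of the
prediction error up to time `τ + 1`. -/
theorem SignalAssumptions.orthUpTo_noiseErr {g : Ω → ℝ} (hg : MemLp g 2 μ) {τ : ℤ}
    (h : OrthUpTo μ p g τ e) : OrthUpTo μ p g (τ + 1) (noiseErr p e θ₀ θ) := by
  obtain ⟨κ, hκ⟩ := H.white.exists_junction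
  obtain ⟨M, hM⟩ := H.adm_noise
  obtain ⟨c, hc⟩ := H.white.exists_goodKer_sker ny nc
  obtain ⟨K, ρ, hK⟩ := H.white.exists_goodKer_inv hθ
  exact (h.gapp_strict H.white hκ hM (hc (θ₀.2 - θ.2)) (fun ω t => sker_zero_lag _ _ _) hg).gapp
    H.white hκ (hM.gapp H.white hκ (hc _)) hK hg

/-- `y - Bu = (B₀ - B)u + Ce + (C₀ - C)e`. Applying `Γ` term by term, the middle summand returns
`e`. -/
theorem SignalAssumptions.predErrorProc_ae_eq {y : ℤ → Ω → Fin ny → ℝ}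
    (hy : ∀ t ω, y t ω = output θ₀ (sched p ω) (fun s => u s ω) (fun s => e s ω) t)
    (t : ℤ) : predErrorProc θ p u y t =ᵐ[μ] fun ω =>
      inErr p u θ₀ θ t ω + (e t ω + noiseErr p e θ₀ θ t ω) := by
  obtain ⟨κ, hκ⟩ := H.white.exists_junction
  obtain ⟨M, hM⟩ := H.adm_noise
  obtain ⟨c, hc⟩ := H.white.exists_goodKer_sker ny nc
  obtain ⟨cu, hcu⟩ := H.input.exists_adm_inOut H.white ny nb
  obtain ⟨K, ρ, hK⟩ := H.white.exists_goodKer_inv hθ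
  obtain ⟨K', hK'⟩ := H.white.exists_goodKer_noiseCoeff θ
  have h1 : predErrorProc θ p u y t = gapp (fun ω => invNoiseCoeff θ (sched p ω))
      (fun s ω => inOut p u (θ₀.1 - θ.1) s ω + (fun s ω =>
        gapp (fun ω => noiseCoeff θ (sched p ω)) e s ω +
        gapp (fun ω => sker (θ₀.2 - θ.2) (sched p ω)) e s ω) s ω) t := by
    ext1 ω
    change ∑' r : ℕ, (invNoiseCoeff θ (sched p ω) t r).mulVec
      (y (t - r) ω - procOut θ (sched p ω) (fun s => u s ω) (t - r)) = _
    refine tsum_congr fun r => ?_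
    congr 1
    beta_reduce
    rw [hy, output, procOut_eq_inOut, procOut_eq_inOut, noiseOut_eq, inOut_sub, gapp_noiseCoeff,
      gapp_sker_sub]
    abel
  have hCe := hM.gapp H.white hκ hK'
  have hDe := hM.gapp H.white hκ (hc (θ₀.2 - θ.2))
  rw [h1]
  filter_upwards [gapp_add H.white hκ (hcu (θ₀.1 - θ.1)) (hCe.add H.white hDe) hK t,
    gapp_add H.white hκ hCe hDe hK t, gapp_inv_gapp H.white hκ hM hK t] with ω h2 h3 h4
  rw [h2, h3, h4]
  rfl

theorem SignalAssumptions.integral_noise_mul_inErr (t s : ℤ) (i j : Fin ny) :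
    ∫ ω, inErr p u θ₀ θ t ω i * e s ω j ∂μ = 0 := by
  obtain ⟨K, ρ, hK⟩ := H.white.exists_goodKer_inv hθ
  exact integral_zero_of_orthUpTo (H.orthUpTo_gapp_inOut hK (θ₀.1 - θ.1) t i s) le_rfl j

theorem SignalAssumptions.integral_inErr_mul_noiseErr (t s : ℤ) (i j : Fin ny) :
    ∫ ω, inErr p u θ₀ θ t ω i * noiseErr p e θ₀ θ s ω j ∂μ = 0 := by
  obtain ⟨K, ρ, hK⟩ := H.white.exists_goodKer_inv hθ
  obtain ⟨M, hM⟩ := H.adm_inErr (θ₀ := θ₀) hθ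
  exact integral_zero_of_orthUpTo (H.orthUpTo_noiseErr hθ (hM.memLp t i)
    (H.orthUpTo_gapp_inOut hK (θ₀.1 - θ.1) t i s)) (by omega) j

theorem SignalAssumptions.integral_noise_mul_noiseErr (t : ℤ) (i j : Fin ny) :
    ∫ ω, e t ω i * noiseErr p e θ₀ θ t ω j ∂μ = 0 :=
  integral_zero_of_orthUpTo (H.orthUpTo_noiseErr hθ (H.noise.memLp t i) (H.orthUpTo_noise t i))
    (by omega) j

/-- The mean square of the prediction error. -/
theorem SignalAssumptions.integral_predError_sq (t : ℤ) (i : Fin ny) :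
    ∫ ω, (inErr p u θ₀ θ t ω i + (e t ω i + noiseErr p e θ₀ θ t ω i)) ^ 2 ∂μ
      = S i i + ∫ ω, inErr p u θ₀ θ t ω i ^ 2 ∂μ + ∫ ω, noiseErr p e θ₀ θ t ω i ^ 2 ∂μ := by
  obtain ⟨M, hM⟩ := H.adm_inErr (θ₀ := θ₀) hθ
  obtain ⟨M', hM'⟩ := H.adm_noiseErr (θ₀ := θ₀) hθ
  have h1 := hM.memLp t i
  have h2 := hM'.memLp t i
  have h3 := H.noise.memLp t i
  rw [integral_add_sq (g := fun ω => e t ω i + noiseErr p e θ₀ θ t ω i) h1 (h3.add h2) ?_, integral_add_sq h3 h2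
    (H.integral_noise_mul_noiseErr hθ t i i)]
  · simp only [sq, H.noise.covariance]
    ring
  · simp only [mul_add]
    rw [integral_add (integrable_mul_of_memLp_two h1 h3) (integrable_mul_of_memLp_two h1 h2),
      H.integral_noise_mul_inErr hθ, H.integral_inErr_mul_noiseErr hθ, add_zero]

/-- The mean square of the prediction error at time `t`, decomposed into the contributions of the
current noise, the input and the past noise. -/
theorem SignalAssumptions.trace_predErrorProc {y : ℤ → Ω → Fin ny → ℝ}
    (hy : ∀ t ω, y t ω = output θ₀ (sched p ω) (fun s => u s ω) (fun s => e s ω) t)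
    (t : ℤ) : (Matrix.of fun i j =>
      ∫ ω, predErrorProc θ p u y t ω i * predErrorProc θ p u y t ω j ∂μ).trace
      = S.trace + ∑ i, ∫ ω, inErr p u θ₀ θ t ω i ^ 2 ∂μ
        + ∑ i, ∫ ω, noiseErr p e θ₀ θ t ω i ^ 2 ∂μ := by
  simp only [Matrix.trace, Matrix.diag, Matrix.of_apply]
  rw [← Finset.sum_add_distrib, ← Finset.sum_add_distrib]
  refine Finset.sum_congr rfl fun i _ => ?_
  rw [← H.integral_predError_sq hθ t i]
  refine integral_congr_ae ?_
  filter_upwards [H.predErrorProc_ae_eq hθ hy t] with ω hω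
  rw [hω, sq]
  rfl

end Decomposition


/-! ### Time averages -/

section TimeAverage

variable {x y : ℤ → ℝ} {a b : ℝ}

theorem HasTimeAverage.unique (hx : HasTimeAverage x a) (hx' : HasTimeAverage x b) : a = b :=
  tendsto_nhds_unique hx hx'

theorem HasTimeAverage.const_mul (hx : HasTimeAverage x a) (c : ℝ) :
    HasTimeAverage (fun t => c * x t) (c * a) := by
  refine (Tendsto.const_mul c hx).congr fun N => ?_
  rw [← Finset.mul_sum]
  ring

theorem HasTimeAverage.add (hx : HasTimeAverage x a) (hy : HasTimeAverage y b) :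
    HasTimeAverage (fun t => x t + y t) (a + b) := by
  refine (Tendsto.add hx hy).congr fun N => ?_
  rw [Finset.sum_add_distrib, mul_add]

theorem HasTimeAverage.sub (hx : HasTimeAverage x a) (hy : HasTimeAverage y b) :
    HasTimeAverage (fun t => x t - y t) (a - b) := by
  refine (Tendsto.sub hx hy).congr fun N => ?_
  rw [Finset.sum_sub_distrib, mul_sub]

theorem hasTimeAverage_const (c : ℝ) : HasTimeAverage (fun _ => c) c := by
  refine tendsto_const_nhds.congr' ?_
  filter_upwards [eventually_gt_atTop 0] with N hN
  have : (N : ℝ) ≠ 0 := by positivity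
  simp only [Finset.sum_const, Nat.card_Icc, nsmul_eq_mul]
  field_simp
  simp

theorem hasTimeAverage_sum {ι : Type*} (s : Finset ι) {x : ι → ℤ → ℝ} {a : ι → ℝ}
    (h : ∀ i ∈ s, HasTimeAverage (x i) (a i)) :
    HasTimeAverage (fun t => ∑ i ∈ s, x i t) (∑ i ∈ s, a i) := by
  refine (tendsto_finsetSum s h).congr fun N => ?_
  rw [Finset.sum_comm, Finset.mul_sum]

theorem HasTimeAverage.mono (hx : HasTimeAverage x a) (hy : HasTimeAverage y b)
    (h : ∀ t, x t ≤ y t) : a ≤ b := by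
  refine le_of_tendsto_of_tendsto' hx hy fun N => ?_
  gcongr with t
  exact h t

/-- A shift by one step changes the sum by two boundary terms, which are bounded and disappear after
division by `N`. -/
theorem HasTimeAverage.shift (hx : HasTimeAverage x a) {B : ℝ} (hB : ∀ t, |x t| ≤ B) (j : ℕ) :
    HasTimeAverage (fun t => x (t - j)) a := by
  induction j with
  | zero => simpa using hx
  | succ j ih =>
    have h1 : Tendsto (fun N : ℕ => (1 / (N : ℝ)) * (x (0 - j) - x ((N : ℤ) - j))) atTop (𝓝 0) := by
      have h2 : Tendsto (fun N : ℕ => (1 / (N : ℝ)) * (2 * B)) atTop (𝓝 0) := by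
        simpa using tendsto_one_div_atTop_nhds_zero_nat.mul_const (2 * B)
      refine squeeze_zero_norm (fun N => ?_) h2
      rw [norm_mul, Real.norm_of_nonneg (by positivity)]
      refine mul_le_mul_of_nonneg_left ?_ (by positivity)
      rw [Real.norm_eq_abs, two_mul]
      exact (abs_sub _ _).trans (add_le_add (hB _) (hB _))
    have h3 := Tendsto.add ih h1
    rw [add_zero] at h3
    refine h3.congr fun N => ?_
    rw [← mul_add]
    congr 1
    induction N with
    | zero => simp
    | succ N ihN =>
      rw [Finset.sum_Icc_succ_top (by omega), Finset.sum_Icc_succ_top (by omega), ← ihN]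
      push_cast
      rw [show (N : ℤ) + 1 - (j + 1) = N - j by ring]
      ring

/-- A nonnegative sequence that is small in time average whenever another one is. -/
theorem HasTimeAverage.of_le_add {z : ℕ → ℤ → ℝ} {c : ℕ → ℝ} (hx : ∀ t, 0 ≤ x t)
    (hz : ∀ n, HasTimeAverage (z n) (c n)) (hc : Tendsto c atTop (𝓝 0))
    (h : ∀ n t, x t ≤ z n t) : HasTimeAverage x 0 := by
  refine tendsto_order.2 ⟨fun b hb => Eventually.of_forall fun N => hb.trans_le ?_, fun b hb => ?_⟩
  · exact mul_nonneg (by positivity) (Finset.sum_nonneg fun t _ => hx t)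
  · obtain ⟨n, hn⟩ := (hc.eventually (gt_mem_nhds hb)).exists
    filter_upwards [(hz n).eventually (gt_mem_nhds hn)] with N hN
    refine lt_of_le_of_lt ?_ hN
    gcongr with t
    exact h n t

end TimeAverage

/-! ### Persistence of excitation -/

section UniformlyBounded

variable {Ω : Type*} {m0 : MeasurableSpace Ω} {μ : Measure Ω}

/-- A process with uniformly bounded second moments. -/
def UBdd (μ : Measure Ω) (f : ℤ → Ω → ℝ) : Prop :=
  (∀ t, AEStronglyMeasurable (f t) μ) ∧ ∃ B : ℝ≥0, ∀ t, eLpNorm (f t) 2 μ ≤ B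

variable {f g : ℤ → Ω → ℝ}

theorem UBdd.memLp (hf : UBdd μ f) (t : ℤ) : MemLp (f t) 2 μ := by
  obtain ⟨h, B, hB⟩ := hf
  exact ⟨h t, (hB t).trans_lt ENNReal.coe_lt_top⟩

theorem UBdd.const_mul (hf : UBdd μ f) (c : ℝ) : UBdd μ (fun t ω => c * f t ω) := by
  obtain ⟨h, B, hB⟩ := hf
  refine ⟨fun t => (h t).const_mul c, ‖c‖₊ * B, fun t => ?_⟩
  change eLpNorm (c • f t) 2 μ ≤ _
  rw [eLpNorm_const_smul, ENNReal.coe_mul,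
    enorm_eq_nnnorm]
  gcongr
  exact hB t

theorem UBdd.sum {ι : Type*} (s : Finset ι) {f : ι → ℤ → Ω → ℝ} (h : ∀ i ∈ s, UBdd μ (f i)) :
    UBdd μ (fun t ω => ∑ i ∈ s, f i t ω) := by
  have h1 : ∀ i : ι, ∃ B : ℝ≥0, i ∈ s → ∀ t, eLpNorm (f i t) 2 μ ≤ B := fun i => by
    by_cases hi : i ∈ s
    · obtain ⟨B, hB⟩ := (h i hi).2
      exact ⟨B, fun _ => hB⟩
    · exact ⟨0, fun h => absurd h hi⟩
  choose B hB using h1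
  refine ⟨fun t => Finset.aestronglyMeasurable_fun_sum _ fun i hi => (h i hi).1 t,
    ∑ i ∈ s, B i, fun t => ?_⟩
  rw [ENNReal.ofNNReal_finsetSum]
  exact (eLpNorm_finset_sum_le _ fun i hi => (h i hi).1 t).trans
    (Finset.sum_le_sum fun i hi => hB i hi t)

theorem UBdd.exists_abs_integral_le (hf : UBdd μ f) (hg : UBdd μ g) :
    ∃ B : ℝ, ∀ t s, |∫ ω, f t ω * g s ω ∂μ| ≤ B := by
  obtain ⟨B, hB⟩ := hf.2
  obtain ⟨B', hB'⟩ := hg.2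
  refine ⟨B * B', fun t s => abs_integral_le_integral_abs.trans
    ((abs_integral_mul_le (hf.memLp t) (hg.memLp s)).trans ?_)⟩
  exact mul_le_mul (ENNReal.toReal_mono ENNReal.coe_ne_top (hB t))
    (ENNReal.toReal_mono ENNReal.coe_ne_top (hB' s)) ENNReal.toReal_nonneg (by positivity)

/-- The time average of the mean square of the combination is the quadratic form of the block
Toeplitz matrix at `c`. Uniform boundedness is needed to move all lags to a common origin. -/
theorem PersistentlyExciting.eq_zero {ι : Type*} [Fintype ι] {s : ℤ → Ω → ι → ℝ} {m : ℕ}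
    (h : PersistentlyExciting μ s m) (hs : ∀ a, UBdd μ (fun t ω => s t ω a))
    {c : Fin m × ι → ℝ}
    (h0 : HasTimeAverage (fun t => ∫ ω, (∑ x, c x * s (t - (x.1 : ℕ)) ω x.2) ^ 2 ∂μ) 0) :
    c = 0 := by
  obtain ⟨R, hR, hpos⟩ := h
  have h1 : HasTimeAverage (fun t => ∫ ω, (∑ x, c x * s (t - (x.1 : ℕ)) ω x.2) ^ 2 ∂μ)
      (∑ x : Fin m × ι, ∑ y : Fin m × ι,
        c x * c y * R ((y.1 : ℤ) - (x.1 : ℤ)) x.2 y.2) := by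
    have e : ∀ t, ∫ ω, (∑ x, c x * s (t - (x.1 : ℕ)) ω x.2) ^ 2 ∂μ
        = ∑ x : Fin m × ι, ∑ y : Fin m × ι, c x * c y *
          ∫ ω, s (t - (x.1 : ℕ)) ω x.2 * s (t - (x.1 : ℕ) - ((y.1 : ℤ) - (x.1 : ℤ))) ω y.2 ∂μ := by
      intro t
      have hint : ∀ x y : Fin m × ι, Integrable (fun ω => c x * c y *
          (s (t - (x.1 : ℕ)) ω x.2 * s (t - (y.1 : ℕ)) ω y.2)) μ := fun x y =>
        (integrable_mul_of_memLp_two ((hs x.2).memLp _) ((hs y.2).memLp _)).const_mul _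
      have e1 : ∀ ω, (∑ x, c x * s (t - (x.1 : ℕ)) ω x.2) ^ 2
          = ∑ x : Fin m × ι, ∑ y : Fin m × ι, c x * c y *
            (s (t - (x.1 : ℕ)) ω x.2 * s (t - (y.1 : ℕ)) ω y.2) := fun ω => by
        rw [sq, Finset.sum_mul_sum]
        refine Finset.sum_congr rfl fun x _ => Finset.sum_congr rfl fun y _ => by ring
      simp only [e1]
      rw [integral_finsetSum _ fun x _ => integrable_finsetSum _ fun y _ => hint x y]
      refine Finset.sum_congr rfl fun x _ => ?_
      rw [integral_finsetSum _ fun y _ => hint x y]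
      refine Finset.sum_congr rfl fun y _ => ?_
      rw [integral_const_mul, show t - ((x.1 : ℕ) : ℤ) - ((y.1 : ℤ) - (x.1 : ℤ)) = t - (y.1 : ℕ) by
        ring]
    simp only [e]
    refine hasTimeAverage_sum _ fun x _ => hasTimeAverage_sum _ fun y _ =>
      HasTimeAverage.const_mul ?_ _
    obtain ⟨B, hB⟩ := (hs x.2).exists_abs_integral_le (hs y.2)
    exact (hR _ x.2 y.2).shift (fun t => hB t _) x.1
  have h2 := h0.unique h1
  by_contra hc
  have h3 := hpos.dotProduct_mulVec_pos hc
  refine h3.ne (h2.trans ?_)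
  simp only [dotProduct, Matrix.mulVec, Matrix.of_apply, Pi.star_apply, star_trivial,
    Finset.mul_sum]
  refine Finset.sum_congr rfl fun x _ => Finset.sum_congr rfl fun y _ => by ring

end UniformlyBounded

/-! ### Identifiability of the process coefficients -/

section InputIdentifiability

variable {Ω : Type*} {m0 : MeasurableSpace Ω} {μ : Measure Ω} [IsProbabilityMeasure μ]
  {ny nu np nb nc : ℕ}
  {p : ℤ → Ω → Fin np → ℝ} {e : ℤ → Ω → Fin ny → ℝ} {S : Matrix (Fin ny) (Fin ny) ℝ}
  {u : ℤ → Ω → Fin nu → ℝ}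

theorem IsWhiteScheduling.ubdd_sprod (hp : IsWhiteScheduling μ p 4) (j : ℤ) {n : ℕ}
    (η : Fin n → Fin (np + 1)) : UBdd μ (fun t => sprod p (t + j) η) := by
  refine ⟨fun t => (hp.measurable_sprod _ η).aestronglyMeasurable,
    (eLpNorm (sprod p 0 η) 2 μ).toNNReal, fun t => ?_⟩
  rw [hp.eLpNorm_sprod, ← hp.eLpNorm_sprod 0, ENNReal.coe_toNNReal (hp.memLp_sprod 0 η).2.ne]

/-- Both strings start at `t`; peeling off the two leading characters leaves independent factors,
each a product of two entries at one time. -/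
theorem IsWhiteScheduling.exists_eLpNorm_sprod_mul_le (hp : IsWhiteScheduling μ p 4) (n n' : ℕ) :
    ∃ B : ℝ≥0, ∀ (t : ℤ) (η : Fin n → Fin (np + 1)) (η' : Fin n' → Fin (np + 1)),
      eLpNorm (fun ω => sprod p t η ω * sprod p t η' ω) 2 μ ≤ B := by
  obtain ⟨Q, -, hQ⟩ := hp.exists_eLpNorm_chr_mul_le
  have key : ∀ (n : ℕ), ∃ B : ℝ≥0, ∀ (t : ℤ) (η : Fin n → Fin (np + 1)),
      eLpNorm (sprod p t η) 2 μ ≤ B := by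
    intro n
    refine ⟨Q ^ n, fun t η => ?_⟩
    rw [hp.eLpNorm_sprod, ENNReal.coe_pow]
    refine (Finset.prod_le_pow_card _ _ (Q : ℝ≥0∞) fun j _ => ?_).trans (by simp)
    have := hQ 0 (η j) 0
    simpa using this
  induction n generalizing n' with
  | zero =>
    obtain ⟨B, hB⟩ := key n'
    exact ⟨B, fun t η η' => by simpa using hB t η'⟩
  | succ n ih =>
    cases n' with
    | zero =>
      obtain ⟨B, hB⟩ := key (n + 1)
      exact ⟨B, fun t η η' => by simpa using hB t η⟩
    | succ n' =>
      obtain ⟨B, hB⟩ := ih n'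
      refine ⟨Q * B, fun t η η' => ?_⟩
      have e : (fun ω => sprod p t η ω * sprod p t η' ω) = fun ω =>
          (chr p t (η 0) ω * chr p t (η' 0) ω) *
          (sprod p (t - 1) (Fin.tail η) ω * sprod p (t - 1) (Fin.tail η') ω) := by
        ext ω
        rw [sprod_succ, sprod_succ]
        ring
      have hs : ∀ {k : ℕ} (ζ : Fin k → Fin (np + 1)),
          Measurable[sig p (Set.Iio t)] (sprod p (t - 1) ζ) := fun ζ =>
        measurable_sprod_sig _ fun j _ => by simp only [Set.mem_Iio]; omega
      rw [e, eLpNorm_mul_of_indep (X := fun ω => chr p t (η 0) ω * chr p t (η' 0) ω)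
        (Y := fun ω => sprod p (t - 1) (Fin.tail η) ω * sprod p (t - 1) (Fin.tail η') ω)
        (hp.sig_le {t}) (hp.sig_le (Set.Iio t)) (hp.indep_Iio t).symm
        ((measurable_chr_sig (Set.mem_singleton t) _).mul
          (measurable_chr_sig (Set.mem_singleton t) _)) ((hs _).mul (hs _)), ENNReal.coe_mul]
      exact mul_le_mul' (hQ _ _ _) (hB _ _ _)

omit [IsProbabilityMeasure μ] in
theorem IsInput.ubdd_mul (hu : IsInput μ u p) {c : ℝ≥0} (hc : InputBound μ p u c)
    (hps : schedSigma p ≤ m0) {f : ℤ → Ω → ℝ} (hf : UBdd μ f)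
    (hfm : ∀ t, Measurable[schedSigma p] (f t)) (j : ℕ) (a : Fin nu) :
    UBdd μ (fun t ω => f t ω * u (t - j) ω a) := by
  obtain ⟨-, B, hB⟩ := hf
  refine ⟨fun t => (((hfm t).mono hps le_rfl).mul
    ((measurable_pi_apply a).comp (hu.measurable _))).aestronglyMeasurable, c * B, fun t => ?_⟩
  refine (hc (t - j) a _ (hfm t)).trans ?_
  rw [ENNReal.coe_mul]
  gcongr
  exact hB t

/-- The products of the noise filter coefficients and the filtered input are bounded. -/
theorem IsInput.ubdd_noiseCoeff_mul_inOut (hu : IsInput μ u p) (hp : IsWhiteScheduling μ p 4)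
    (g : ProcPar ny nu np nb) (θ : Params ny nu np nb nc) (k : ℕ) (i l : Fin ny) :
    UBdd μ (fun t ω => noiseCoeff θ (sched p ω) t k i l * inOut p u g t ω i) := by
  have hps := hp.schedSigma_le
  obtain ⟨cu, hcu⟩ := hu.exists_inputBound hps
  have key : ∀ (n : ℕ) (η' : Fin n → Fin (np + 1)),
      UBdd μ (fun t ω => sprod p t η' ω * inOut p u g t ω i) := by
    intro n η'
    simp only [inOut, Finset.mul_sum]
    refine UBdd.sum _ fun k _ => UBdd.sum _ fun η _ => UBdd.sum _ fun a _ => ?_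
    have h1 : UBdd μ (fun t ω => sprod p t η' ω * sprod p t η ω) := by
      obtain ⟨B, hB⟩ := hp.exists_eLpNorm_sprod_mul_le n ((k : ℕ) + 1)
      exact ⟨fun t => ((hp.measurable_sprod t η').mul
        (hp.measurable_sprod t η)).aestronglyMeasurable, B, fun t => hB t η' η⟩
    have h2 := (hu.ubdd_mul hcu hps h1 (fun t => (measurable_sprod_schedSigma t η').mul
      (measurable_sprod_schedSigma t η)) k a).const_mul (g k η i a)
    convert h2 using 3
    ring
  cases k with
  | zero =>
    have h := (key 0 Fin.elim0).const_mul ((1 : Matrix (Fin ny) (Fin ny) ℝ) i l)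
    simpa [noiseCoeff_zero_lag] using h
  | succ k =>
    have e : ∀ t ω, noiseCoeff θ (sched p ω) t (k + 1) i l
        = sker θ.2 (sched p ω) t (k + 1) i l := fun t ω => by
      rw [noiseCoeff_eq]
      simp [kone]
    simp only [e, sker_apply_succ]
    by_cases hk : k < nc
    · simp only [hk, dif_pos, Finset.sum_mul, mul_assoc]
      exact UBdd.sum _ fun η _ => (key _ η).const_mul _
    · simp only [hk, dif_neg, not_false_eq_true, zero_mul]
      exact ⟨fun t => aestronglyMeasurable_const, 0, fun t => by simp⟩

/-- If the filtered input vanishes in mean square after application of the inverse noise filter,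
it vanishes in mean square. -/
theorem IsInput.hasTimeAverage_inOut (hu : IsInput μ u p) (hp : IsWhiteScheduling μ p 4)
    (g : ProcPar ny nu np nb) {θ : Params ny nu np nb nc} (hθ : θ ∈ stableParams μ p)
    (h : HasTimeAverage (fun t =>
      ∑ i, ∫ ω, gapp (fun ω => invNoiseCoeff θ (sched p ω)) (inOut p u g) t ω i ^ 2 ∂μ) 0)
    (i : Fin ny) : HasTimeAverage (fun t => ∫ ω, inOut p u g t ω i ^ 2 ∂μ) 0 := by
  obtain ⟨κ, hκ⟩ := hp.exists_junction
  obtain ⟨K, ρ, hK⟩ := hp.exists_goodKer_inv hθ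
  obtain ⟨c, hc⟩ := hu.exists_adm_inOut hp ny nb
  set ξ := gapp (fun ω => invNoiseCoeff θ (sched p ω)) (inOut p u g) with hξ
  have hξA := (hc g).gapp hp hκ hK
  rw [← hξ] at hξA
  have hub := fun k l => hu.ubdd_noiseCoeff_mul_inOut hp g θ k i l
  choose B hB using fun k l => (hub k l).2
  have hw : ∀ t, inOut p u g t =ᵐ[μ] fun ω => ∑ k ∈ Finset.range (nc + 1),
      (noiseCoeff θ (sched p ω) t k).mulVec (ξ (t - k) ω) := by
    intro t
    filter_upwards [gapp_gapp_inv hp hκ (hc g) hK t] with ω hω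
    rw [← hω, gapp_noiseCoeff, ← noiseOut_eq]
    rfl
  -- The coefficients of `C` are unbounded, so `w = Cξ` cannot be estimated directly by `ξ`. Only
  -- one factor of `w²` is expanded, and the coefficient goes with the other: `E w² = ∑ E (C_k w)
  -- ξ(t - k)`, where `C_k w` is bounded in `L²`.
  have hle : ∀ t, ∫ ω, inOut p u g t ω i ^ 2 ∂μ ≤ ∑ k ∈ Finset.range (nc + 1), ∑ l,
      B k l * (eLpNorm (fun ω => ξ (t - k) ω l) 2 μ).toReal := by
    intro t
    have e1 : ∫ ω, inOut p u g t ω i ^ 2 ∂μ = ∫ ω, ∑ k ∈ Finset.range (nc + 1), ∑ l,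
        noiseCoeff θ (sched p ω) t k i l * inOut p u g t ω i * ξ (t - k) ω l ∂μ := by
      refine integral_congr_ae ?_
      filter_upwards [hw t] with ω hω
      rw [sq]
      nth_rw 1 [hω]
      simp only [Finset.sum_apply, Matrix.mulVec, dotProduct, Finset.sum_mul]
      refine Finset.sum_congr rfl fun k _ => Finset.sum_congr rfl fun l _ => by ring
    have hint := fun k l => integrable_mul_of_memLp_two ((hub k l).memLp t)
      (hξA.memLp (t - (k : ℕ)) l)
    rw [e1, integral_finsetSum _ fun k _ => integrable_finsetSum _ fun l _ => hint k l]
    refine Finset.sum_le_sum fun k _ => ?_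
    rw [integral_finsetSum _ fun l _ => hint k l]
    refine Finset.sum_le_sum fun l _ => ?_
    refine (le_abs_self _).trans (abs_integral_le_integral_abs.trans
      ((abs_integral_mul_le ((hub k l).memLp t) (hξA.memLp _ l)).trans ?_))
    gcongr
    exact ENNReal.toReal_mono ENNReal.coe_ne_top (hB k l t)
  have hξb : ∀ t l, (eLpNorm (fun ω => ξ t ω l) 2 μ).toReal ^ 2 ≤ ∑ i, ∫ ω, ξ t ω i ^ 2 ∂μ := by
    intro t l
    rw [← integral_sq_eq (hξA.memLp t l)]
    exact Finset.single_le_sum (f := fun i => ∫ ω, ξ t ω i ^ 2 ∂μ)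
      (fun j _ => integral_nonneg fun _ => sq_nonneg _) (Finset.mem_univ l)
  have hbdd : ∃ B : ℝ, ∀ t, |∑ i, ∫ ω, ξ t ω i ^ 2 ∂μ| ≤ B := by
    have h1 : ∀ i, UBdd μ (fun t ω => ξ t ω i) := fun i =>
      ⟨fun t => (hξA.memLp t i).1, _, fun t => hξA.eLpNorm_le t i⟩
    choose B' hB' using fun i => (h1 i).exists_abs_integral_le (h1 i)
    refine ⟨∑ i, B' i, fun t => (Finset.abs_sum_le_sum_abs _ _).trans
      (Finset.sum_le_sum fun i _ => ?_)⟩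
    simpa only [sq] using hB' i t t
  obtain ⟨B', hB'⟩ := hbdd
  -- The bound is linear in the norm of `ξ`, whereas only the average of its square is known to
  -- vanish. This inequality trades one for the other, with an error `1 / (n + 1)` that is made
  -- small afterwards.
  have hδ : ∀ (n : ℕ) (a : ℝ), a ≤ 1 / ((n : ℝ) + 1) + ((n : ℝ) + 1) * a ^ 2 := by
    intro n a
    have hn : (0 : ℝ) < (n : ℝ) + 1 := by positivity
    have h1 : 0 ≤ 1 / ((n : ℝ) + 1) * ((((n : ℝ) + 1) * a - 1 / 2) ^ 2 + 3 / 4) := by positivity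
    have h2 : 1 / ((n : ℝ) + 1) * ((((n : ℝ) + 1) * a - 1 / 2) ^ 2 + 3 / 4)
      = 1 / ((n : ℝ) + 1) + ((n : ℝ) + 1) * a ^ 2 - a := by
      field_simp
      ring
    linarith
  refine HasTimeAverage.of_le_add (z := fun n t => ∑ k ∈ Finset.range (nc + 1), ∑ l : Fin ny,
    B k l * (1 / ((n : ℝ) + 1) + ((n : ℝ) + 1) * ∑ i, ∫ ω, ξ (t - k) ω i ^ 2 ∂μ))
    (c := fun n => ∑ k ∈ Finset.range (nc + 1), ∑ l : Fin ny,
      (B k l : ℝ) * (1 / ((n : ℝ) + 1) + ((n : ℝ) + 1) * 0))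
    (fun t => integral_nonneg fun _ => sq_nonneg _) (fun n => ?_) ?_ (fun n t => ?_)
  · exact hasTimeAverage_sum _ fun k _ => hasTimeAverage_sum _ fun l _ =>
      ((hasTimeAverage_const _).add ((h.shift hB' k).const_mul _)).const_mul _
  · have : Tendsto (fun n : ℕ => ∑ k ∈ Finset.range (nc + 1), ∑ l : Fin ny,
        (B k l : ℝ) * (1 / ((n : ℝ) + 1) + ((n : ℝ) + 1) * 0)) atTop
        (𝓝 (∑ k ∈ Finset.range (nc + 1), ∑ l : Fin ny, (B k l : ℝ) * 0)) := by
      refine tendsto_finsetSum _ fun k _ => tendsto_finsetSum _ fun l _ => ?_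
      simp only [mul_zero, add_zero]
      simpa using tendsto_one_div_add_atTop_nhds_zero_nat.const_mul (B k l : ℝ)
    simpa using this
  · refine (hle t).trans (Finset.sum_le_sum fun k _ => Finset.sum_le_sum fun l _ => ?_)
    refine mul_le_mul_of_nonneg_left ((hδ n _).trans ?_) (by positivity)
    gcongr
    exact hξb _ l

/-- The string of a process coefficient of lag `k`, reversed and padded with zeros. -/
def revPad (n : ℕ) {np k : ℕ} (η : Fin (k + 1) → Fin (np + 1)) (j : Fin (n + 1)) : Fin (np + 1) :=
  if (j : ℕ) ≤ k then η ⟨k - j, by omega⟩ else 0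

theorem revPad_injective {n k : ℕ} (hk : k ≤ n) :
    Function.Injective (revPad n (np := np) (k := k)) := by
  intro η η' h
  ext1 j
  have h1 := congrFun h ⟨k - j, by omega⟩
  simp only [revPad, if_pos (show k - (j : ℕ) ≤ k by omega)] at h1
  have e : (⟨k - (k - (j : ℕ)), by omega⟩ : Fin (k + 1)) = j := Fin.ext (by simp only; omega)
  rwa [e] at h1

/-- The extended input at time `t - k` looks forward from `t - k` to `t - k + n`, whereas a string
of lag `k` reads backwards from `t` to `t - k`. Hence the reversal; the remaining times get the
character `0`, which contributes the factor `1`. -/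
theorem extInput_revPad {n k : ℕ} (hk : k ≤ n) (η : Fin (k + 1) → Fin (np + 1)) (t : ℤ)
    (a : Fin nu) (ω : Ω) :
    extInput n (sched p ω) (fun s => u s ω) (t - k) (revPad n η, a)
      = sprod p t η ω * u (t - k) ω a := by
  rw [extInput, sprod_eq_prod]
  congr 1
  set f : ℕ → ℝ := fun j => if h : j ≤ k then chr p (t - k + j) (η ⟨k - j, by omega⟩) ω else 1
    with hf
  have h1 : ∏ j : Fin (n + 1), extSched (sched p ω) (t - k + (j : ℤ)) (revPad n η j)
      = ∏ j : Fin (n + 1), f j := by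
    refine Finset.prod_congr rfl fun j _ => ?_
    simp only [hf, revPad]
    split_ifs
    · rfl
    · rfl
  have h2 : ∏ j : Fin (k + 1), chr p (t - (j : ℤ)) (η j) ω = ∏ j : Fin (k + 1), f (k - j) := by
    refine Finset.prod_congr rfl fun j _ => ?_
    simp only [hf, dif_pos (show k - (j : ℕ) ≤ k by omega)]
    congr 2
    · push_cast [show (j : ℕ) ≤ k by omega]
      ring
    · exact Fin.ext (by simp only; omega)
  rw [h1, h2, Fin.prod_univ_eq_prod_range f, Fin.prod_univ_eq_prod_range (fun j => f (k - j)),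
    show (∏ j ∈ Finset.range (k + 1), f (k - j)) = ∏ j ∈ Finset.range (k + 1), f j from
      Finset.prod_range_reflect f (k + 1)]
  refine (Finset.prod_subset (Finset.range_mono (by omega)) fun j _ hj => ?_).symm
  rw [Finset.mem_range] at hj
  simp only [hf, dif_neg (show ¬ j ≤ k by omega)]

theorem IsInput.ubdd_extInput (hu : IsInput μ u p) (hp : IsWhiteScheduling μ p 4) (n : ℕ)
    (x : (Fin (n + 1) → Fin (np + 1)) × Fin nu) :
    UBdd μ (fun t ω => extInput n (sched p ω) (fun s => u s ω) t x) := by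
  obtain ⟨ζ, a⟩ := x
  obtain ⟨cu, hcu⟩ := hu.exists_inputBound hp.schedSigma_le
  -- Every word of full length is the reversal of a string, so nothing is padded here.
  have e0 : revPad n (fun j : Fin (n + 1) => ζ j.rev) = ζ := by
    ext1 j
    have hj := j.2
    rw [revPad, if_pos (by omega)]
    congr 1
    exact Fin.ext (by simp only [Fin.val_rev]; omega)
  have e : ∀ t ω, extInput n (sched p ω) (fun s => u s ω) t (ζ, a)
      = sprod p (t + n) (fun j : Fin (n + 1) => ζ j.rev) ω * u (t - (0 : ℕ)) ω a := by
    intro t ω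
    have h := extInput_revPad (p := p) (u := u) le_rfl (fun j : Fin (n + 1) => ζ j.rev) (t + n)
      a ω
    rw [e0, add_sub_cancel_right] at h
    simpa using h
  simp only [e]
  exact hu.ubdd_mul hcu hp.schedSigma_le (hp.ubdd_sprod n _)
    (fun t => measurable_sprod_schedSigma _ _) 0 a

/-- A persistently exciting input identifies the process coefficients. -/
theorem IsInput.eq_zero_of_hasTimeAverage (hu : IsInput μ u p) (hp : IsWhiteScheduling μ p 4)
    {m : ℕ} (hpe : PersistentlyExciting μ
      (fun t ω => extInput nb (sched p ω) (fun s => u s ω) t) m) (hm : nb < m)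
    (g : ProcPar ny nu np nb) (i : Fin ny)
    (h : HasTimeAverage (fun t => ∫ ω, inOut p u g t ω i ^ 2 ∂μ) 0) (k : Fin (nb + 1))
    (η : Fin ((k : ℕ) + 1) → Fin (np + 1)) (a : Fin nu) : g k η i a = 0 := by
  classical
  have hk : ∀ k : Fin (nb + 1), (k : ℕ) ≤ nb := fun k => Nat.lt_succ_iff.1 k.2
  -- `c` places the parameter of lag `k` and string `η` at the lag `k` of the extended input, which
  -- exists since `nb < m`. As `revPad` is injective, no two parameters share a place and each can
  -- be read off from `c`.
  set c : Fin m × ((Fin (nb + 1) → Fin (np + 1)) × Fin nu) → ℝ := fun x =>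
    ∑ k : Fin (nb + 1), ∑ η : Fin ((k : ℕ) + 1) → Fin (np + 1), ∑ a,
      if x = (⟨k, (hk k).trans_lt hm⟩, (revPad nb η, a)) then g k η i a else 0 with hc
  have h1 : c = 0 := by
    have e : ∀ t ω, ∑ x, c x * extInput nb (sched p ω) (fun s => u s ω) (t - (x.1 : ℕ)) x.2
        = inOut p u g t ω i := ?_
    · refine hpe.eq_zero (fun x => hu.ubdd_extInput hp nb x) ?_
      simpa only [e] using h
    intro t ω
    simp only [hc, Finset.sum_mul, ite_mul, zero_mul, inOut]
    rw [Finset.sum_comm]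
    refine Finset.sum_congr rfl fun k _ => ?_
    rw [Finset.sum_comm]
    refine Finset.sum_congr rfl fun η _ => ?_
    rw [Finset.sum_comm]
    refine Finset.sum_congr rfl fun a _ => ?_
    rw [Finset.sum_ite_eq' Finset.univ, if_pos (Finset.mem_univ _)]
    exact congrArg _ (extInput_revPad (hk k) η t a ω)
  have h2 := congrFun h1 (⟨k, (hk k).trans_lt hm⟩, (revPad nb η, a))
  simp only [hc, Pi.zero_apply] at h2
  rw [← h2, Finset.sum_eq_single k, Finset.sum_eq_single η, Finset.sum_eq_single a]
  · simp
  · intro b _ hb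
    simp [Ne.symm hb]
  · simp
  · intro ζ _ hζ
    refine Finset.sum_eq_zero fun b _ => if_neg fun hh => hζ ?_
    simp only [Prod.mk.injEq] at hh
    exact (revPad_injective (hk k) hh.2.1).symm
  · simp
  · intro k' _ hk'
    refine Finset.sum_eq_zero fun ζ _ => Finset.sum_eq_zero fun b _ => if_neg fun hh => hk' ?_
    simp only [Prod.mk.injEq, Fin.mk.injEq] at hh
    exact (Fin.ext hh.1).symm
  · simp

end InputIdentifiability


/-! ### Stationarity of processes driven by scheduling and noise -/

section Stationarity

variable {Ω : Type*} {m0 : MeasurableSpace Ω} {μ : Measure Ω} {ny nu np nb nc : ℕ}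
  {p : ℤ → Ω → Fin np → ℝ} {e : ℤ → Ω → Fin ny → ℝ} {S : Matrix (Fin ny) (Fin ny) ℝ}
  {u : ℤ → Ω → Fin nu → ℝ}

/-- The joint trajectory of scheduling and noise, seen from time `t`. -/
def jointTraj (p : ℤ → Ω → Fin np → ℝ) (e : ℤ → Ω → Fin ny → ℝ) (t : ℤ) (ω : Ω) :
    (ℤ → Fin np → ℝ) × (ℤ → Fin ny → ℝ) :=
  (fun s => p (s + t) ω, fun s => e (s + t) ω)

/-- A process that is a fixed measurable function of the shifted joint trajectory. -/
def Stat {E : Type*} [MeasurableSpace E] (p : ℤ → Ω → Fin np → ℝ) (e : ℤ → Ω → Fin ny → ℝ)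
    (f : ℤ → Ω → E) : Prop :=
  ∃ Φ : (ℤ → Fin np → ℝ) × (ℤ → Fin ny → ℝ) → E, Measurable Φ ∧
    ∀ t ω, f t ω = Φ (jointTraj p e t ω)

section Closure

variable {E E' G : Type*} [MeasurableSpace E] [MeasurableSpace E'] [MeasurableSpace G]

theorem Stat.const (c : E) : Stat p e fun _ (_ : Ω) => c := ⟨fun _ => c, measurable_const, fun _ _ => rfl⟩

theorem Stat.comp {f : ℤ → Ω → E} (hf : Stat p e f) {h : E → G} (hh : Measurable h) :
    Stat p e fun t ω => h (f t ω) := by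
  obtain ⟨Φ, hΦ, e1⟩ := hf
  exact ⟨fun x => h (Φ x), hh.comp hΦ, fun t ω => congrArg h (e1 t ω)⟩

theorem Stat.comp₂ {f : ℤ → Ω → E} {g : ℤ → Ω → E'} (hf : Stat p e f) (hg : Stat p e g)
    {h : E → E' → G} (hh : Measurable (Function.uncurry h)) :
    Stat p e fun t ω => h (f t ω) (g t ω) := by
  obtain ⟨Φ, hΦ, e1⟩ := hf
  obtain ⟨Ψ, hΨ, e2⟩ := hg
  exact ⟨fun x => h (Φ x) (Ψ x), hh.comp (hΦ.prodMk hΨ), fun t ω => by beta_reduce; rw [e1, e2]⟩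

theorem Stat.mul {f g : ℤ → Ω → ℝ} (hf : Stat p e f) (hg : Stat p e g) :
    Stat p e fun t ω => f t ω * g t ω := hf.comp₂ hg measurable_mul

theorem Stat.pi {ι : Type*} {f : ι → ℤ → Ω → ℝ} (h : ∀ i, Stat p e (f i)) :
    Stat p e fun t ω i => f i t ω := by
  choose Φ hΦ e1 using h
  exact ⟨fun x i => Φ i x, measurable_pi_lambda _ hΦ, fun t ω => by simp only [e1]⟩

theorem Stat.sum {ι : Type*} (s : Finset ι) {f : ι → ℤ → Ω → ℝ} (h : ∀ i, Stat p e (f i)) :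
    Stat p e fun t ω => ∑ i ∈ s, f i t ω := by
  choose Φ hΦ e1 using h
  exact ⟨fun x => ∑ i ∈ s, Φ i x, Finset.measurable_fun_sum _ fun i _ => hΦ i,
    fun t ω => by simp only [e1]⟩

theorem Stat.prod {ι : Type*} (s : Finset ι) {f : ι → ℤ → Ω → ℝ} (h : ∀ i, Stat p e (f i)) :
    Stat p e fun t ω => ∏ i ∈ s, f i t ω := by
  choose Φ hΦ e1 using h
  exact ⟨fun x => ∏ i ∈ s, Φ i x, Finset.measurable_fun_prod _ fun i _ => hΦ i,
    fun t ω => by simp only [e1]⟩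

theorem Stat.lag {f : ℤ → Ω → E} (hf : Stat p e f) (r : ℤ) : Stat p e fun t ω => f (t - r) ω := by
  obtain ⟨Φ, hΦ, e1⟩ := hf
  refine ⟨fun x => Φ (fun s => x.1 (s - r), fun s => x.2 (s - r)), hΦ.comp ?_, fun t ω => ?_⟩
  · exact (measurable_pi_lambda _ fun s => (measurable_pi_apply _).comp measurable_fst).prodMk
      (measurable_pi_lambda _ fun s => (measurable_pi_apply _).comp measurable_snd)
  · beta_reduce
    rw [e1]
    congr 1
    simp only [jointTraj, sub_add_eq_add_sub, add_sub_assoc]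

end Closure

theorem stat_chr (a : Fin (np + 1)) : Stat p e fun t ω => chr p t a ω := by
  refine Fin.cases ?_ (fun i => ?_) a
  · exact Stat.const 1
  · refine ⟨fun x => x.1 0 i, ?_, fun t ω => ?_⟩
    · exact (measurable_pi_apply i).comp ((measurable_pi_apply 0).comp measurable_fst)
    · simp [jointTraj]

theorem stat_noise : Stat p e e :=
  ⟨fun x => x.2 0, (measurable_pi_apply 0).comp measurable_snd, fun t ω => by simp [jointTraj]⟩

theorem Stat.apply {z : ℤ → Ω → Fin ny → ℝ} (h : Stat p e z) (i : Fin ny) :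
    Stat p e fun t ω => z t ω i := h.comp (measurable_pi_apply i)

theorem stat_sprod {n : ℕ} (η : Fin n → Fin (np + 1)) : Stat p e fun t ω => sprod p t η ω := by
  simp only [sprod_eq_prod]
  exact Stat.prod _ fun j => (stat_chr (η j)).lag _

theorem stat_sker (h : NoisePar ny np nc) (k : ℕ) (i l : Fin ny) :
    Stat p e fun t ω => sker h (sched p ω) t k i l := by
  cases k with
  | zero => exact Stat.const 0
  | succ k =>
    simp only [sker_apply_succ]
    by_cases hk : k < nc
    · simp only [hk, dif_pos]
      exact Stat.sum _ fun η => (Stat.const _).mul (stat_sprod η)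
    · simp only [hk, dif_neg, not_false_eq_true]
      exact Stat.const 0

theorem stat_invNoiseCoeff (θ : Params ny nu np nb nc) (k : ℕ) (i l : Fin ny) :
    Stat p e fun t ω => invNoiseCoeff θ (sched p ω) t k i l := by
  induction k using Nat.strong_induction_on generalizing i l with
  | _ k ih =>
    cases k with
    | zero =>
      simp only [invNoiseCoeff_zero_lag]
      exact Stat.const _
    | succ k =>
      -- The sum runs over the attached antidiagonal so that each index carries the proof that its
      -- lag is smaller, as the induction hypothesis requires.
      have e1 : ∀ t ω, invNoiseCoeff θ (sched p ω) t (k + 1) i l =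
          ∑ x ∈ (Finset.HasAntidiagonal.antidiagonal k).attach, ∑ q, (-1) *
            (invNoiseCoeff θ (sched p ω) t x.1.1 i q *
              sker θ.2 (sched p ω) (t - x.1.1) (x.1.2 + 1) q l) := by
        intro t ω
        rw [invNoiseCoeff_succ_right, Matrix.neg_apply, Matrix.sum_apply, ← Finset.sum_neg_distrib,
          ← Finset.sum_attach]
        refine Finset.sum_congr rfl fun x _ => ?_
        rw [Matrix.mul_apply, ← Finset.sum_neg_distrib]
        exact Finset.sum_congr rfl fun q _ => (neg_one_mul _).symm
      simp only [e1]
      refine Stat.sum _ fun x => Stat.sum _ fun q => (Stat.const _).mul ((ih _ ?_ i q).mul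
        ((stat_sker θ.2 _ q l).lag _))
      have := x.2
      rw [Finset.HasAntidiagonal.mem_antidiagonal] at this
      omega

theorem Stat.gapp {F : Ω → Ker ny} (hF : ∀ k i l, Stat p e fun t ω => F ω t k i l)
    {z : ℤ → Ω → Fin ny → ℝ} (hz : Stat p e z) : Stat p e (LPVMAX.gapp F z) := by
  have h : ∀ r : ℕ, Stat p e fun t ω => (F ω t r).mulVec (z (t - r) ω) := fun r => by
    have : ∀ t ω, (F ω t r).mulVec (z (t - r) ω) = fun i => ∑ q, F ω t r i q * z (t - r) ω q :=
      fun t ω => rfl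
    simp only [this]
    exact Stat.pi fun i => Stat.sum _ fun q => (hF r i q).mul ((hz.lag r).apply q)
  choose Φ hΦ e1 using h
  exact ⟨fun x => ∑' r, Φ r x, Measurable.tsum hΦ, fun t ω => tsum_congr fun r => e1 r t ω⟩

theorem stat_noiseErr (θ₀ θ : Params ny nu np nb nc) : Stat p e (noiseErr p e θ₀ θ) :=
  (stat_noise.gapp (stat_sker _)).gapp (stat_invNoiseCoeff θ)

variable [IsProbabilityMeasure μ]

/-- Scheduling and noise are independent of each other, and each is a family of independent
variables whose law does not depend on time. A shift only renames the indices. -/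
theorem SignalAssumptions.identDistrib_jointTraj (H : SignalAssumptions μ p e S u) (t : ℤ) :
    IdentDistrib (jointTraj p e t) (jointTraj p e 0) μ μ := by
  have key : ∀ t : ℤ, IndepFun (fun ω s => p (s + t) ω) (fun ω s => e (s + t) ω) μ := by
    intro t
    have h : IndepFun (fun ω (s : ℤ) => p s ω) (fun ω (s : ℤ) => e s ω) μ := H.indep
    exact h.comp (φ := fun (x : ℤ → Fin np → ℝ) s => x (s + t))
      (ψ := fun (x : ℤ → Fin ny → ℝ) s => x (s + t))
      (measurable_pi_lambda _ fun s => measurable_pi_apply _)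
      (measurable_pi_lambda _ fun s => measurable_pi_apply _)
  refine IdentDistrib.prodMk ?_ ?_ (key t) (key 0)
  · have hinj : ∀ t : ℤ, Function.Injective fun x : ℤ × Fin np => (x.1 + t, x.2) := by
      rintro t ⟨a, b⟩ ⟨c, d⟩ h
      simpa using h
    have h : IdentDistrib (fun ω (x : ℤ × Fin np) => p (x.1 + t) ω x.2)
        (fun ω (x : ℤ × Fin np) => p (x.1 + 0) ω x.2) μ μ :=
      IdentDistrib.pi (X := fun (x : ℤ × Fin np) ω => p (x.1 + t) ω x.2)
        (Y := fun (x : ℤ × Fin np) ω => p (x.1 + 0) ω x.2)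
        (fun x => (H.white.identDistrib _ _).trans (H.white.identDistrib _ _).symm)
        (H.white.indep.precomp (hinj t)) (H.white.indep.precomp (hinj 0))
    exact h.comp (u := fun (v : ℤ × Fin np → ℝ) s i => v (s, i))
      (measurable_pi_lambda _ fun s => measurable_pi_lambda _ fun i => measurable_pi_apply _)
  · exact IdentDistrib.pi (X := fun (s : ℤ) ω => e (s + t) ω) (Y := fun (s : ℤ) ω => e (s + 0) ω)
      (fun s => (H.noise.identDistrib _).trans (H.noise.identDistrib _).symm)
      (H.noise.indep.precomp (add_left_injective t)) (H.noise.indep.precomp (add_left_injective 0))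

theorem SignalAssumptions.integral_stat (H : SignalAssumptions μ p e S u) {f : ℤ → Ω → ℝ}
    (hf : Stat p e f) (t : ℤ) : ∫ ω, f t ω ∂μ = ∫ ω, f 0 ω ∂μ := by
  obtain ⟨Φ, hΦ, e1⟩ := hf
  simp only [e1]
  exact ((H.identDistrib_jointTraj t).comp hΦ).integral_eq

end Stationarity

/-! ### Identifiability of the noise coefficients -/

section NoiseIdentifiability

variable {Ω : Type*} {m0 : MeasurableSpace Ω} {μ : Measure Ω} [IsProbabilityMeasure μ]
  {ny nu np nb nc : ℕ}
  {p : ℤ → Ω → Fin np → ℝ} {e : ℤ → Ω → Fin ny → ℝ} {S : Matrix (Fin ny) (Fin ny) ℝ}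
  {u : ℤ → Ω → Fin nu → ℝ}

/-- The expectation factors over the times of the string; at a time where the characters differ the
factor is zero. -/
theorem IsWhiteScheduling.integral_sprod_mul_of_ne (hp : IsWhiteScheduling μ p 4) (t : ℤ) {n : ℕ}
    {ζ η : Fin n → Fin (np + 1)} (h : ζ ≠ η) : ∫ ω, sprod p t ζ ω * sprod p t η ω ∂μ = 0 := by
  induction n generalizing t with
  | zero => exact absurd (Subsingleton.elim _ _) h
  | succ n ih =>
    have e1 : ∀ ω, sprod p t ζ ω * sprod p t η ω = (chr p t (ζ 0) ω * chr p t (η 0) ω) *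
        (sprod p (t - 1) (Fin.tail ζ) ω * sprod p (t - 1) (Fin.tail η) ω) := fun ω => by
      rw [sprod_succ, sprod_succ]
      ring
    have hs : ∀ ξ : Fin n → Fin (np + 1),
        Measurable[sig p (Set.Iio t)] (sprod p (t - 1) ξ) := fun ξ =>
      measurable_sprod_sig _ fun j _ => by simp only [Set.mem_Iio]; omega
    simp only [e1]
    refine (integral_mul_of_indep (X := fun ω => chr p t (ζ 0) ω * chr p t (η 0) ω)
      (Y := fun ω => sprod p (t - 1) (Fin.tail ζ) ω * sprod p (t - 1) (Fin.tail η) ω)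
      (hp.sig_le {t}) (hp.sig_le (Set.Iio t)) (hp.indep_Iio t).symm
        ((measurable_chr_sig (Set.mem_singleton t) _).mul
          (measurable_chr_sig (Set.mem_singleton t) _)) ((hs _).mul (hs _))).trans ?_
    by_cases h0 : ζ 0 = η 0
    · rw [ih (t - 1) fun h1 => h ?_, mul_zero]
      rw [← Fin.cons_self_tail ζ, ← Fin.cons_self_tail η, h0, h1]
    · rw [hp.integral_chr_mul, if_neg h0, zero_mul]

theorem IsWhiteScheduling.integral_sprod_sq_ne_zero (hp : IsWhiteScheduling μ p 4) (t : ℤ) {n : ℕ}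
    (η : Fin n → Fin (np + 1)) : ∫ ω, sprod p t η ω * sprod p t η ω ∂μ ≠ 0 := by
  have h := integral_sq_eq (hp.memLp_sprod t η)
  simp only [sq] at h
  rw [h]
  have h1 : eLpNorm (sprod p t η) 2 μ ≠ 0 := by
    rw [hp.eLpNorm_sprod]
    exact Finset.prod_ne_zero_iff.2 fun j _ => hp.eLpNorm_chr_ne_zero 0 (η j)
  have h2 := ENNReal.toReal_ne_zero.2 ⟨h1, (hp.memLp_sprod t η).2.ne⟩
  positivity

/-- A filter of white noise vanishes only if its coefficients vanish. -/
theorem SignalAssumptions.eq_zero_of_gapp_sker (H : SignalAssumptions μ p e S u)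
    (h : NoisePar ny np nc) (h0 : gapp (fun ω => sker h (sched p ω)) e 0 =ᵐ[μ] 0) : h = 0 := by
  have hps := H.white.schedSigma_le
  have key : ∀ (k : Fin nc) (ζ : Fin ((k : ℕ) + 2) → Fin (np + 1)) i b,
      ∑ l, h k ζ i l * S b l = 0 := by
    intro k ζ i b
    -- Test variable isolating one string: whiteness of `e` removes the other lags, orthogonality of
    -- strings of equal length removes the other strings. What remains is `E p_ζ²` times an entry of
    -- the product of `S` with a row of `h`.
    set g : Ω → ℝ := fun ω => sprod p 0 ζ ω * e (0 - ((k : ℕ) + 1 : ℕ)) ω b with hg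
    have hg2 : MemLp g 2 μ := H.noise.memLp_mul hps H.indep (measurable_sprod_schedSigma 0 ζ)
      (H.white.memLp_sprod 0 ζ) _ b
    have e1 : ∀ᵐ ω ∂μ, (0 : ℝ) = ∑ k' : Fin nc, ∑ l,
        ∑ η : Fin ((k' : ℕ) + 2) → Fin (np + 1), h k' η i l *
          (g ω * (sprod p 0 η ω * e (0 - ((k' : ℕ) + 1 : ℕ)) ω l)) := by
      filter_upwards [h0] with ω hω
      have h1 := congrFun hω i
      rw [gapp_sker, Finset.sum_range_succ', sker_zero_lag, Matrix.zero_mulVec, add_zero,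
        Finset.sum_apply, ← Fin.sum_univ_eq_sum_range (fun k => (sker h (sched p ω) 0
          (k + 1)).mulVec (e (0 - ((k + 1 : ℕ) : ℤ)) ω) i)] at h1
      have h2 := congrArg (fun x => g ω * x) h1
      simp only [Pi.zero_apply, mul_zero] at h2
      rw [← h2, Finset.mul_sum]
      refine Finset.sum_congr rfl fun k' _ => ?_
      simp only [Matrix.mulVec, dotProduct, sker_apply_succ, dif_pos k'.2, Finset.mul_sum,
        Finset.sum_mul]
      refine Finset.sum_congr rfl fun l _ => Finset.sum_congr rfl fun η _ => ?_
      ring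
    have hint : ∀ (k' : Fin nc) l (η : Fin ((k' : ℕ) + 2) → Fin (np + 1)), Integrable (fun ω =>
        h k' η i l * (g ω * (sprod p 0 η ω * e (0 - ((k' : ℕ) + 1 : ℕ)) ω l))) μ :=
      fun k' l η => (integrable_mul_of_memLp_two hg2 (H.noise.memLp_mul hps H.indep
        (measurable_sprod_schedSigma 0 η) (H.white.memLp_sprod 0 η) _ l)).const_mul _
    have e2 := integral_congr_ae e1
    rw [integral_zero, integral_finsetSum _ fun k' _ => integrable_finsetSum _ fun l _ =>
      integrable_finsetSum _ fun η _ => hint k' l η, Finset.sum_eq_single k] at e2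
    · rw [integral_finsetSum _ fun l _ => integrable_finsetSum _ fun η _ => hint k l η] at e2
      have e3 : ∀ l, ∫ ω, ∑ η : Fin ((k : ℕ) + 2) → Fin (np + 1), h k η i l *
          (g ω * (sprod p 0 η ω * e (0 - ((k : ℕ) + 1 : ℕ)) ω l)) ∂μ
          = (∫ ω, sprod p 0 ζ ω * sprod p 0 ζ ω ∂μ) * (h k ζ i l * S b l) := by
        intro l
        rw [integral_finsetSum _ fun η _ => hint k l η, Finset.sum_eq_single ζ]
        · rw [integral_const_mul, H.noise.integral_mul_mul hps H.indep
            (measurable_sprod_schedSigma 0 ζ) (measurable_sprod_schedSigma 0 ζ),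
            H.noise.covariance]
          ring
        · intro η _ hη
          rw [integral_const_mul, H.noise.integral_mul_mul hps H.indep
            (measurable_sprod_schedSigma 0 ζ) (measurable_sprod_schedSigma 0 η),
            H.white.integral_sprod_mul_of_ne 0 hη.symm, zero_mul, mul_zero]
        · simp
      simp only [e3, ← Finset.mul_sum] at e2
      exact (mul_eq_zero.1 e2.symm).resolve_left (H.white.integral_sprod_sq_ne_zero 0 ζ)
    · intro k' _ hk'
      rw [integral_finsetSum _ fun l _ => integrable_finsetSum _ fun η _ => hint k' l η]
      refine Finset.sum_eq_zero fun l _ => ?_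
      rw [integral_finsetSum _ fun η _ => hint k' l η]
      refine Finset.sum_eq_zero fun η _ => ?_
      have hne : (k : ℕ) ≠ k' := fun hh => hk' (Fin.ext hh.symm)
      rw [integral_const_mul, H.noise.integral_mul_mul hps H.indep
        (measurable_sprod_schedSigma 0 ζ) (measurable_sprod_schedSigma 0 η),
        H.noise.integral_mul_of_ne (by omega), mul_zero, mul_zero]
    · simp
  ext k ζ i l
  have h1 : S.mulVec (h k ζ i) = 0 := by
    ext b
    simp only [Matrix.mulVec, dotProduct, Pi.zero_apply]
    rw [← key k ζ i b]
    exact Finset.sum_congr rfl fun l _ => mul_comm _ _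
  by_contra hne
  have h2 := H.noise.posDef.dotProduct_mulVec_pos (x := h k ζ i) fun h0 => hne (by rw [h0]; rfl)
  rw [h1, dotProduct_zero] at h2
  exact h2.ne rfl

variable {θ₀ θ : Params ny nu np nb nc}

/-- Undoing `Γ` involves the noise part at past times as well; by stationarity, vanishing at time
`0` means vanishing at all times. Then `(C₀ - C)e = 0`. -/
theorem SignalAssumptions.eq_of_noiseErr (H : SignalAssumptions μ p e S u)
    (hθ : θ ∈ stableParams μ p) (h : ∀ i, ∫ ω, noiseErr p e θ₀ θ 0 ω i ^ 2 ∂μ = 0) :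
    θ₀.2 = θ.2 := by
  obtain ⟨M, hM⟩ := H.adm_noiseErr (θ₀ := θ₀) hθ
  obtain ⟨M', hM'⟩ := H.adm_gapp_sker (θ₀.2 - θ.2)
  obtain ⟨κ, hκ⟩ := H.white.exists_junction
  obtain ⟨K, ρ, hK⟩ := H.white.exists_goodKer_inv hθ
  have h1 : ∀ t, noiseErr p e θ₀ θ t =ᵐ[μ] 0 := by
    intro t
    have h2 : ∀ i, ∀ᵐ ω ∂μ, noiseErr p e θ₀ θ t ω i = 0 := by
      intro i
      have h3 : ∫ ω, noiseErr p e θ₀ θ t ω i ^ 2 ∂μ = 0 := by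
        rw [← h i]
        exact H.integral_stat (f := fun t ω => noiseErr p e θ₀ θ t ω i ^ 2)
          (((stat_noiseErr θ₀ θ).apply i).comp (measurable_id.pow_const 2)) t
      have h4 := (integral_eq_zero_iff_of_nonneg (fun ω => sq_nonneg _)
        (hM.memLp t i).integrable_sq).1 h3
      filter_upwards [h4] with ω hω
      simpa using hω
    filter_upwards [ae_all_iff.2 h2] with ω hω
    ext i
    exact hω i
  have h5 : gapp (fun ω => sker (θ₀.2 - θ.2) (sched p ω)) e 0 =ᵐ[μ] 0 := by
    refine (gapp_gapp_inv H.white hκ hM' hK 0).symm.trans ?_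
    refine (gapp_congr (z' := fun _ _ => 0) h1 0).trans (ae_of_all _ fun ω => ?_)
    simp [gapp]
  exact sub_eq_zero.1 (H.eq_zero_of_gapp_sker _ h5)

end NoiseIdentifiability


/-! ### The asymptotic loss and its minimum -/

section Loss

variable {Ω : Type*} {m0 : MeasurableSpace Ω} {μ : Measure Ω} [IsProbabilityMeasure μ]
  {ny nu np nb nc : ℕ}
  {p : ℤ → Ω → Fin np → ℝ} {e : ℤ → Ω → Fin ny → ℝ} {S : Matrix (Fin ny) (Fin ny) ℝ}
  {u : ℤ → Ω → Fin nu → ℝ} {θ₀ θ θ' : Params ny nu np nb nc}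
  {y : ℤ → Ω → Fin ny → ℝ} {V : Params ny nu np nb nc → ℝ} {m : ℕ}

/-- The mean square of the input part of the prediction error at time `t`. -/
noncomputable def inLoss (μ : Measure Ω) (p : ℤ → Ω → Fin np → ℝ) (u : ℤ → Ω → Fin nu → ℝ)
    (θ₀ θ : Params ny nu np nb nc) (t : ℤ) : ℝ :=
  ∑ i, ∫ ω, inErr p u θ₀ θ t ω i ^ 2 ∂μ

/-- The mean square of the past noise part of the prediction error at time `t`. -/
noncomputable def noiseLoss (μ : Measure Ω) (p : ℤ → Ω → Fin np → ℝ) (e : ℤ → Ω → Fin ny → ℝ)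
    (θ₀ θ : Params ny nu np nb nc) (t : ℤ) : ℝ :=
  ∑ i, ∫ ω, noiseErr p e θ₀ θ t ω i ^ 2 ∂μ

omit [IsProbabilityMeasure μ] in
theorem inLoss_nonneg (t : ℤ) : 0 ≤ inLoss μ p u θ₀ θ t :=
  Finset.sum_nonneg fun _ _ => integral_nonneg fun _ => sq_nonneg _

omit [IsProbabilityMeasure μ] in
theorem noiseLoss_nonneg (t : ℤ) : 0 ≤ noiseLoss μ p e θ₀ θ t :=
  Finset.sum_nonneg fun _ _ => integral_nonneg fun _ => sq_nonneg _

/-- With the noise coefficients fixed, `Γ` is fixed and the input part is linear in the deviation of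
the process coefficients. -/
theorem inErr_of_smul {c : ℝ} (h : θ.2 = θ'.2) (hc : θ₀.1 - θ'.1 = c • (θ₀.1 - θ.1)) (t : ℤ)
    (ω : Ω) : inErr p u θ₀ θ' t ω = c • inErr p u θ₀ θ t ω := by
  rw [inErr, inErr, ← gapp_smul, hc]
  simp only [← invNoiseCoeff_congr (noiseCoeff_congr h _)]
  congr 1
  ext1 s
  ext1 ω
  exact inOut_smul _ _ _ _

theorem noiseErr_congr (h : θ.2 = θ'.2) : noiseErr p e θ₀ θ = noiseErr p e θ₀ θ' := by
  simp only [noiseErr, ← invNoiseCoeff_congr (noiseCoeff_congr h _), h]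

omit [IsProbabilityMeasure μ] in
theorem inLoss_of_smul {c : ℝ} (h : θ.2 = θ'.2) (hc : θ₀.1 - θ'.1 = c • (θ₀.1 - θ.1)) (t : ℤ) :
    inLoss μ p u θ₀ θ' t = c ^ 2 * inLoss μ p u θ₀ θ t := by
  simp only [inLoss, inErr_of_smul h hc, Pi.smul_apply, smul_eq_mul, mul_pow, integral_const_mul,
    Finset.mul_sum]

theorem inErr_self (t : ℤ) (ω : Ω) : inErr p u θ₀ θ₀ t ω = 0 := by
  have := inErr_of_smul (p := p) (u := u) (θ₀ := θ₀) (θ := θ₀) (θ' := θ₀) (c := 0) rfl (by simp) t ω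
  simpa using this

theorem noiseErr_self (t : ℤ) (ω : Ω) : noiseErr p e θ₀ θ₀ t ω = 0 := by
  have h : ∀ s ω, gapp (fun ω => sker (θ₀.2 - θ₀.2) (sched p ω)) e s ω = 0 := fun s ω => by
    rw [gapp_sker_sub, sub_self]
  rw [noiseErr]
  generalize gapp (fun ω => sker (θ₀.2 - θ₀.2) (sched p ω)) e = z at h
  simp [gapp, h]

variable (H : SignalAssumptions μ p e S u)

include H

/-- Independence of `t` allows the noise part to be subtracted from the time average as a constant.
-/
theorem SignalAssumptions.noiseLoss_eq (t : ℤ) :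
    noiseLoss μ p e θ₀ θ t = noiseLoss μ p e θ₀ θ 0 :=
  Finset.sum_congr rfl fun i _ => H.integral_stat (f := fun t ω => noiseErr p e θ₀ θ t ω i ^ 2)
    (((stat_noiseErr θ₀ θ).apply i).comp (measurable_id.pow_const 2)) t

variable (hy : ∀ t ω, y t ω = output θ₀ (sched p ω) (fun s => u s ω) (fun s => e s ω) t)
  (hV : IsAsymptoticLoss μ p u y V)

include hy hV

theorem SignalAssumptions.hasTimeAverage_inLoss (hθ : θ ∈ stableParams μ p) :
    HasTimeAverage (inLoss μ p u θ₀ θ) (V θ - S.trace - noiseLoss μ p e θ₀ θ 0) := by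
  have h := ((hV θ hθ).sub (hasTimeAverage_const S.trace)).sub
    (hasTimeAverage_const (noiseLoss μ p e θ₀ θ 0))
  simp only [H.trace_predErrorProc hθ hy] at h
  convert h using 2 with t
  have := H.noiseLoss_eq (θ₀ := θ₀) (θ := θ) t
  rw [← this, inLoss, noiseLoss]
  ring

theorem SignalAssumptions.add_noiseLoss_le_loss (hθ : θ ∈ stableParams μ p) :
    S.trace + noiseLoss μ p e θ₀ θ 0 ≤ V θ := by
  have := (hasTimeAverage_const 0).mono (H.hasTimeAverage_inLoss hy hV hθ) fun t => inLoss_nonneg t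
  linarith

theorem SignalAssumptions.trace_le_loss (hθ : θ ∈ stableParams μ p) : S.trace ≤ V θ := by
  have := H.add_noiseLoss_le_loss hy hV hθ
  have h2 : 0 ≤ noiseLoss μ p e θ₀ θ 0 := noiseLoss_nonneg 0
  linarith

theorem SignalAssumptions.loss_true (hθ₀ : θ₀ ∈ stableParams μ p) : V θ₀ = S.trace := by
  have h := H.hasTimeAverage_inLoss hy hV hθ₀
  have h1 : noiseLoss μ p e θ₀ θ₀ 0 = 0 := by simp [noiseLoss, noiseErr_self]
  have h2 : inLoss μ p u θ₀ θ₀ = fun _ => 0 := by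
    ext t
    simp [inLoss, inErr_self]
  rw [h1, h2] at h
  have := (hasTimeAverage_const 0).unique h
  linarith

variable (hpers : PersistentlyExciting μ
  (fun t ω => extInput nb (sched p ω) (fun s => u s ω) t) m) (hm : Fin ny → Fin nu → nb < m)

include hpers hm

omit hy hV in
theorem SignalAssumptions.eq_fst_of_inLoss (hθ : θ ∈ stableParams μ p)
    (h : HasTimeAverage (inLoss μ p u θ₀ θ) 0) : θ = (θ₀.1, θ.2) := by
  refine Prod.ext ?_ rfl
  refine (sub_eq_zero.1 ?_).symm
  ext k η i a
  exact H.input.eq_zero_of_hasTimeAverage H.white hpers (hm i a) _ i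
    (H.input.hasTimeAverage_inOut H.white _ hθ h i) k η a

theorem SignalAssumptions.eq_of_loss_eq (hθ : θ ∈ stableParams μ p) (h : V θ = S.trace) :
    θ = θ₀ := by
  have h1 := H.add_noiseLoss_le_loss hy hV hθ
  have h2 : 0 ≤ noiseLoss μ p e θ₀ θ 0 := noiseLoss_nonneg 0
  have h3 : noiseLoss μ p e θ₀ θ 0 = 0 := by linarith
  have h4 := H.hasTimeAverage_inLoss hy hV hθ
  rw [h3, h, sub_self, sub_zero] at h4
  have h5 := H.eq_fst_of_inLoss hpers hm hθ h4
  have h6 := H.eq_of_noiseErr (θ₀ := θ₀) hθ fun i =>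
    (Finset.sum_eq_zero_iff_of_nonneg fun _ _ => integral_nonneg fun _ => sq_nonneg _).1 h3 i
      (Finset.mem_univ i)
  rw [h5, ← h6]

/-- At a stationary point the process coefficients are the true ones. -/
theorem SignalAssumptions.eq_fst_of_hasFDerivAt (hθ : θ ∈ stableParams μ p)
    (h : HasFDerivAt V (0 : Params ny nu np nb nc →L[ℝ] ℝ) θ) : θ = (θ₀.1, θ.2) := by
  have havg := H.hasTimeAverage_inLoss hy hV hθ
  set A := V θ - S.trace - noiseLoss μ p e θ₀ θ 0 with hA
  -- Along the direction towards the true process coefficients the input part is scaled by `1 - r`,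
  -- so the loss is an explicit quadratic in `r` with derivative `-2A` at zero.
  set d : Params ny nu np nb nc := (θ₀.1 - θ.1, 0) with hd
  have h1 : ∀ r : ℝ, V (θ + r • d) = S.trace + noiseLoss μ p e θ₀ θ 0 + (1 - r) ^ 2 * A := by
    intro r
    have e1 : θ.2 = (θ + r • d).2 := by simp [hd]
    have e2 : θ₀.1 - (θ + r • d).1 = (1 - r) • (θ₀.1 - θ.1) := by
      simp only [hd, Prod.fst_add, Prod.smul_fst, sub_smul, one_smul]
      abel
    have h2 := H.hasTimeAverage_inLoss hy hV (stableParams_congr e1 hθ)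
    have h3 := havg.const_mul ((1 - r) ^ 2)
    simp only [← inLoss_of_smul e1 e2] at h3
    have h4 := h2.unique h3
    rw [noiseLoss, ← noiseErr_congr e1] at h4
    rw [noiseLoss]
    linarith
  have h2 : HasDerivAt (fun r : ℝ => V (θ + r • d)) 0 0 := by
    have h3 : HasDerivAt (fun r : ℝ => θ + r • d) d 0 := by
      simpa using ((hasDerivAt_id (0 : ℝ)).smul_const d).const_add θ
    have h4 : HasFDerivAt V (0 : Params ny nu np nb nc →L[ℝ] ℝ) (θ + (0 : ℝ) • d) := by
      simpa using h
    have h5 := h4.comp_hasDerivAt (0 : ℝ) h3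
    rwa [zero_apply] at h5
  have h3 : HasDerivAt (fun r : ℝ => V (θ + r • d)) (-2 * A) 0 := by
    simp only [h1]
    have h4 : HasDerivAt (fun r : ℝ => 1 - r) (-1) 0 := by
      simpa using (hasDerivAt_id (0 : ℝ)).const_sub 1
    have h5 := ((h4.pow 2).mul_const A).const_add (S.trace + noiseLoss μ p e θ₀ θ 0)
    refine h5.congr_deriv ?_
    norm_num
  have h4 : A = 0 := by
    have := h2.unique h3
    linarith
  rw [h4] at havg
  exact H.eq_fst_of_inLoss hpers hm hθ havg

end Loss

/-! ### Continuity of the loss, and its derivative at the true parameter -/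

section Perturbation

variable {Ω : Type*} {m0 : MeasurableSpace Ω} {μ : Measure Ω} [IsProbabilityMeasure μ]
  {ny nu np nb nc : ℕ}
  {p : ℤ → Ω → Fin np → ℝ} {e : ℤ → Ω → Fin ny → ℝ} {S : Matrix (Fin ny) (Fin ny) ℝ}
  {u : ℤ → Ω → Fin nu → ℝ} {θ₀ θ : Params ny nu np nb nc}
  {y : ℤ → Ω → Fin ny → ℝ} {V : Params ny nu np nb nc → ℝ}

theorem IsWhiteScheduling.exists_uniform_goodKer (hp : IsWhiteScheduling μ p 4)
    (hθ : θ ∈ stableParams μ p) : ∃ δ > (0 : ℝ), ∃ K ρ : ℝ≥0, ∀ θ', ‖θ' - θ‖ < δ →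
      θ' ∈ stableParams μ p ∧ GoodKer μ p (fun ω => invNoiseCoeff θ' (sched p ω)) K ρ := by
  obtain ⟨δ, hδ, K, ρ, hρ, h⟩ := hp.exists_uniform_kBd hθ
  have hm : max ρ (1 / 2) < 1 := max_lt hρ (by rw [div_lt_one (by norm_num)]; norm_num)
  refine ⟨δ, hδ, K, max ρ (1 / 2), fun θ' hθ' => ?_⟩
  have h1 : KBd μ (fun ω => invNoiseCoeff θ' (sched p ω)) K (max ρ (1 / 2)) := fun t k i l =>
    (h θ' hθ' t k i l).trans (ENNReal.coe_le_coe.2 (by gcongr; exact le_max_left _ _))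
  exact ⟨(hp.mem_stableParams_iff θ').2 ⟨K, _, lt_max_of_lt_right (by norm_num), hm, h1⟩,
    hp.goodKer_inv h1 hm⟩

/-- Lipschitz dependence of inverse filtering on the parameters. -/
theorem IsWhiteScheduling.exists_lipschitz (hp : IsWhiteScheduling μ p 4)
    (hθ : θ ∈ stableParams μ p) (M c : ℝ≥0) : ∃ δ > (0 : ℝ), ∃ C : ℝ≥0, ∀ θ', ‖θ' - θ‖ < δ →
      θ' ∈ stableParams μ p ∧ ∀ z z' d : ℤ → Ω → Fin ny → ℝ, Adm μ p z M →
        Adm μ p d (c * ‖θ' - θ‖₊) → (∀ t ω, z' t ω = z t ω + d t ω) → ∀ t i,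
          eLpNorm (fun ω => gapp (fun ω => invNoiseCoeff θ' (sched p ω)) z' t ω i
            - gapp (fun ω => invNoiseCoeff θ (sched p ω)) z t ω i) 2 μ
              ≤ (C * ‖θ' - θ‖₊ : ℝ≥0) := by
  obtain ⟨δ, hδ, K, ρ, h⟩ := hp.exists_uniform_goodKer hθ
  obtain ⟨κ, hκ⟩ := hp.exists_junction
  obtain ⟨cs, hcs⟩ := hp.exists_goodKer_sker ny nc
  have hθg := (h θ (by simpa using hδ)).2
  refine ⟨δ, hδ, ny * κ * c * K * ∑' r : ℕ, ρ ^ r + ny * κ * (ny * κ *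
    (ny * κ * M * K * ∑' r : ℕ, ρ ^ r) * cs * ∑' r : ℕ, (1 / 2) ^ r) * K * ∑' r : ℕ, ρ ^ r,
    fun θ' hθ' => ⟨(h θ' hθ').1, fun z z' d hz hd hzd t i => ?_⟩⟩
  have hg := (h θ' hθ').2
  have hz' : z' = fun t ω => z t ω + d t ω := by
    ext t ω : 2
    exact hzd t ω
  have h1 := hd.gapp hp hκ hg
  have h2 := ((hz.gapp hp hκ hg).gapp hp hκ (hcs (θ.2 - θ'.2))).gapp hp hκ hθg
  have e1 : (fun ω => gapp (fun ω => invNoiseCoeff θ' (sched p ω)) z' t ω i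
      - gapp (fun ω => invNoiseCoeff θ (sched p ω)) z t ω i) =ᵐ[μ]
      fun ω => gapp (fun ω => invNoiseCoeff θ' (sched p ω)) d t ω i +
        gapp (fun ω => invNoiseCoeff θ (sched p ω)) (gapp (fun ω => sker (θ.2 - θ'.2) (sched p ω))
          (gapp (fun ω => invNoiseCoeff θ' (sched p ω)) z)) t ω i := by
    filter_upwards [gapp_add hp hκ hz hd hg t, gapp_inv_eq hp hκ hz hg hθg t] with ω h3 h4
    rw [hz', h3, h4]
    simp only [Pi.add_apply]
    ring
  rw [eLpNorm_congr_ae e1]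
  refine (eLpNorm_add_le (h1.memLp t i).1 (h2.memLp t i).1 (by norm_num)).trans
    ((add_le_add (h1.eLpNorm_le t i) (h2.eLpNorm_le t i)).trans ?_)
  rw [← ENNReal.coe_add]
  refine ENNReal.coe_le_coe.2 ?_
  have h5 : ‖θ.2 - θ'.2‖₊ ≤ ‖θ' - θ‖₊ := by
    rw [← nnnorm_neg, neg_sub]
    exact norm_snd_le (θ' - θ)
  calc _ ≤ ny * κ * (c * ‖θ' - θ‖₊) * K * ∑' r : ℕ, ρ ^ r + ny * κ * (ny * κ *
    (ny * κ * M * K * ∑' r : ℕ, ρ ^ r) * (cs * ‖θ' - θ‖₊) * ∑' r : ℕ, (1 / 2) ^ r) * K *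
      ∑' r : ℕ, ρ ^ r := by gcongr
    _ = _ := by ring

omit [IsProbabilityMeasure μ] in
-- Factorization of a difference of squares. For `M = 0` the bound is `d ^ 2`, which is what makes
-- the loss of second order at the true parameter.
theorem abs_integral_sq_sub_le {a a' : Ω → ℝ} (ha : MemLp a 2 μ) (ha' : MemLp a' 2 μ) {M d : ℝ≥0}
    (hM : eLpNorm a 2 μ ≤ M) (hd : eLpNorm (fun ω => a' ω - a ω) 2 μ ≤ d) :
    |∫ ω, a' ω ^ 2 ∂μ - ∫ ω, a ω ^ 2 ∂μ| ≤ d * (2 * M + d) := by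
  rw [integral_sq_eq ha, integral_sq_eq ha']
  have hd' : eLpNorm (a' - a) 2 μ ≤ d := hd
  have h1 : (eLpNorm a' 2 μ).toReal ≤ (eLpNorm a 2 μ).toReal + d := by
    have : eLpNorm a' 2 μ ≤ eLpNorm a 2 μ + d := by
      calc eLpNorm a' 2 μ = eLpNorm (a + (a' - a)) 2 μ := by rw [add_sub_cancel]
        _ ≤ _ := (eLpNorm_add_le ha.1 (ha'.1.sub ha.1) (by norm_num)).trans (by gcongr)
    have h2 := ENNReal.toReal_mono (ENNReal.add_ne_top.2 ⟨ha.2.ne, ENNReal.coe_ne_top⟩) this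
    rwa [ENNReal.toReal_add ha.2.ne ENNReal.coe_ne_top] at h2
  have h2 : (eLpNorm a 2 μ).toReal ≤ (eLpNorm a' 2 μ).toReal + d := by
    have : eLpNorm a 2 μ ≤ eLpNorm a' 2 μ + d := by
      calc eLpNorm a 2 μ = eLpNorm (a' - (a' - a)) 2 μ := by rw [sub_sub_cancel]
        _ ≤ _ := (eLpNorm_sub_le ha'.1 (ha'.1.sub ha.1) (by norm_num)).trans (by gcongr)
    have h2 := ENNReal.toReal_mono (ENNReal.add_ne_top.2 ⟨ha'.2.ne, ENNReal.coe_ne_top⟩) this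
    rwa [ENNReal.toReal_add ha'.2.ne ENNReal.coe_ne_top] at h2
  have h3 : (eLpNorm a 2 μ).toReal ≤ M := ENNReal.toReal_mono ENNReal.coe_ne_top hM
  have h4 : 0 ≤ (eLpNorm a 2 μ).toReal := ENNReal.toReal_nonneg
  have h5 : 0 ≤ (eLpNorm a' 2 μ).toReal := ENNReal.toReal_nonneg
  rw [sq_sub_sq, abs_mul, mul_comm]
  refine mul_le_mul ?_ ?_ (abs_nonneg _) (by positivity)
  · rw [abs_le]
    constructor <;> linarith
  · rw [abs_of_nonneg (by positivity)]
    linarith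

variable (H : SignalAssumptions μ p e S u)
  (hy : ∀ t ω, y t ω = output θ₀ (sched p ω) (fun s => u s ω) (fun s => e s ω) t)
  (hV : IsAsymptoticLoss μ p u y V)

include H hy hV

/-- Local modulus of continuity of the asymptotic loss. -/
theorem SignalAssumptions.exists_abs_loss_sub_le (hθ : θ ∈ stableParams μ p) {M : ℝ≥0}
    (h1 : ∀ t i, eLpNorm (fun ω => inErr p u θ₀ θ t ω i) 2 μ ≤ M)
    (h2 : ∀ t i, eLpNorm (fun ω => noiseErr p e θ₀ θ t ω i) 2 μ ≤ M) :
    ∃ δ > (0 : ℝ), ∃ C : ℝ≥0, ∀ θ', ‖θ' - θ‖ < δ → θ' ∈ stableParams μ p ∧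
      |V θ' - V θ| ≤ 2 * (ny * (C * ‖θ' - θ‖ * (2 * M + C * ‖θ' - θ‖))) := by
  obtain ⟨cu, hcu⟩ := H.input.exists_adm_inOut H.white ny nb
  obtain ⟨κ, hκ⟩ := H.white.exists_junction
  obtain ⟨Me, hMe⟩ := H.adm_noise
  obtain ⟨cs, hcs⟩ := H.white.exists_goodKer_sker ny nc
  obtain ⟨δ₁, hδ₁, C₁, hC₁⟩ := H.white.exists_lipschitz hθ (cu * ‖θ₀.1 - θ.1‖₊) cu
  obtain ⟨δ₂, hδ₂, C₂, hC₂⟩ := H.white.exists_lipschitz hθ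
    (ny * κ * Me * (cs * ‖θ₀.2 - θ.2‖₊) * ∑' r : ℕ, (1 / 2) ^ r)
    (ny * κ * Me * cs * ∑' r : ℕ, (1 / 2) ^ r)
  refine ⟨min δ₁ δ₂, lt_min hδ₁ hδ₂, max C₁ C₂, fun θ' hθ' => ?_⟩
  obtain ⟨hs, h3⟩ := hC₁ θ' (hθ'.trans_le (min_le_left _ _))
  obtain ⟨-, h4⟩ := hC₂ θ' (hθ'.trans_le (min_le_right _ _))
  refine ⟨hs, ?_⟩
  obtain ⟨M₁, hM₁⟩ := H.adm_inErr (θ₀ := θ₀) hθ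
  obtain ⟨M₂, hM₂⟩ := H.adm_inErr (θ₀ := θ₀) hs
  obtain ⟨M₃, hM₃⟩ := H.adm_noiseErr (θ₀ := θ₀) hθ
  obtain ⟨M₄, hM₄⟩ := H.adm_noiseErr (θ₀ := θ₀) hs
  have hmono : ∀ {z : ℤ → Ω → Fin ny → ℝ} {A B : ℝ≥0}, Adm μ p z A → A ≤ B → Adm μ p z B :=
    fun hz hAB => ⟨hz.measurable, fun t i X hX => (hz.bound t i X hX).trans (by gcongr)⟩
  have e1 : ∀ t i, eLpNorm (fun ω => inErr p u θ₀ θ' t ω i - inErr p u θ₀ θ t ω i) 2 μ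
      ≤ (max C₁ C₂ * ‖θ' - θ‖₊ : ℝ≥0) := by
    intro t i
    refine (h3 _ (inOut p u (θ₀.1 - θ'.1)) (inOut p u (θ.1 - θ'.1)) (hcu (θ₀.1 - θ.1))
      (hmono (hcu _) ?_) (fun t ω => ?_) t i).trans (ENNReal.coe_le_coe.2 ?_)
    · gcongr
      rw [← nnnorm_neg, neg_sub]
      exact norm_fst_le (θ' - θ)
    · rw [inOut_sub, inOut_sub, inOut_sub]
      abel
    · gcongr
      exact le_max_left _ _
  have e2 : ∀ t i, eLpNorm (fun ω => noiseErr p e θ₀ θ' t ω i - noiseErr p e θ₀ θ t ω i) 2 μ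
      ≤ (max C₁ C₂ * ‖θ' - θ‖₊ : ℝ≥0) := by
    intro t i
    refine (h4 _ (gapp (fun ω => sker (θ₀.2 - θ'.2) (sched p ω)) e)
      (gapp (fun ω => sker (θ.2 - θ'.2) (sched p ω)) e)
      (hMe.gapp H.white hκ (hcs (θ₀.2 - θ.2)))
      (hmono (hMe.gapp H.white hκ (hcs _)) ?_) (fun t ω => ?_) t i).trans
        (ENNReal.coe_le_coe.2 ?_)
    · have h5 : ‖θ.2 - θ'.2‖₊ ≤ ‖θ' - θ‖₊ := by
        rw [← nnnorm_neg, neg_sub]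
        exact norm_snd_le (θ' - θ)
      calc _ ≤ ny * κ * Me * (cs * ‖θ' - θ‖₊) * ∑' r : ℕ, (1 / 2) ^ r := by gcongr
        _ = _ := by ring
    · rw [gapp_sker_sub, gapp_sker_sub, gapp_sker_sub]
      abel
    · gcongr
      exact le_max_right _ _
  set d : ℝ≥0 := max C₁ C₂ * ‖θ' - θ‖₊ with hd
  have hd' : (d : ℝ) = (max C₁ C₂ : ℝ≥0) * ‖θ' - θ‖ := by rw [hd, NNReal.coe_mul, coe_nnnorm]
  rw [← hd']
  have b1 : ∀ t, |inLoss μ p u θ₀ θ' t - inLoss μ p u θ₀ θ t| ≤ ny * (d * (2 * M + d)) := by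
    intro t
    rw [inLoss, inLoss, ← Finset.sum_sub_distrib]
    refine (Finset.abs_sum_le_sum_abs _ _).trans ((Finset.sum_le_sum fun i _ =>
      abs_integral_sq_sub_le (hM₁.memLp t i) (hM₂.memLp t i) (h1 t i) (e1 t i)).trans ?_)
    simp
  have b2 : |noiseLoss μ p e θ₀ θ' 0 - noiseLoss μ p e θ₀ θ 0| ≤ ny * (d * (2 * M + d)) := by
    rw [noiseLoss, noiseLoss, ← Finset.sum_sub_distrib]
    refine (Finset.abs_sum_le_sum_abs _ _).trans ((Finset.sum_le_sum fun i _ =>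
      abs_integral_sq_sub_le (hM₃.memLp 0 i) (hM₄.memLp 0 i) (h2 0 i) (e2 0 i)).trans ?_)
    simp
  -- The estimate of the input part is uniform in `t`, so it survives the time average.
  have b3 := (H.hasTimeAverage_inLoss hy hV hs).sub (H.hasTimeAverage_inLoss hy hV hθ)
  have b4 := b3.mono (hasTimeAverage_const _) fun t => (abs_le.1 (b1 t)).2
  have b5 := (hasTimeAverage_const _).mono b3 fun t => (abs_le.1 (b1 t)).1
  rw [abs_le] at b2 ⊢
  constructor <;> linarith [b2.1, b2.2]

theorem SignalAssumptions.continuousAt_loss (hθ : θ ∈ stableParams μ p) : ContinuousAt V θ := by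
  obtain ⟨M₁, hM₁⟩ := H.adm_inErr (θ₀ := θ₀) hθ
  obtain ⟨M₃, hM₃⟩ := H.adm_noiseErr (θ₀ := θ₀) hθ
  obtain ⟨δ, hδ, C, hC⟩ := H.exists_abs_loss_sub_le hy hV hθ (M := max M₁ M₃)
    (fun t i => (hM₁.eLpNorm_le t i).trans (ENNReal.coe_le_coe.2 (le_max_left _ _)))
    (fun t i => (hM₃.eLpNorm_le t i).trans (ENNReal.coe_le_coe.2 (le_max_right _ _)))
  rw [ContinuousAt, tendsto_iff_norm_sub_tendsto_zero]
  have h1 : Tendsto (fun θ' => ‖θ' - θ‖) (𝓝 θ) (𝓝 0) :=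
    tendsto_iff_norm_sub_tendsto_zero.1 tendsto_id
  have h2 : Tendsto (fun θ' => 2 * ((ny : ℝ) * (C * ‖θ' - θ‖ *
      (2 * (max M₁ M₃ : ℝ≥0) + C * ‖θ' - θ‖)))) (𝓝 θ) (𝓝 0) := by
    have h3 := (((h1.const_mul (C : ℝ)).mul ((h1.const_mul (C : ℝ)).const_add
      (2 * ((max M₁ M₃ : ℝ≥0) : ℝ)))).const_mul (ny : ℝ)).const_mul 2
    simpa using h3
  refine squeeze_zero' (Eventually.of_forall fun _ => norm_nonneg _) ?_ h2
  filter_upwards [h1.eventually (gt_mem_nhds hδ)] with θ' hθ'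
  exact (hC θ' hθ').2

/-- Both error parts vanish at the true parameter, so the local modulus of continuity applies with
`M = 0` and is quadratic. -/
theorem SignalAssumptions.hasFDerivAt_loss (hθ₀ : θ₀ ∈ stableParams μ p) :
    HasFDerivAt V (0 : Params ny nu np nb nc →L[ℝ] ℝ) θ₀ := by
  obtain ⟨δ, hδ, C, hC⟩ := H.exists_abs_loss_sub_le hy hV hθ₀ (M := 0)
    (fun t i => by simp [inErr_self]) (fun t i => by simp [noiseErr_self])
  have h1 : Tendsto (fun θ' => ‖θ' - θ₀‖) (𝓝 θ₀) (𝓝 0) :=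
    tendsto_iff_norm_sub_tendsto_zero.1 tendsto_id
  have h2 : (fun θ' => V θ' - V θ₀) =O[𝓝 θ₀] fun θ' => ‖θ' - θ₀‖ ^ 2 := by
    refine Asymptotics.IsBigO.of_bound (2 * (ny * C ^ 2)) ?_
    filter_upwards [h1.eventually (gt_mem_nhds hδ)] with θ' hθ'
    rw [Real.norm_eq_abs, Real.norm_of_nonneg (by positivity)]
    refine (hC θ' hθ').2.trans (le_of_eq ?_)
    simp only [NNReal.coe_zero]
    ring
  refine HasFDerivAt.of_isLittleO ?_
  simp only [zero_apply, sub_zero]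
  refine h2.trans_isLittleO ?_
  refine Asymptotics.isLittleO_iff.2 fun c hc => ?_
  filter_upwards [h1.eventually (gt_mem_nhds hc)] with θ' hθ'
  rw [Real.norm_of_nonneg (by positivity), sq]
  gcongr

end Perturbation

/-! ### Convergence of minimizers -/

section Consistency

/-- Minimizers over a compact set of functions that converge uniformly to a continuous function
with a unique minimizer converge to that minimizer. -/
theorem tendsto_of_isMinOn_of_tendstoUniformlyOn {E : Type*} [TopologicalSpace E] {D : Set E}
    (hD : IsCompact D) {V : E → ℝ} (hV : ContinuousOn V D) {x₀ : E} (hx₀ : x₀ ∈ D)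
    (hmin : ∀ x ∈ D, x ≠ x₀ → V x₀ < V x) {f : ℕ → E → ℝ}
    (hf : TendstoUniformlyOn f V atTop D) {x : ℕ → E} (hx : ∀ N, x N ∈ D)
    (hxmin : ∀ N, IsMinOn (f N) D (x N)) : Tendsto x atTop (𝓝 x₀) := by
  refine tendsto_nhds.2 fun U hU hxU => ?_
  rcases (D \ U).eq_empty_or_nonempty with h0 | h0
  · exact Eventually.of_forall fun N => by
      by_contra h
      exact (h0 ▸ (⟨hx N, h⟩ : x N ∈ D \ U) : x N ∈ (∅ : Set E))
  obtain ⟨b, hb, hbmin⟩ := (hD.diff hU).exists_isMinOn h0 (hV.mono Set.sdiff_subset)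
  -- Half the gap between `V x₀` and the least value of `V` on `D` outside the neighbourhood. If `f
  -- N` is closer than this to `V` on `D`, a minimizer outside would have a larger value than `x₀`.
  have hgap : 0 < (V b - V x₀) / 2 :=
    half_pos (sub_pos.2 (hmin b hb.1 fun h => hb.2 (h ▸ hxU)))
  filter_upwards [Metric.tendstoUniformlyOn_iff.1 hf _ hgap] with N hN
  by_contra h
  have h1 := hbmin (⟨hx N, h⟩ : x N ∈ D \ U)
  have h2 := hN x₀ hx₀
  have h3 := hN (x N) (hx N)
  have h4 := hxmin N hx₀
  rw [Real.dist_eq, abs_lt] at h2 h3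
  simp only [Set.mem_ofPred_eq] at h1 h4
  linarith [h2.1, h3.2]

end Consistency


theorem measurable_tsum_mulVec {Ω : Type*} [MeasurableSpace Ω] {ny : ℕ}
    {A : ℕ → Ω → Matrix (Fin ny) (Fin ny) ℝ} {v : ℕ → Ω → Fin ny → ℝ}
    (hA : ∀ r i q, Measurable fun ω => A r ω i q) (hv : ∀ r, Measurable (v r)) :
    Measurable fun ω => ∑' r, (A r ω).mulVec (v r ω) := by
  refine Measurable.tsum fun r => measurable_pi_lambda _ fun i => ?_
  simp only [Matrix.mulVec, dotProduct]
  exact Finset.measurable_fun_sum _ fun q _ =>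
    (hA r i q).mul ((measurable_pi_apply q).comp (hv r))

/-! ### Processes adapted to past scheduling -/

section Adapted

variable {Ω : Type*} {m0 : MeasurableSpace Ω} {μ : Measure Ω} {ny nu np nb nc : ℕ}
  {p : ℤ → Ω → Fin np → ℝ} {e : ℤ → Ω → Fin ny → ℝ} {S : Matrix (Fin ny) (Fin ny) ℝ}
  {u : ℤ → Ω → Fin nu → ℝ} {z : ℤ → Ω → Fin ny → ℝ} {F : Ω → Ker ny}

/-- The information in the scheduling up to time `t` and the whole noise. -/
@[reducible] def pastSigma (p : ℤ → Ω → Fin np → ℝ) (e : ℤ → Ω → Fin ny → ℝ) (t : ℤ) :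
    MeasurableSpace Ω := sig p (Set.Iic t) ⊔ noiseSigma e

theorem pastSigma_mono {s t : ℤ} (h : s ≤ t) : pastSigma p e s ≤ pastSigma p e t :=
  sup_le_sup_right (sig_mono (Set.Iic_subset_Iic.2 h)) _

/-- A process that depends on the scheduling only through its values up to the current time. -/
def AdaptedTo (p : ℤ → Ω → Fin np → ℝ) (e : ℤ → Ω → Fin ny → ℝ) (z : ℤ → Ω → Fin ny → ℝ) : Prop :=
  ∀ t, Measurable[pastSigma p e t] (z t)

theorem adaptedTo_noise : AdaptedTo p e e := fun t =>
  Measurable.mono ((measurable_pi_apply t).comp (comap_measurable fun ω (t : ℤ) => e t ω))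
    (le_sup_right : noiseSigma e ≤ pastSigma p e t) le_rfl

theorem AdaptedTo.gapp [IsProbabilityMeasure μ] (hz : AdaptedTo p e z) (hF : LKer μ p F) :
    AdaptedTo p e (gapp F z) := by
  exact fun t => @measurable_tsum_mulVec Ω (pastSigma p e t) ny _ _
    (fun r i q => ((hF.ll t r i q).measurable_sig le_rfl).mono le_sup_left le_rfl)
    fun r => (hz (t - r)).mono (pastSigma_mono (by omega)) le_rfl

/-- Future and past of the scheduling are independent, and both together are independent of the
noise. The whole noise may therefore be included in the past. -/
theorem SignalAssumptions.indep_pastSigma [IsProbabilityMeasure μ]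
    (H : SignalAssumptions μ p e S u) (t : ℤ) :
    Indep (sig p (Set.Ioi t)) (pastSigma p e t) μ :=
  indep_sup_right_of_indep (H.white.sig_le _) (H.white.sig_le _) H.noise.noiseSigma_le
    (H.white.indep_Ioi_Iic t)
    (indep_of_indep_of_le_left H.indep (sup_le (sig_le_schedSigma _) (sig_le_schedSigma _)))

theorem SignalAssumptions.pastSigma_le (H : SignalAssumptions μ p e S u) (t : ℤ) :
    pastSigma p e t ≤ m0 := sup_le (H.white.sig_le _) H.noise.noiseSigma_le

end Adapted

/-! ### Splitting strings -/

section Split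

variable {Ω : Type*} {np : ℕ} {p : ℤ → Ω → Fin np → ℝ}

theorem sprod_split {n a b : ℕ} (h : n = a + b) (t : ℤ) (η : Fin n → Fin (np + 1)) (ω : Ω) :
    sprod p t η ω = sprod p t (fun i : Fin a => η ⟨i, by omega⟩) ω
      * sprod p (t - a) (fun i : Fin b => η ⟨a + i, by omega⟩) ω := by
  subst h
  simp only [sprod_eq_prod, Fin.prod_univ_add]
  congr 1
  refine Finset.prod_congr rfl fun j _ => ?_
  simp only [Fin.natAdd, Fin.val_mk]
  push_cast
  rw [sub_sub]

theorem sum_init_last {k : ℕ} (f : (Fin (k + 1) → Fin (np + 1)) → Fin (np + 1) → ℝ) :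
    ∑ ζ : Fin (k + 2) → Fin (np + 1), f (Fin.init ζ) (ζ (Fin.last (k + 1)))
      = ∑ ξ, ∑ b, f ξ b := by
  rw [Finset.sum_comm, ← Finset.sum_product', Finset.univ_product_univ]
  refine (Fintype.sum_equiv (Fin.snocEquiv fun _ : Fin (k + 2) => Fin (np + 1)) _ _ ?_).symm
  rintro ⟨b, ξ⟩
  simp [Fin.snocEquiv]

end Split

/-! ### Correlations determined by finitely many numbers -/

section TailRepresentation

variable {Ω : Type*} {m0 : MeasurableSpace Ω} {μ : Measure Ω} [IsProbabilityMeasure μ]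
  {ny nu np nb nc : ℕ}
  {p : ℤ → Ω → Fin np → ℝ} {e : ℤ → Ω → Fin ny → ℝ} {S : Matrix (Fin ny) (Fin ny) ℝ}
  {u : ℤ → Ω → Fin nu → ℝ} {θ₀ θ : Params ny nu np nb nc} {M : ℝ≥0}

/-- The correlations of `f(s)` with the value of `w` at time `s - (k + 1)` are determined by
finitely many coefficients and the scheduling after time `s - (k + 1)`. -/
def TailRep (μ : Measure Ω) (p : ℤ → Ω → Fin np → ℝ) (w : ℤ → Ω → ℝ) (k : ℕ) (f : ℤ → Ω → ℝ) :
    Prop :=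
  (∀ s Z, RL μ p s Z → MemLp (fun ω => Z ω * f s ω) 2 μ) ∧
  ∃ δ : (Fin (k + 1) → Fin (np + 1)) → Fin (np + 1) → ℝ,
    ∀ s Z (c : Fin (np + 1) → Ω → ℝ), RL μ p s Z →
      (∀ b, Measurable[sig p (Set.Ioi (s - (k + 1 : ℕ)))] (c b)) → (∀ b, MemLp (c b) 2 μ) →
      ∫ ω, Z ω * f s ω * ((∑ b, c b ω * chr p (s - (k + 1 : ℕ)) b ω) * w (s - (k + 1 : ℕ)) ω) ∂μ
        = ∑ ξ, ∑ b, δ ξ b * ∫ ω, Z ω * sprod p s ξ ω * c b ω ∂μ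

variable {w : ℤ → Ω → ℝ} {k : ℕ}

omit [IsProbabilityMeasure μ] in
theorem TailRep.const_mul {f : ℤ → Ω → ℝ} (h : TailRep μ p w k f) (a : ℝ) :
    TailRep μ p w k fun s ω => a * f s ω := by
  obtain ⟨h1, δ, h2⟩ := h
  refine ⟨fun s Z hZ => ?_, fun ξ b => a * δ ξ b, fun s Z c hZ hc hc2 => ?_⟩
  · have := (h1 s Z hZ).const_mul a
    convert this using 2
    ring
  · simp only [mul_assoc, ← Finset.mul_sum]
    simp only [← mul_assoc]
    rw [← h2 s Z c hZ hc hc2, ← integral_const_mul]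
    refine integral_congr_ae (ae_of_all _ fun ω => ?_)
    ring

theorem TailRep.sum {z : ℤ → Ω → Fin ny → ℝ} (hp : IsWhiteScheduling μ p 4) (hz : Adm μ p z M)
    {l : Fin ny} {ι : Type*} (I : Finset ι) {f : ι → ℤ → Ω → ℝ}
    (h : ∀ i ∈ I, TailRep μ p (fun t ω => z t ω l) k (f i)) :
    TailRep μ p (fun t ω => z t ω l) k fun s ω => ∑ i ∈ I, f i s ω := by
  classical
  have h2 : ∀ i : ι, ∃ δ : (Fin (k + 1) → Fin (np + 1)) → Fin (np + 1) → ℝ, i ∈ I →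
      ∀ s Z (c : Fin (np + 1) → Ω → ℝ), RL μ p s Z →
      (∀ b, Measurable[sig p (Set.Ioi (s - (k + 1 : ℕ)))] (c b)) → (∀ b, MemLp (c b) 2 μ) →
      ∫ ω, Z ω * f i s ω * ((∑ b, c b ω * chr p (s - (k + 1 : ℕ)) b ω) *
        z (s - (k + 1 : ℕ)) ω l) ∂μ
        = ∑ ξ, ∑ b, δ ξ b * ∫ ω, Z ω * sprod p s ξ ω * c b ω ∂μ := fun i => by
    by_cases hi : i ∈ I
    · obtain ⟨δ, hδ⟩ := (h i hi).2
      exact ⟨δ, fun _ => hδ⟩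
    · exact ⟨0, fun hh => absurd hh hi⟩
  choose δ hδ using h2
  refine ⟨fun s Z hZ => ?_, fun ξ b => ∑ i ∈ I, δ i ξ b, fun s Z c hZ hc hc2 => ?_⟩
  · simp only [Finset.mul_sum]
    exact memLp_finsetSum _ fun i hi => (h i hi).1 s Z hZ
  · have hY : RL μ p (s - (k + 1 : ℕ)) fun ω => ∑ b, c b ω * chr p (s - (k + 1 : ℕ)) b ω :=
      ⟨c, hc, hc2, rfl⟩
    have e1 : ∀ ω, Z ω * (∑ i ∈ I, f i s ω) * ((∑ b, c b ω * chr p (s - (k + 1 : ℕ)) b ω) *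
        z (s - (k + 1 : ℕ)) ω l) = ∑ i ∈ I, Z ω * f i s ω *
          ((∑ b, c b ω * chr p (s - (k + 1 : ℕ)) b ω) * z (s - (k + 1 : ℕ)) ω l) := fun ω => by
      rw [Finset.mul_sum, Finset.sum_mul]
    simp only [e1]
    rw [integral_finsetSum _ fun i hi => integrable_mul_of_memLp_two ((h i hi).1 s Z hZ)
      (hz.memLp_mul hp hY l), Finset.sum_congr rfl fun i hi => hδ i hi s Z c hZ hc hc2,
      Finset.sum_comm]
    refine Finset.sum_congr rfl fun ξ _ => ?_
    rw [Finset.sum_comm]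
    simp only [Finset.sum_mul]

omit [IsProbabilityMeasure μ] in
theorem TailRep.zero : TailRep μ p w k fun _ _ => 0 :=
  ⟨fun s Z _ => by simp, 0, fun s Z c _ _ _ => by simp⟩

/-- The string is cut at `τ = s - (k + 1)`. Its first `k + 1` characters lie after `τ`, together
with `Z` and `c b`; the others, the value of `v` (whose time is at most `τ` as `k ≤ j`) and `z τ`
belong to the past. The two groups are independent, and the mean of the second is constant by
stationarity: these means are the numbers `δ`, attached to the initial string `η₁`. -/
theorem SignalAssumptions.tailRep_sprod_mul (H : SignalAssumptions μ p e S u)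
    {z v : ℤ → Ω → Fin ny → ℝ} {M' : ℝ≥0} (hz : Adm μ p z M) (hv : Adm μ p v M')
    (hzs : Stat p e z) (hvs : Stat p e v) (hza : AdaptedTo p e z) (hva : AdaptedTo p e v)
    (l q : Fin ny) {k j : ℕ} (hkj : k ≤ j) (η : Fin (j + 2) → Fin (np + 1)) :
    TailRep μ p (fun t ω => z t ω l) k fun s ω => sprod p s η ω * v (s - (j + 1 : ℕ)) ω q := by
  classical
  have hL2 : ∀ s Z, RL μ p s Z →
      MemLp (fun ω => Z ω * (sprod p s η ω * v (s - (j + 1 : ℕ)) ω q)) 2 μ := fun s Z hZ => by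
    simp only [← mul_assoc]
    exact hv.memLp_mul H.white (H.white.rl_mul_sprod hZ η (by push_cast; ring)) q
  have hn : j + 2 = (k + 1) + (j - k + 1) := by omega
  set η₁ : Fin (k + 1) → Fin (np + 1) := fun i => η ⟨i, by omega⟩ with hη₁
  set η₂ : Fin (j - k + 1) → Fin (np + 1) := fun i => η ⟨k + 1 + i, by omega⟩ with hη₂
  set m : Fin (np + 1) → ℤ → Ω → ℝ := fun b t ω =>
    chr p t b ω * (sprod p t η₂ ω * v (t - (j - k : ℕ)) ω q * z t ω l) with hm
  have hms : ∀ b, Stat p e (m b) := fun b => (stat_chr b).mul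
    (((stat_sprod η₂).mul ((hvs.lag _).apply q)).mul (hzs.apply l))
  refine ⟨hL2, fun ξ b => if ξ = η₁ then ∫ ω, m b 0 ω ∂μ else 0, fun s Z c hZ hc hc2 => ?_⟩
  set τ : ℤ := s - (k + 1 : ℕ) with hτ
  have hlag : s - ((j + 1 : ℕ) : ℤ) = τ - (j - k : ℕ) := by
    push_cast [hkj, hτ]
    ring
  have e1 : ∀ ω, Z ω * (sprod p s η ω * v (s - (j + 1 : ℕ)) ω q) *
      ((∑ b, c b ω * chr p τ b ω) * z τ ω l)
      = ∑ b, (Z ω * sprod p s η₁ ω * c b ω) * m b τ ω := fun ω => by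
    rw [sprod_split hn, hlag, Finset.sum_mul, Finset.mul_sum]
    refine Finset.sum_congr rfl fun b _ => ?_
    simp only [hm, ← hη₁, ← hη₂, ← hτ]
    ring
  have hint : ∀ b, Integrable (fun ω => (Z ω * sprod p s η₁ ω * c b ω) * m b τ ω) μ := by
    intro b
    have h1 := integrable_mul_of_memLp_two (hL2 s Z hZ)
      (hz.memLp_mul H.white (Lin.single (τ := τ) b (hc b) (hc2 b)) l)
    convert h1 using 2 with ω
    rw [sprod_split hn, hlag]
    simp only [hm, ← hη₁, ← hη₂, ← hτ]
    ring
  simp only [e1]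
  rw [integral_finsetSum _ fun b _ => hint b, Finset.sum_comm]
  refine Finset.sum_congr rfl fun b _ => ?_
  rw [Finset.sum_eq_single η₁]
  · rw [if_pos rfl, mul_comm, ← H.integral_stat (hms b) τ]
    refine integral_mul_of_indep (X := fun ω => Z ω * sprod p s η₁ ω * c b ω) (Y := m b τ)
      (H.white.sig_le _) (H.pastSigma_le τ) (H.indep_pastSigma τ) ?_ ?_
    · have m1 : Measurable[sig p (Set.Ioi τ)] Z := hZ.measurable_sig fun x hx => by
        simp only [Set.mem_Ici, Set.mem_Ioi, hτ] at hx ⊢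
        omega
      have m2 : Measurable[sig p (Set.Ioi τ)] (sprod p s η₁) :=
        measurable_sprod_sig _ fun i hi => by
          simp only [Set.mem_Ioi, hτ]
          omega
      exact (m1.mul m2).mul (hc b)
    · have hle : sig p (Set.Iic τ) ≤ pastSigma p e τ := le_sup_left
      have m1 : Measurable[pastSigma p e τ] (chr p τ b) :=
        (measurable_chr_sig (Set.mem_Iic.2 le_rfl) b).mono hle le_rfl
      have m2 : Measurable[pastSigma p e τ] (sprod p τ η₂) := by
        refine Measurable.mono (measurable_sprod_sig _ fun i hi => ?_) hle le_rfl
        simp only [Set.mem_Iic]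
        omega
      have m3 : Measurable[pastSigma p e τ] fun ω => v (τ - (j - k : ℕ)) ω q :=
        (measurable_pi_apply q).comp ((hva _).mono (pastSigma_mono (by omega)) le_rfl)
      have m4 : Measurable[pastSigma p e τ] fun ω => z τ ω l :=
        (measurable_pi_apply l).comp (hza τ)
      exact m1.mul ((m2.mul m3).mul m4)
  · intro ξ _ hξ
    rw [if_neg hξ, zero_mul]
  · simp

theorem SignalAssumptions.tailRep_sker (H : SignalAssumptions μ p e S u)
    {z v : ℤ → Ω → Fin ny → ℝ} {M' : ℝ≥0} (hz : Adm μ p z M) (hv : Adm μ p v M')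
    (hzs : Stat p e z) (hvs : Stat p e v) (hza : AdaptedTo p e z) (hva : AdaptedTo p e v)
    (l q : Fin ny) {k j : ℕ} (hkj : k ≤ j) (h : NoisePar ny np nc) :
    TailRep μ p (fun t ω => z t ω l) k fun s ω =>
      (sker h (sched p ω) s (j + 1)).mulVec (v (s - (j + 1 : ℕ)) ω) q := by
  simp only [Matrix.mulVec, dotProduct, sker_apply_succ]
  refine TailRep.sum H.white hz _ fun q' _ => ?_
  by_cases hj : j < nc
  · simp only [hj, dif_pos, Finset.sum_mul, mul_assoc]
    exact TailRep.sum H.white hz _ fun η _ =>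
      (H.tailRep_sprod_mul hz hv hzs hvs hza hva l q' hkj η).const_mul _
  · simp only [hj, dif_neg, not_false_eq_true, zero_mul]
    exact TailRep.zero

/-- Correlations as in `TailRep` are those of a filter coefficient. -/
theorem IsWhiteScheduling.integral_sker_mul (hp : IsWhiteScheduling μ p 4)
    (Δ : NoisePar ny np nc) (k : Fin nc)
    (δ : (Fin ((k : ℕ) + 1) → Fin (np + 1)) → Fin (np + 1) → ℝ) (q l : Fin ny)
    (hΔ : ∀ ζ, Δ k ζ q l = (∫ ω, chr p 0 (ζ (Fin.last _)) ω ^ 2 ∂μ)⁻¹ *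
      δ (Fin.init ζ) (ζ (Fin.last _)))
    {s : ℤ} {Z : Ω → ℝ} (hZ : RL μ p s Z) {c : Fin (np + 1) → Ω → ℝ}
    (hc : ∀ b, Measurable[sig p (Set.Ioi (s - ((k : ℕ) + 1 : ℕ)))] (c b))
    (hc2 : ∀ b, MemLp (c b) 2 μ) :
    ∫ ω, Z ω * sker Δ (sched p ω) s (k + 1) q l *
        (∑ b, c b ω * chr p (s - ((k : ℕ) + 1 : ℕ)) b ω) ∂μ
      = ∑ ξ, ∑ b, δ ξ b * ∫ ω, Z ω * sprod p s ξ ω * c b ω ∂μ := by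
  set τ : ℤ := s - ((k : ℕ) + 1 : ℕ) with hτ
  have e1 : ∀ ω, Z ω * sker Δ (sched p ω) s (k + 1) q l * (∑ b, c b ω * chr p τ b ω)
      = ∑ ζ : Fin ((k : ℕ) + 2) → Fin (np + 1), ∑ b, Δ k ζ q l *
        (Z ω * sprod p s ζ ω * (c b ω * chr p τ b ω)) := fun ω => by
    rw [sker_apply_succ, dif_pos k.2, Finset.mul_sum (a := Z ω), Finset.sum_mul_sum]
    refine Finset.sum_congr rfl fun ζ _ => Finset.sum_congr rfl fun b _ => ?_
    ring
  have hint : ∀ (ζ : Fin ((k : ℕ) + 2) → Fin (np + 1)) b, Integrable (fun ω => Δ k ζ q l *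
        (Z ω * sprod p s ζ ω * (c b ω * chr p τ b ω))) μ := fun ζ b =>
    (integrable_mul_of_memLp_two
      (hp.memLp_rl (hp.rl_mul_sprod hZ ζ (t' := τ) (by rw [hτ]; push_cast; ring)))
      (hp.memLp_rl (Lin.single (τ := τ) b (hc b) (hc2 b)))).const_mul _
  -- The two characters at `τ` are independent of everything after `τ`. By orthogonality only `b = ζ
  -- (Fin.last _)` survives, with its second moment, which the normalization in `hΔ` cancels.
  have e2 : ∀ (ζ : Fin ((k : ℕ) + 2) → Fin (np + 1)) b,
      ∫ ω, Z ω * sprod p s ζ ω * (c b ω * chr p τ b ω) ∂μ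
        = (∫ ω, Z ω * sprod p s (Fin.init ζ) ω * c b ω ∂μ) *
          ∫ ω, chr p τ (ζ (Fin.last _)) ω * chr p τ b ω ∂μ := by
    intro ζ b
    have hb := fun a => measurable_chr_sig (p := p) (Set.mem_singleton τ) a
    refine Eq.trans (integral_congr_ae (ae_of_all _ fun ω => ?_))
      (integral_mul_of_indep (X := fun ω => Z ω * sprod p s (Fin.init ζ) ω * c b ω)
        (Y := fun ω => chr p τ (ζ (Fin.last _)) ω * chr p τ b ω)
        (hp.sig_le (Set.Ioi τ)) (hp.sig_le {τ}) (hp.indep_Ioi τ) ?_ ((hb _).mul (hb b)))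
    · simp only
      rw [sprod_last, ← hτ]
      ring
    · have m1 : Measurable[sig p (Set.Ioi τ)] Z := hZ.measurable_sig fun x hx => by
        simp only [Set.mem_Ici, Set.mem_Ioi, hτ] at hx ⊢
        omega
      have m2 : Measurable[sig p (Set.Ioi τ)] (sprod p s (Fin.init ζ)) :=
        measurable_sprod_sig _ fun i hi => by
          simp only [Set.mem_Ioi, hτ]
          omega
      exact (m1.mul m2).mul (hc b)
  simp only [e1]
  rw [integral_finsetSum _ fun ζ _ => integrable_finsetSum _ fun b _ => hint ζ b,
    ← sum_init_last]
  refine Finset.sum_congr rfl fun ζ _ => ?_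
  rw [integral_finsetSum _ fun b _ => hint ζ b, Finset.sum_eq_single (ζ (Fin.last _))]
  · have h0 := (hp.integral_chr_sq_pos (ζ (Fin.last _))).ne'
    rw [integral_const_mul, e2, hp.integral_chr_mul, if_pos rfl, hΔ]
    field_simp
  · intro b _ hb
    rw [integral_const_mul, e2, hp.integral_chr_mul, if_neg hb.symm, mul_zero, mul_zero]
  · simp

end TailRepresentation


/-! ### The prediction error of the pure noise model -/

section NoisePrediction

variable {Ω : Type*} {m0 : MeasurableSpace Ω} {μ : Measure Ω}
  {ny nu np nb nc : ℕ}
  {p : ℤ → Ω → Fin np → ℝ} {e : ℤ → Ω → Fin ny → ℝ} {S : Matrix (Fin ny) (Fin ny) ℝ}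
  {u : ℤ → Ω → Fin nu → ℝ} {θ₀ θ : Params ny nu np nb nc}

/-- The prediction error of `θ` for the pure noise model with parameters `θ₀`. -/
noncomputable def noisePred (p : ℤ → Ω → Fin np → ℝ) (e : ℤ → Ω → Fin ny → ℝ)
    (θ₀ θ : Params ny nu np nb nc) : ℤ → Ω → Fin ny → ℝ :=
  gapp (fun ω => invNoiseCoeff θ (sched p ω)) (gapp (fun ω => noiseCoeff θ₀ (sched p ω)) e)

/-- The contribution of lag `j + 1` to the recursion for the prediction error. -/
noncomputable def predLag (p : ℤ → Ω → Fin np → ℝ) (e : ℤ → Ω → Fin ny → ℝ)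
    (θ₀ θ : Params ny nu np nb nc) (j : ℕ) (s : ℤ) (ω : Ω) (q : Fin ny) : ℝ :=
  (sker θ₀.2 (sched p ω) s (j + 1)).mulVec (e (s - (j + 1 : ℕ)) ω) q
    + (-1) * (sker θ.2 (sched p ω) s (j + 1)).mulVec (noisePred p e θ₀ θ (s - (j + 1 : ℕ)) ω) q

theorem gapp_sker_range {z : ℤ → Ω → Fin ny → ℝ} (h : NoisePar ny np nc) (t : ℤ) (ω : Ω) {N : ℕ}
    (hN : nc ≤ N) : gapp (fun ω => sker h (sched p ω)) z t ω
      = ∑ j ∈ Finset.range N, (sker h (sched p ω) t (j + 1)).mulVec (z (t - (j + 1 : ℕ)) ω) := by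
  rw [gapp_sker, Finset.sum_range_succ', sker_zero_lag, Matrix.zero_mulVec, add_zero]
  refine Finset.sum_subset (Finset.range_mono hN) fun j _ hj => ?_
  rw [Finset.mem_range] at hj
  rw [sker_eq_zero _ _ _ (by omega), Matrix.zero_mulVec]

theorem conv_inv_sker_zero_lag (θ : Params ny nu np nb nc) (Δ : NoisePar ny np nc)
    (q : ℤ → Fin np → ℝ) (t : ℤ) : conv (invNoiseCoeff θ q) (sker Δ q) t 0 = 0 := by
  simp [conv, sker_zero_lag]

/-- Coefficient of lag `n + 1` in `C(ΓΔ) = Δ`; the summand with lag zero of `ΓΔ` drops out. The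
autocorrelations of the prediction error will satisfy this same recursion. -/
theorem conv_inv_sker_succ (θ : Params ny nu np nb nc) (Δ : NoisePar ny np nc)
    (q : ℤ → Fin np → ℝ) (t : ℤ) (n : ℕ) :
    conv (invNoiseCoeff θ q) (sker Δ q) t (n + 1) = sker Δ q t (n + 1)
      - ∑ j ∈ Finset.range n, sker θ.2 q t (j + 1)
        * conv (invNoiseCoeff θ q) (sker Δ q) (t - (j + 1 : ℕ)) (n - j) := by
  have h : conv (noiseCoeff θ q) (conv (invNoiseCoeff θ q) (sker Δ q)) = sker Δ q := by
    rw [← conv_assoc, noiseCoeff_conv_invNoiseCoeff, kone_conv]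
  have h1 := congrFun (congrFun h t) (n + 1)
  rw [conv_succ_left, noiseCoeff_zero_lag, one_mul,
    Finset.Nat.sum_antidiagonal_eq_sum_range_succ (fun a b => noiseCoeff θ q t (a + 1)
      * conv (invNoiseCoeff θ q) (sker Δ q) (t - (a + 1 : ℕ)) b), Finset.sum_range_succ,
    Nat.sub_self, conv_inv_sker_zero_lag, mul_zero, add_zero] at h1
  simp only [noiseCoeff_eq, kone, Pi.add_apply, Nat.add_eq_zero_iff, one_ne_zero, and_false,
    if_false, zero_add] at h1
  exact eq_sub_of_add_eq h1

theorem stat_noiseCoeff (θ : Params ny nu np nb nc) (k : ℕ) (i l : Fin ny) :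
    Stat p e fun t ω => noiseCoeff θ (sched p ω) t k i l := by
  cases k with
  | zero => simp only [noiseCoeff_zero_lag]; exact Stat.const _
  | succ k => exact stat_sker θ.2 (k + 1) i l

theorem stat_noisePred (θ₀ θ : Params ny nu np nb nc) : Stat p e (noisePred p e θ₀ θ) :=
  (stat_noise.gapp (stat_noiseCoeff θ₀)).gapp (stat_invNoiseCoeff θ)

variable [IsProbabilityMeasure μ] (H : SignalAssumptions μ p e S u)

include H

theorem SignalAssumptions.adaptedTo_noisePred (θ₀ θ : Params ny nu np nb nc) :
    AdaptedTo p e (noisePred p e θ₀ θ) :=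
  (adaptedTo_noise.gapp (H.white.lker_noiseCoeff θ₀)).gapp (H.white.lker_inv θ)

theorem SignalAssumptions.adm_noisePred (hθ : θ ∈ stableParams μ p) :
    ∃ M, Adm μ p (noisePred p e θ₀ θ) M := by
  obtain ⟨κ, hκ⟩ := H.white.exists_junction
  obtain ⟨M, hM⟩ := H.adm_noise
  obtain ⟨K', hK'⟩ := H.white.exists_goodKer_noiseCoeff θ₀
  obtain ⟨K, ρ, hK⟩ := H.white.exists_goodKer_inv hθ
  exact ⟨_, (hM.gapp H.white hκ hK').gapp H.white hκ hK⟩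

theorem SignalAssumptions.orthUpTo_noisePred (hθ : θ ∈ stableParams μ p) {g : Ω → ℝ}
    (hg : MemLp g 2 μ) {τ : ℤ} (h : OrthUpTo μ p g τ e) :
    OrthUpTo μ p g τ (noisePred p e θ₀ θ) := by
  obtain ⟨κ, hκ⟩ := H.white.exists_junction
  obtain ⟨M, hM⟩ := H.adm_noise
  obtain ⟨K', hK'⟩ := H.white.exists_goodKer_noiseCoeff θ₀
  obtain ⟨K, ρ, hK⟩ := H.white.exists_goodKer_inv hθ
  exact (h.gapp H.white hκ hM hK' hg).gapp H.white hκ (hM.gapp H.white hκ hK') hK hg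

theorem SignalAssumptions.noisePred_ae_eq (hθ : θ ∈ stableParams μ p) (t : ℤ) :
    noisePred p e θ₀ θ t =ᵐ[μ] fun ω => e t ω + noiseErr p e θ₀ θ t ω := by
  obtain ⟨κ, hκ⟩ := H.white.exists_junction
  obtain ⟨M, hM⟩ := H.adm_noise
  obtain ⟨c, hc⟩ := H.white.exists_goodKer_sker ny nc
  obtain ⟨K, ρ, hK⟩ := H.white.exists_goodKer_inv hθ
  obtain ⟨K', hK'⟩ := H.white.exists_goodKer_noiseCoeff θ
  have e1 : gapp (fun ω => noiseCoeff θ₀ (sched p ω)) e = fun s ω =>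
      gapp (fun ω => noiseCoeff θ (sched p ω)) e s ω
        + gapp (fun ω => sker (θ₀.2 - θ.2) (sched p ω)) e s ω := by
    ext1 s
    ext1 ω
    rw [gapp_noiseCoeff, gapp_noiseCoeff, gapp_sker_sub]
    abel
  rw [noisePred, e1]
  filter_upwards [gapp_add H.white hκ (hM.gapp H.white hκ hK') (hM.gapp H.white hκ (hc _)) hK t,
    gapp_inv_gapp H.white hκ hM hK t] with ω h1 h2
  rw [h1, h2, noiseErr]

/-- The recursion for the prediction error. -/
theorem SignalAssumptions.noisePred_recursion (hθ : θ ∈ stableParams μ p) (t : ℤ) {N : ℕ}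
    (hN : nc ≤ N) : ∀ᵐ ω ∂μ, ∀ q, noisePred p e θ₀ θ t ω q
      = e t ω q + ∑ j ∈ Finset.range N, predLag p e θ₀ θ j t ω q := by
  obtain ⟨κ, hκ⟩ := H.white.exists_junction
  obtain ⟨M, hM⟩ := H.adm_noise
  obtain ⟨K, ρ, hK⟩ := H.white.exists_goodKer_inv hθ
  obtain ⟨K', hK'⟩ := H.white.exists_goodKer_noiseCoeff θ₀
  filter_upwards [gapp_gapp_inv H.white hκ (hM.gapp H.white hκ hK') hK t] with ω h1 q
  change gapp (fun ω => noiseCoeff θ (sched p ω)) (noisePred p e θ₀ θ) t ω = _ at h1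
  rw [gapp_noiseCoeff, gapp_noiseCoeff, gapp_sker_range _ _ _ hN, gapp_sker_range _ _ _ hN] at h1
  have h2 := congrFun h1 q
  simp only [Pi.add_apply, Finset.sum_apply] at h2
  simp only [predLag, Finset.sum_add_distrib, ← Finset.mul_sum]
  linarith

/-- A process `Z` times the noise at time `s` is orthogonal to past prediction errors. -/
theorem SignalAssumptions.integral_noise_mul_noisePred (hθ : θ ∈ stableParams μ p) {s τ : ℤ}
    (hs : τ < s) {Z Y : Ω → ℝ} (hZ : RL μ p s Z) (hY : RL μ p τ Y) (q l : Fin ny) :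
    ∫ ω, Z ω * e s ω q * (Y ω * noisePred p e θ₀ θ τ ω l) ∂μ = 0 := by
  have hZ' := hZ.measurable_schedSigma
  exact H.orthUpTo_noisePred hθ
    (H.noise.memLp_mul H.white.schedSigma_le H.indep hZ' (H.white.memLp_rl hZ) s q)
    (H.noise.orthUpTo H.white.schedSigma_le H.indep hZ' s q) τ (by omega) l Y hY

theorem SignalAssumptions.memLp_mul_sker_mulVec {z : ℤ → Ω → Fin ny → ℝ} {M : ℝ≥0}
    (hz : Adm μ p z M) (h : NoisePar ny np nc) {s : ℤ} {Z : Ω → ℝ} (hZ : RL μ p s Z) (j : ℕ)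
    (q : Fin ny) :
    MemLp (fun ω => Z ω * (sker h (sched p ω) s j).mulVec (z (s - j) ω) q) 2 μ :=
  hz.term_memLp H.white (H.white.rker_sker h) hZ j q

theorem SignalAssumptions.memLp_mul_predLag (hθ : θ ∈ stableParams μ p) {s : ℤ} {Z : Ω → ℝ}
    (hZ : RL μ p s Z) (j : ℕ) (q : Fin ny) :
    MemLp (fun ω => Z ω * predLag p e θ₀ θ j s ω q) 2 μ := by
  obtain ⟨M, hM⟩ := H.adm_noise
  obtain ⟨M', hM'⟩ := H.adm_noisePred (θ₀ := θ₀) hθ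
  have h1 := (H.memLp_mul_sker_mulVec hM θ₀.2 hZ (j + 1) q).add
    ((H.memLp_mul_sker_mulVec hM' θ.2 hZ (j + 1) q).const_mul (-1))
  convert h1 using 2 with ω
  simp only [predLag, Pi.add_apply]
  ring

/-- The noise in lag `j + 1` is later than `τ`, hence orthogonal to the prediction error at `τ`.
Only the autoregressive term remains. -/
theorem SignalAssumptions.integral_predLag_mul (hθ : θ ∈ stableParams μ p) {s τ : ℤ} {j : ℕ}
    (hs : τ < s - (j + 1 : ℕ)) {Z Y : Ω → ℝ} (hZ : RL μ p s Z) (hY : RL μ p τ Y) (q l : Fin ny) :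
    ∫ ω, Z ω * predLag p e θ₀ θ j s ω q * (Y ω * noisePred p e θ₀ θ τ ω l) ∂μ
      = -∑ q', ∫ ω, (Z ω * sker θ.2 (sched p ω) s (j + 1) q q')
        * noisePred p e θ₀ θ (s - (j + 1 : ℕ)) ω q' * (Y ω * noisePred p e θ₀ θ τ ω l) ∂μ := by
  obtain ⟨M, hM⟩ := H.adm_noise
  obtain ⟨M', hM'⟩ := H.adm_noisePred (θ₀ := θ₀) hθ
  have hg := hM'.memLp_mul H.white hY l
  have e1 : ∀ ω, Z ω * predLag p e θ₀ θ j s ω q * (Y ω * noisePred p e θ₀ θ τ ω l)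
      = ∑ q', (Z ω * sker θ₀.2 (sched p ω) s (j + 1) q q') * e (s - (j + 1 : ℕ)) ω q'
          * (Y ω * noisePred p e θ₀ θ τ ω l)
        - ∑ q', (Z ω * sker θ.2 (sched p ω) s (j + 1) q q')
          * noisePred p e θ₀ θ (s - (j + 1 : ℕ)) ω q' * (Y ω * noisePred p e θ₀ θ τ ω l) := by
    intro ω
    simp only [predLag, Matrix.mulVec, dotProduct, mul_assoc, ← Finset.mul_sum]
    simp only [← mul_assoc, ← Finset.sum_mul]
    ring
  have i1 : ∀ q', Integrable (fun ω => (Z ω * sker θ₀.2 (sched p ω) s (j + 1) q q')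
      * e (s - (j + 1 : ℕ)) ω q' * (Y ω * noisePred p e θ₀ θ τ ω l)) μ := fun q' =>
    integrable_mul_of_memLp_two
      (hM.memLp_mul H.white (H.white.rker_sker θ₀.2 s (j + 1) q q' Z hZ) q') hg
  have i2 : ∀ q', Integrable (fun ω => (Z ω * sker θ.2 (sched p ω) s (j + 1) q q')
      * noisePred p e θ₀ θ (s - (j + 1 : ℕ)) ω q' * (Y ω * noisePred p e θ₀ θ τ ω l)) μ :=
    fun q' => integrable_mul_of_memLp_two
      (hM'.memLp_mul H.white (H.white.rker_sker θ.2 s (j + 1) q q' Z hZ) q') hg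
  simp only [e1]
  rw [integral_sub (integrable_finsetSum _ fun q' _ => i1 q')
    (integrable_finsetSum _ fun q' _ => i2 q'), integral_finsetSum _ fun q' _ => i1 q',
    integral_finsetSum _ fun q' _ => i2 q', Finset.sum_eq_zero fun q' _ =>
      H.integral_noise_mul_noisePred hθ hs (H.white.rker_sker θ₀.2 s (j + 1) q q' Z hZ) hY q' l,
    zero_sub]

omit [IsProbabilityMeasure μ] H in
theorem TailRep.add [IsProbabilityMeasure μ] {z : ℤ → Ω → Fin ny → ℝ} {M : ℝ≥0}
    (hp : IsWhiteScheduling μ p 4)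
    (hz : Adm μ p z M) {l : Fin ny} {k : ℕ} {f g : ℤ → Ω → ℝ}
    (hf : TailRep μ p (fun t ω => z t ω l) k f) (hg : TailRep μ p (fun t ω => z t ω l) k g) :
    TailRep μ p (fun t ω => z t ω l) k fun s ω => f s ω + g s ω := by
  have := TailRep.sum hp hz (l := l) (k := k) Finset.univ (f := fun b : Bool => cond b f g)
    (by rintro (_ | _) _; exacts [hg, hf])
  simpa using this

theorem SignalAssumptions.tailRep_predLag (hθ : θ ∈ stableParams μ p) (k : ℕ) (q l : Fin ny) :
    TailRep μ p (fun t ω => noisePred p e θ₀ θ t ω l) k fun s ω =>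
      ∑ i ∈ Finset.range nc, predLag p e θ₀ θ (k + i) s ω q := by
  obtain ⟨M, hM⟩ := H.adm_noise
  obtain ⟨M', hM'⟩ := H.adm_noisePred (θ₀ := θ₀) hθ
  refine TailRep.sum H.white hM' _ fun i _ => TailRep.add H.white hM' ?_ (TailRep.const_mul ?_ _)
  · exact H.tailRep_sker hM' hM (stat_noisePred _ _) stat_noise (H.adaptedTo_noisePred _ _)
      adaptedTo_noise l q (Nat.le_add_right k i) _
  · exact H.tailRep_sker hM' hM' (stat_noisePred _ _) (stat_noisePred _ _)
      (H.adaptedTo_noisePred _ _) (H.adaptedTo_noisePred _ _) l q (Nat.le_add_right k i) _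

end NoisePrediction


/-! ### Autocorrelations of the prediction error as filter coefficients -/

section Correlation

variable {Ω : Type*} {m0 : MeasurableSpace Ω} {μ : Measure Ω} [IsProbabilityMeasure μ]
  {ny nu np nb nc : ℕ}
  {p : ℤ → Ω → Fin np → ℝ} {e : ℤ → Ω → Fin ny → ℝ} {S : Matrix (Fin ny) (Fin ny) ℝ}
  {u : ℤ → Ω → Fin nu → ℝ} {θ₀ θ : Params ny nu np nb nc}
  (H : SignalAssumptions μ p e S u)

include H

/-- The correlations of the remote part of the recursion are the coefficients of a filter. -/
theorem SignalAssumptions.exists_integral_tail (hθ : θ ∈ stableParams μ p) :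
    ∃ Δ : NoisePar ny np nc, ∀ (n : ℕ) (s : ℤ) (q l : Fin ny) (Z Y : Ω → ℝ), RL μ p s Z →
      RL μ p (s - (n + 1 : ℕ)) Y →
      ∫ ω, Z ω * (∑ i ∈ Finset.range nc, predLag p e θ₀ θ (n + i) s ω q)
        * (Y ω * noisePred p e θ₀ θ (s - (n + 1 : ℕ)) ω l) ∂μ
        = ∫ ω, Z ω * sker Δ (sched p ω) s (n + 1) q l * Y ω ∂μ := by
  have h1 := fun k q l => (H.tailRep_predLag (θ₀ := θ₀) hθ k q l).2
  choose δ hδ using h1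
  -- Each number `δ` is divided by the second moment of the last character, the normalization
  -- required by `integral_sker_mul`.
  refine ⟨fun k ζ q l => (∫ ω, chr p 0 (ζ (Fin.last _)) ω ^ 2 ∂μ)⁻¹ *
      δ k q l (Fin.init ζ) (ζ (Fin.last _)), fun n s q l Z Y hZ hY => ?_⟩
  by_cases hn : n < nc
  · obtain ⟨c, hc, hc2, rfl⟩ := hY
    rw [hδ n q l s Z c hZ hc hc2]
    exact (H.white.integral_sker_mul _ ⟨n, hn⟩ (δ n q l) q l (fun ζ => rfl) hZ hc hc2).symm
  -- From lag `nc + 1` on both sides are zero, so `Δ` has the order of the model and is an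
  -- admissible direction of differentiation.
  · have e1 : ∀ i ω, predLag p e θ₀ θ (n + i) s ω q = 0 := fun i ω => by
      rw [predLag, sker_eq_zero _ _ _ (by omega), sker_eq_zero _ _ _ (by omega)]
      simp
    simp only [e1, sker_eq_zero _ _ _ (show nc < n + 1 by omega)]
    simp

/-- The correlations of the prediction error are the coefficients of the derivative of the inverse
noise filter in some direction. -/
theorem SignalAssumptions.exists_integral_noisePred_mul (hθ : θ ∈ stableParams μ p) :
    ∃ Δ : NoisePar ny np nc, ∀ (n : ℕ) (s : ℤ) (q l : Fin ny) (Z Y : Ω → ℝ), RL μ p s Z →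
      RL μ p (s - (n + 1 : ℕ)) Y →
      ∫ ω, Z ω * noisePred p e θ₀ θ s ω q
        * (Y ω * noisePred p e θ₀ θ (s - (n + 1 : ℕ)) ω l) ∂μ
        = ∫ ω, Z ω * conv (invNoiseCoeff θ (sched p ω)) (sker Δ (sched p ω)) s (n + 1) q l
          * Y ω ∂μ := by
  obtain ⟨Δ, hΔ⟩ := H.exists_integral_tail (θ₀ := θ₀) hθ
  refine ⟨Δ, fun n => ?_⟩
  obtain ⟨M, hM⟩ := H.adm_noise
  obtain ⟨M', hM'⟩ := H.adm_noisePred (θ₀ := θ₀) hθ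
  have hconv : RKer μ p fun ω => conv (invNoiseCoeff θ (sched p ω)) (sker Δ (sched p ω)) :=
    (H.white.rker_inv θ).conv (H.white.rker_sker Δ)
  induction n using Nat.strong_induction_on with
  | _ n ih =>
    intro s q l Z Y hZ hY
    set τ : ℤ := s - (n + 1 : ℕ) with hτ
    set g : Ω → ℝ := fun ω => Y ω * noisePred p e θ₀ θ τ ω l with hgdef
    have hg : MemLp g 2 μ := hM'.memLp_mul H.white hY l
    have hlag : ∀ j, Integrable (fun ω => Z ω * predLag p e θ₀ θ j s ω q * g ω) μ := fun j =>
      integrable_mul_of_memLp_two (H.memLp_mul_predLag hθ hZ j q) hg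
    have htail : Integrable (fun ω => Z ω * (∑ i ∈ Finset.range nc,
        predLag p e θ₀ θ (n + i) s ω q) * g ω) μ :=
      integrable_mul_of_memLp_two ((H.tailRep_predLag hθ n q l).1 s Z hZ) hg
    have hnoise : Integrable (fun ω => Z ω * e s ω q * g ω) μ :=
      integrable_mul_of_memLp_two (hM.memLp_mul H.white hZ q) hg
    have hsum : Integrable (fun ω => ∑ j ∈ Finset.range n,
        Z ω * predLag p e θ₀ θ j s ω q * g ω) μ := integrable_finsetSum _ fun j _ => hlag j
    have hrest : Integrable (fun ω => ∑ j ∈ Finset.range n, Z ω * predLag p e θ₀ θ j s ω q * g ω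
        + Z ω * (∑ i ∈ Finset.range nc, predLag p e θ₀ θ (n + i) s ω q) * g ω) μ :=
      hsum.add htail
    -- The recursion over `n + nc` lags is cut at `n`. The current noise is orthogonal to the past;
    -- lags up to `n` lead to correlations at smaller distance, known by induction; the tail gives
    -- the coefficient of `Δ`.
    have e1 : (fun ω => Z ω * noisePred p e θ₀ θ s ω q * g ω) =ᵐ[μ] fun ω =>
        Z ω * e s ω q * g ω + (∑ j ∈ Finset.range n, Z ω * predLag p e θ₀ θ j s ω q * g ω
          + Z ω * (∑ i ∈ Finset.range nc, predLag p e θ₀ θ (n + i) s ω q) * g ω) := by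
      filter_upwards [H.noisePred_recursion hθ s (Nat.le_add_left nc n)] with ω hω
      rw [hω, Finset.sum_range_add, ← Finset.sum_mul, ← Finset.mul_sum]
      ring
    have hZs : ∀ j q', RL μ p (s - (j + 1 : ℕ))
        fun ω => Z ω * sker θ.2 (sched p ω) s (j + 1) q q' := fun j q' =>
      H.white.rker_sker θ.2 s (j + 1) q q' Z hZ
    have hstep : ∀ j ∈ Finset.range n, ∀ q',
        RL μ p τ fun ω => Z ω * sker θ.2 (sched p ω) s (j + 1) q q'
          * conv (invNoiseCoeff θ (sched p ω)) (sker Δ (sched p ω)) (s - (j + 1 : ℕ)) (n - j) q' l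
        := by
      intro j hj q'
      rw [Finset.mem_range] at hj
      have := hconv (s - (j + 1 : ℕ)) (n - j) q' l _ (hZs j q')
      rwa [show s - ((j + 1 : ℕ) : ℤ) - ((n - j : ℕ) : ℤ) = τ by omega] at this
    have i1 : ∀ j ∈ Finset.range n, ∀ q', Integrable (fun ω =>
        Z ω * sker θ.2 (sched p ω) s (j + 1) q q'
          * conv (invNoiseCoeff θ (sched p ω)) (sker Δ (sched p ω)) (s - (j + 1 : ℕ)) (n - j) q' l
          * Y ω) μ := fun j hj q' =>
      integrable_mul_of_memLp_two (H.white.memLp_rl (hstep j hj q')) (H.white.memLp_rl hY)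
    have i2 : Integrable (fun ω => Z ω * sker Δ (sched p ω) s (n + 1) q l * Y ω) μ :=
      integrable_mul_of_memLp_two (H.white.memLp_rl (H.white.rker_sker Δ s (n + 1) q l Z hZ))
        (H.white.memLp_rl hY)
    have e2 : ∀ ω, Z ω * conv (invNoiseCoeff θ (sched p ω)) (sker Δ (sched p ω)) s (n + 1) q l
        * Y ω = Z ω * sker Δ (sched p ω) s (n + 1) q l * Y ω - ∑ j ∈ Finset.range n, ∑ q',
          Z ω * sker θ.2 (sched p ω) s (j + 1) q q'
          * conv (invNoiseCoeff θ (sched p ω)) (sker Δ (sched p ω)) (s - (j + 1 : ℕ)) (n - j) q' l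
          * Y ω := by
      intro ω
      rw [conv_inv_sker_succ, Matrix.sub_apply, Matrix.sum_apply]
      simp only [Matrix.mul_apply, mul_sub, sub_mul, Finset.mul_sum, Finset.sum_mul, mul_assoc]
    rw [integral_congr_ae e1, integral_add hnoise hrest,
      H.integral_noise_mul_noisePred hθ (by omega) hZ hY q l, zero_add,
      integral_add hsum htail, hΔ n s q l Z Y hZ hY, integral_finsetSum _ fun j _ => hlag j]
    simp only [e2]
    rw [integral_sub i2 (integrable_finsetSum _ fun j hj => integrable_finsetSum _ fun q' _ =>
      i1 j hj q'), integral_finsetSum _ fun j hj => integrable_finsetSum _ fun q' _ => i1 j hj q',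
      add_comm, sub_eq_add_neg, ← Finset.sum_neg_distrib]
    congr 1
    refine Finset.sum_congr rfl fun j hj => ?_
    rw [integral_finsetSum _ fun q' _ => i1 j hj q']
    have hj' := Finset.mem_range.1 hj
    rw [H.integral_predLag_mul hθ (by omega) hZ hY]
    congr 1
    refine Finset.sum_congr rfl fun q' _ => ?_
    -- The distance between `s - (j + 1)` and `τ` is `n - j`, and the induction hypothesis counts
    -- distances from one.
    have h3 := ih (n - j - 1) (by omega) (s - (j + 1 : ℕ)) q' l _ Y (hZs j q')
    have h4 : s - ((j + 1 : ℕ) : ℤ) - ((n - j - 1 + 1 : ℕ) : ℤ) = τ := by omega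
    have h5 : n - j - 1 + 1 = n - j := by omega
    rw [h4, h5] at h3
    exact h3 hY

end Correlation


/-! ### Stationary points of the loss -/

section StationaryPoints

variable {Ω : Type*} {m0 : MeasurableSpace Ω} {μ : Measure Ω} [IsProbabilityMeasure μ]
  {ny nu np nb nc : ℕ}
  {p : ℤ → Ω → Fin np → ℝ} {e : ℤ → Ω → Fin ny → ℝ} {S : Matrix (Fin ny) (Fin ny) ℝ}
  {u : ℤ → Ω → Fin nu → ℝ} {θ₀ θ θ' : Params ny nu np nb nc}
  {y : ℤ → Ω → Fin ny → ℝ} {V : Params ny nu np nb nc → ℝ} {m : ℕ}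

omit [IsProbabilityMeasure μ] in
theorem abs_integral_mul_le_of_le {f g : Ω → ℝ} (hf : MemLp f 2 μ) (hg : MemLp g 2 μ) {A B : ℝ≥0}
    (hA : eLpNorm f 2 μ ≤ A) (hB : eLpNorm g 2 μ ≤ B) : |∫ ω, f ω * g ω ∂μ| ≤ A * B :=
  (abs_integral_le_integral_abs.trans (abs_integral_mul_le hf hg)).trans
    (mul_le_mul (ENNReal.toReal_mono ENNReal.coe_ne_top hA)
      (ENNReal.toReal_mono ENNReal.coe_ne_top hB) ENNReal.toReal_nonneg A.2)

/-- The effect of the direction `Δ` on a process filtered by the inverse noise filter. -/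
noncomputable def dirErr (p : ℤ → Ω → Fin np → ℝ) (θ : Params ny nu np nb nc)
    (Δ : NoisePar ny np nc) (z : ℤ → Ω → Fin ny → ℝ) : ℤ → Ω → Fin ny → ℝ :=
  gapp (fun ω => invNoiseCoeff θ (sched p ω)) (gapp (fun ω => sker Δ (sched p ω)) z)

section Perturbed

variable {κ M K K' ρ ρ' : ℝ≥0} {z : ℤ → Ω → Fin ny → ℝ} {Δ : NoisePar ny np nc} {r : ℝ}
  (hp : IsWhiteScheduling μ p 4) (hκ : Junction μ p κ) (hz : Adm μ p z M)
  (h : GoodKer μ p (fun ω => invNoiseCoeff θ (sched p ω)) K ρ)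
  (h' : GoodKer μ p (fun ω => invNoiseCoeff θ' (sched p ω)) K' ρ') (hr : θ'.2 = θ.2 + r • Δ)

include hp hκ hz h h' hr

theorem gapp_inv_perturb (t : ℤ) :
    gapp (fun ω => invNoiseCoeff θ' (sched p ω)) z t =ᵐ[μ] fun ω =>
      gapp (fun ω => invNoiseCoeff θ (sched p ω)) z t ω
        + (-r) • dirErr p θ Δ (gapp (fun ω => invNoiseCoeff θ' (sched p ω)) z) t ω := by
  filter_upwards [gapp_inv_eq hp hκ hz h' h t] with ω hω
  rw [hω, dirErr, ← gapp_smul, show θ.2 - θ'.2 = (-r) • Δ by rw [hr, neg_smul]; abel]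
  congr 2
  ext1 s
  ext1 ω
  exact gapp_sker_smul _ _ _ _

/-- A second use of the resolvent identity, applied to the first-order term itself, so that what is
left is of second order in `r`. -/
theorem dirErr_perturb (t : ℤ) :
    dirErr p θ Δ (gapp (fun ω => invNoiseCoeff θ' (sched p ω)) z) t =ᵐ[μ] fun ω =>
      dirErr p θ Δ (gapp (fun ω => invNoiseCoeff θ (sched p ω)) z) t ω
        + (-r) • dirErr p θ Δ (dirErr p θ Δ (gapp (fun ω => invNoiseCoeff θ' (sched p ω)) z)) t ω
    := by
  obtain ⟨c, hc⟩ := hp.exists_goodKer_sker (μ := μ) (p := p) ny nc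
  have a1 := hz.gapp hp hκ h
  have a2 := ((hz.gapp hp hκ h').gapp hp hκ (hc Δ)).gapp hp hκ h
  have h1 : ∀ s, gapp (fun ω => sker Δ (sched p ω))
      (gapp (fun ω => invNoiseCoeff θ' (sched p ω)) z) s =ᵐ[μ] fun ω =>
        gapp (fun ω => sker Δ (sched p ω)) (gapp (fun ω => invNoiseCoeff θ (sched p ω)) z) s ω
        + (-r) • gapp (fun ω => sker Δ (sched p ω))
          (dirErr p θ Δ (gapp (fun ω => invNoiseCoeff θ' (sched p ω)) z)) s ω := by
    intro s
    refine (gapp_congr (gapp_inv_perturb hp hκ hz h h' hr) s).trans ?_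
    filter_upwards [gapp_add hp hκ a1 (a2.const_smul (-r)) (hc Δ) s] with ω hω
    rw [← gapp_smul]
    exact hω
  refine (gapp_congr h1 t).trans ?_
  filter_upwards [gapp_add hp hκ (a1.gapp hp hκ (hc Δ))
    ((a2.gapp hp hκ (hc Δ)).const_smul (-r)) h t] with ω hω
  simp only [dirErr]
  rw [← gapp_smul]
  exact hω

end Perturbed

variable (H : SignalAssumptions μ p e S u)

include H

theorem SignalAssumptions.sum_integral_noisePred_sq (hθ : θ ∈ stableParams μ p) :
    ∑ i, ∫ ω, noisePred p e θ₀ θ 0 ω i ^ 2 ∂μ = S.trace + noiseLoss μ p e θ₀ θ 0 := by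
  obtain ⟨M, hM⟩ := H.adm_noiseErr (θ₀ := θ₀) hθ
  rw [Matrix.trace, noiseLoss, ← Finset.sum_add_distrib]
  refine Finset.sum_congr rfl fun i _ => ?_
  rw [Matrix.diag_apply, ← H.noise.covariance 0 i i]
  simp only [← sq]
  rw [← integral_add_sq (H.noise.memLp 0 i) (hM.memLp 0 i)
    (H.integral_noise_mul_noiseErr hθ 0 i i)]
  refine integral_congr_ae ?_
  filter_upwards [H.noisePred_ae_eq hθ 0] with ω hω
  rw [hω]
  rfl

/-- With `ε' = ε - rψ'` and `ψ' = ψ - rχ` one has `ε'² = ε² - 2rεψ + r²(2εχ + ψ'²)`. The last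
bracket is bounded in mean uniformly near `θ`, because the decay of the inverse filters is locally
uniform. -/
theorem SignalAssumptions.integral_noisePred_perturb (hθ : θ ∈ stableParams μ p)
    (Δ : NoisePar ny np nc) : ∃ δ > (0 : ℝ), ∃ C : ℝ, ∀ r : ℝ, |r| < δ →
      θ + r • ((0, Δ) : Params ny nu np nb nc) ∈ stableParams μ p ∧ ∀ i,
      |∫ ω, noisePred p e θ₀ (θ + r • ((0, Δ) : Params ny nu np nb nc)) 0 ω i ^ 2 ∂μ
        - ∫ ω, noisePred p e θ₀ θ 0 ω i ^ 2 ∂μ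
        + 2 * r * ∫ ω, noisePred p e θ₀ θ 0 ω i * dirErr p θ Δ (noisePred p e θ₀ θ) 0 ω i ∂μ|
        ≤ C * r ^ 2 := by
  have hp := H.white
  obtain ⟨δ, hδ, K, ρ, hK⟩ := hp.exists_uniform_goodKer hθ
  obtain ⟨κ, hκ⟩ := hp.exists_junction
  obtain ⟨c, hc⟩ := hp.exists_goodKer_sker ny nc
  obtain ⟨M₀, hM₀⟩ := H.adm_noise
  obtain ⟨K', hK'⟩ := hp.exists_goodKer_noiseCoeff θ₀
  have hg := (hK θ (by simpa using hδ)).2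
  have hz := hM₀.gapp hp hκ hK'
  have a0 := hz.gapp hp hκ hg
  have aψ := (a0.gapp hp hκ (hc Δ)).gapp hp hκ hg
  have aχ := (aψ.gapp hp hκ (hc Δ)).gapp hp hκ hg
  set d : Params ny nu np nb nc := (0, Δ) with hd
  -- `A`, `B`, `B'` bound the components of `ε`, `ψ'`, `χ` in `L²`, independently of `r`.
  set A := ny * κ * (ny * κ * M₀ * K' * ∑' r : ℕ, (1 / 2 : ℝ≥0) ^ r) * K * ∑' r : ℕ, ρ ^ r
  set B := ny * κ * (ny * κ * A * (c * ‖Δ‖₊) * ∑' r : ℕ, (1 / 2 : ℝ≥0) ^ r) * K * ∑' r : ℕ, ρ ^ r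
  set B' := ny * κ * (ny * κ * B * (c * ‖Δ‖₊) * ∑' r : ℕ, (1 / 2 : ℝ≥0) ^ r) * K * ∑' r : ℕ, ρ ^ r
  refine ⟨δ / (‖d‖ + 1), by positivity, 2 * (A * B') + B * B, fun r hr => ?_⟩
  have hnorm : ‖θ + r • d - θ‖ < δ := by
    rw [add_sub_cancel_left, norm_smul, Real.norm_eq_abs]
    have h1 : |r| * (‖d‖ + 1) < δ := (lt_div_iff₀ (by positivity)).1 hr
    nlinarith [abs_nonneg r]
  obtain ⟨hs, hg'⟩ := hK _ hnorm
  refine ⟨hs, fun i => ?_⟩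
  have hr2 : (θ + r • d).2 = θ.2 + r • Δ := by simp [hd]
  have b0 := hz.gapp hp hκ hg'
  have bψ := (b0.gapp hp hκ (hc Δ)).gapp hp hκ hg
  have bχ := (bψ.gapp hp hκ (hc Δ)).gapp hp hκ hg
  set ε := noisePred p e θ₀ θ with hε
  set ε' := noisePred p e θ₀ (θ + r • d) with hε'
  set ψ := dirErr p θ Δ ε with hψ
  set ψ' := dirErr p θ Δ ε' with hψ'
  set χ := dirErr p θ Δ ψ' with hχ
  have m0' : MemLp (fun ω => ε 0 ω i) 2 μ := a0.memLp 0 i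
  have m1 : MemLp (fun ω => ψ 0 ω i) 2 μ := aψ.memLp 0 i
  have m2 : MemLp (fun ω => ψ' 0 ω i) 2 μ := bψ.memLp 0 i
  have m3 : MemLp (fun ω => χ 0 ω i) 2 μ := bχ.memLp 0 i
  have e1 : (fun ω => ε' 0 ω i ^ 2) =ᵐ[μ] fun ω => (ε 0 ω i ^ 2 +
      (-(2 * r)) * (ε 0 ω i * ψ 0 ω i)) + (2 * r ^ 2 * (ε 0 ω i * χ 0 ω i)
        + r ^ 2 * (ψ' 0 ω i * ψ' 0 ω i)) := by
    filter_upwards [gapp_inv_perturb hp hκ hz hg hg' hr2 0, dirErr_perturb hp hκ hz hg hg' hr2 0]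
      with ω h1 h2
    have h3 : ε' 0 ω i = ε 0 ω i + (-r) * ψ' 0 ω i := congrFun h1 i
    have h4 : ψ' 0 ω i = ψ 0 ω i + (-r) * χ 0 ω i := congrFun h2 i
    have h5 : ψ 0 ω i = ψ' 0 ω i + r * χ 0 ω i := by rw [h4]; ring
    rw [h3, h5]
    ring
  have i0 := m0'.integrable_sq
  have i1 := (integrable_mul_of_memLp_two m0' m1).const_mul (-(2 * r))
  have i2 := (integrable_mul_of_memLp_two m0' m3).const_mul (2 * r ^ 2)
  have i3 := (integrable_mul_of_memLp_two m2 m2).const_mul (r ^ 2)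
  have i4 : Integrable (fun ω => ε 0 ω i ^ 2 + (-(2 * r)) * (ε 0 ω i * ψ 0 ω i)) μ := i0.add i1
  have i5 : Integrable (fun ω => 2 * r ^ 2 * (ε 0 ω i * χ 0 ω i)
        + r ^ 2 * (ψ' 0 ω i * ψ' 0 ω i)) μ := i2.add i3
  have k1 : |∫ ω, ε 0 ω i * χ 0 ω i ∂μ| ≤ A * B' :=
    abs_integral_mul_le_of_le m0' m3 (a0.eLpNorm_le 0 i) (bχ.eLpNorm_le 0 i)
  have k2 : |∫ ω, ψ' 0 ω i * ψ' 0 ω i ∂μ| ≤ B * B :=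
    abs_integral_mul_le_of_le m2 m2 (bψ.eLpNorm_le 0 i) (bψ.eLpNorm_le 0 i)
  rw [integral_congr_ae e1, integral_add i4 i5, integral_add i0 i1, integral_add i2 i3,
    integral_const_mul, integral_const_mul, integral_const_mul]
  have e2 : ∀ a b x w : ℝ, a + -(2 * r) * b + (2 * r ^ 2 * x + r ^ 2 * w) - a + 2 * r * b
      = (2 * x + w) * r ^ 2 := fun a b x w => by ring
  rw [e2, abs_mul, abs_of_nonneg (sq_nonneg r)]
  refine mul_le_mul_of_nonneg_right ((abs_add_le _ _).trans (add_le_add ?_ k2)) (sq_nonneg r)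
  rw [abs_mul, abs_two]
  linarith

/-- Identification of the noise coefficients from stationarity in all directions. -/
theorem SignalAssumptions.eq_snd_of_integral_dirErr (hθ₀ : θ₀ ∈ stableParams μ p)
    (hθ : θ ∈ stableParams μ p)
    (h : ∀ Δ, ∑ i, ∫ ω, noisePred p e θ₀ θ 0 ω i * dirErr p θ Δ (noisePred p e θ₀ θ) 0 ω i ∂μ = 0) :
    θ₀.2 = θ.2 := by
  have hp := H.white
  obtain ⟨κ, hκ⟩ := hp.exists_junction
  obtain ⟨c, hc⟩ := hp.exists_goodKer_sker ny nc
  obtain ⟨K, ρ, hK⟩ := hp.exists_goodKer_inv hθ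
  obtain ⟨K₀, ρ₀, hK₀⟩ := hp.exists_goodKer_inv hθ₀
  obtain ⟨M, hM⟩ := H.adm_noisePred (θ₀ := θ₀) hθ
  -- The direction whose filter `x = ΓΔ` has the autocorrelations of `ε` as coefficients;
  -- differentiating in this direction turns the derivative into a sum of squares.
  obtain ⟨Δ, hΔ⟩ := H.exists_integral_noisePred_mul (θ₀ := θ₀) hθ
  obtain ⟨K', ρ', hconv⟩ := GoodKer.conv hp hκ hK (hc Δ)
  set x : Ω → Ker ny := fun ω => conv (invNoiseCoeff θ (sched p ω)) (sker Δ (sched p ω)) with hx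
  have hrl : ∀ k i l, RL μ p (0 - (k : ℕ)) fun ω => x ω 0 k i l := fun k i l => by
    simpa using hconv.rker 0 k i l (fun _ => 1) Lin.one
  have hterm : ∀ (k : ℕ) i l, ∫ ω, noisePred p e θ₀ θ 0 ω i *
      (1 * x ω 0 k i l * noisePred p e θ₀ θ (0 - k) ω l) ∂μ = ∫ ω, x ω 0 k i l ^ 2 ∂μ := by
    intro k i l
    cases k with
    | zero => simp [hx, conv_inv_sker_zero_lag]
    | succ n =>
      have := hΔ n 0 i l (fun _ => 1) _ Lin.one (hrl (n + 1) i l)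
      simp only [one_mul] at this ⊢
      rw [this]
      simp only [sq, hx]
  -- Expanding `E ε·(xε)` over lags, the correlation at lag `k` with multiplier `x_k` is `E x_k²`,
  -- so the vanishing derivative is a sum of nonnegative terms.
  have hsum : HasSum (fun k : ℕ => ∑ i, ∑ l, ∫ ω, x ω 0 k i l ^ 2 ∂μ) 0 := by
    rw [← h Δ]
    refine hasSum_sum fun i _ => ?_
    have h1 := hM.hasSum_integral_gapp hp hκ hconv (hM.memLp 0 i) (t := 0) (X := fun _ => 1)
      Lin.one i
    simp only [hterm] at h1
    convert h1 using 1
    refine integral_congr_ae ?_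
    filter_upwards [gapp_conv hp hκ hM hK (hc Δ) 0] with ω hω
    rw [hω, one_mul]
    rfl
  have hnn : ∀ k i l, 0 ≤ ∫ ω, x ω 0 k i l ^ 2 ∂μ := fun k i l =>
    integral_nonneg fun _ => sq_nonneg _
  have hx0 : ∀ k i l, (fun ω => x ω 0 k i l) =ᵐ[μ] 0 := by
    intro k i l
    have h1 := congrFun ((hasSum_zero_iff_of_nonneg fun k => Finset.sum_nonneg fun i _ =>
      Finset.sum_nonneg fun l _ => hnn k i l).1 hsum) k
    have h2 := (Finset.sum_eq_zero_iff_of_nonneg fun i _ =>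
      Finset.sum_nonneg fun l _ => hnn k i l).1 h1 i (Finset.mem_univ i)
    have h3 := (Finset.sum_eq_zero_iff_of_nonneg fun l _ => hnn k i l).1 h2 l (Finset.mem_univ l)
    filter_upwards [(integral_eq_zero_iff_of_nonneg (fun ω => sq_nonneg _)
      (hp.memLp_rl (hrl k i l)).integrable_sq).1 h3] with ω hω
    simpa using hω
  -- As `x` vanishes, `ε` is orthogonal to its own past, even when that past is multiplied by
  -- functions of the scheduling.
  have horth : ∀ i, OrthUpTo μ p (fun ω => noisePred p e θ₀ θ 0 ω i) (-1)
      (noisePred p e θ₀ θ) := by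
    intro i s hs l X hX
    obtain ⟨n, rfl⟩ : ∃ n : ℕ, s = 0 - (n + 1 : ℕ) := ⟨(-1 - s).toNat, by omega⟩
    have h1 := hΔ n 0 i l (fun _ => 1) X Lin.one hX
    simp only [one_mul] at h1
    rw [h1, ← integral_zero Ω ℝ]
    refine integral_congr_ae ?_
    filter_upwards [hx0 (n + 1) i l] with ω hω
    have hω' : conv (invNoiseCoeff θ (sched p ω)) (sker Δ (sched p ω)) 0 (n + 1) i l = 0 := hω
    rw [hω', zero_mul]
  obtain ⟨M₀, hM₀⟩ := H.adm_noise
  obtain ⟨Mn, hMn⟩ := H.adm_noiseErr (θ₀ := θ₀) hθ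
  obtain ⟨Kn, hKn⟩ := hp.exists_goodKer_noiseCoeff θ₀
  have hCe := hM₀.gapp hp hκ hKn
  -- Resolvent identity for `z = C₀e`: `ε = Γz = Γ₀z + Γ₀(C₀ - C)Γz = e + Γ₀(C₀ - C)ε`. This is
  -- where stability of the true parameter enters.
  have herr : noiseErr p e θ₀ θ 0 =ᵐ[μ] dirErr p θ₀ (θ₀.2 - θ.2) (noisePred p e θ₀ θ) 0 := by
    filter_upwards [H.noisePred_ae_eq (θ₀ := θ₀) hθ 0, gapp_inv_eq hp hκ hCe hK hK₀ 0,
      gapp_inv_gapp hp hκ hM₀ hK₀ 0] with ω h1 h2 h3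
    rw [h3] at h2
    exact add_left_cancel (h1.symm.trans h2)
  refine H.eq_of_noiseErr hθ fun i => ?_
  have h1 : ∫ ω, noisePred p e θ₀ θ 0 ω i * dirErr p θ₀ (θ₀.2 - θ.2) (noisePred p e θ₀ θ) 0 ω i ∂μ
      = 0 :=
    integral_zero_of_orthUpTo (((horth i).gapp_strict hp hκ hM (hc (θ₀.2 - θ.2))
      (fun ω t => sker_zero_lag _ _ _) (hM.memLp 0 i)).gapp hp hκ (hM.gapp hp hκ (hc _)) hK₀
        (hM.memLp 0 i)) (by omega) i
  -- Since `ε = e + noiseErr` with `e` orthogonal to `noiseErr`, the mean of `ε · noiseErr` is the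
  -- mean square of `noiseErr`. By `h1` and `herr` it is zero.
  have h2 : ∫ ω, noisePred p e θ₀ θ 0 ω i * noiseErr p e θ₀ θ 0 ω i ∂μ
      = ∫ ω, e 0 ω i * noiseErr p e θ₀ θ 0 ω i + noiseErr p e θ₀ θ 0 ω i ^ 2 ∂μ := by
    refine integral_congr_ae ?_
    filter_upwards [H.noisePred_ae_eq (θ₀ := θ₀) hθ 0] with ω hω
    rw [hω, Pi.add_apply]
    ring
  rw [integral_add (integrable_mul_of_memLp_two (H.noise.memLp 0 i) (hMn.memLp 0 i))
    (hMn.memLp 0 i).integrable_sq, H.integral_noise_mul_noiseErr hθ, zero_add] at h2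
  rw [← h2, ← h1]
  refine integral_congr_ae ?_
  filter_upwards [herr] with ω hω
  rw [hω]

variable (hy : ∀ t ω, y t ω = output θ₀ (sched p ω) (fun s => u s ω) (fun s => e s ω) t)
  (hV : IsAsymptoticLoss μ p u y V)

include hy hV

theorem SignalAssumptions.loss_eq_of_fst_eq (hθ : θ ∈ stableParams μ p) (h : θ.1 = θ₀.1) :
    V θ = ∑ i, ∫ ω, noisePred p e θ₀ θ 0 ω i ^ 2 ∂μ := by
  have h1 := H.hasTimeAverage_inLoss hy hV hθ
  have h2 : inLoss μ p u θ₀ θ = fun _ => 0 := by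
    ext t
    rw [inLoss_of_smul (θ := θ) (c := 0) rfl (by simp [h])]
    simp
  rw [h2] at h1
  have := (hasTimeAverage_const 0).unique h1
  rw [H.sum_integral_noisePred_sq hθ]
  linarith

theorem SignalAssumptions.sum_integral_dirErr_eq_zero (hθ : θ ∈ stableParams μ p) (h : θ.1 = θ₀.1)
    (hd : HasFDerivAt V (0 : Params ny nu np nb nc →L[ℝ] ℝ) θ) (Δ : NoisePar ny np nc) :
    ∑ i, ∫ ω, noisePred p e θ₀ θ 0 ω i * dirErr p θ Δ (noisePred p e θ₀ θ) 0 ω i ∂μ = 0 := by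
  obtain ⟨δ, hδ, C, hC⟩ := H.integral_noisePred_perturb (θ₀ := θ₀) hθ Δ
  set d : Params ny nu np nb nc := (0, Δ) with hddef
  set A := ∑ i, ∫ ω, noisePred p e θ₀ θ 0 ω i * dirErr p θ Δ (noisePred p e θ₀ θ) 0 ω i ∂μ with hA
  have h2 : HasDerivAt (fun r : ℝ => V (θ + r • d)) 0 0 := by
    have h3 : HasDerivAt (fun r : ℝ => θ + r • d) d 0 := by
      simpa using ((hasDerivAt_id (0 : ℝ)).smul_const d).const_add θ
    have h4 : HasFDerivAt V (0 : Params ny nu np nb nc →L[ℝ] ℝ) (θ + (0 : ℝ) • d) := by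
      simpa using hd
    have h5 := h4.comp_hasDerivAt (0 : ℝ) h3
    rwa [zero_apply] at h5
  -- Along this direction the process coefficients remain the true ones, so the loss is the mean
  -- square of `noisePred`, and its expansion has remainder of order `r²`.
  have h3 : HasDerivAt (fun r : ℝ => V (θ + r • d)) (-2 * A) 0 := by
    rw [hasDerivAt_iff_isLittleO_nhds_zero]
    have h4 : (fun r : ℝ => V (θ + (0 + r) • d) - V (θ + (0 : ℝ) • d) - r • (-2 * A))
        =O[𝓝 0] fun r : ℝ => r ^ 2 := by
      refine Asymptotics.IsBigO.of_bound (ny * C) ?_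
      filter_upwards [Metric.ball_mem_nhds (0 : ℝ) hδ] with r hr
      rw [mem_ball_zero_iff, Real.norm_eq_abs] at hr
      obtain ⟨hs, hb⟩ := hC r hr
      have hfst : (θ + r • d).1 = θ₀.1 := by simp [hddef, h]
      rw [zero_add, zero_smul, add_zero, H.loss_eq_of_fst_eq hy hV hs hfst,
        H.loss_eq_of_fst_eq hy hV hθ h, Real.norm_eq_abs, Real.norm_of_nonneg (sq_nonneg r)]
      have e1 : ∀ a b : ℝ, a - b - r • (-2 * A) = a - b + 2 * r * A := fun a b => by
        rw [smul_eq_mul]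
        ring
      rw [e1, hA, Finset.mul_sum, ← Finset.sum_sub_distrib, ← Finset.sum_add_distrib]
      refine (Finset.abs_sum_le_sum_abs _ _).trans ((Finset.sum_le_sum fun i _ => hb i).trans ?_)
      simp [mul_assoc]
    refine h4.trans_isLittleO ?_
    simpa using (Asymptotics.isLittleO_pow_pow (𝕜 := ℝ) (show 1 < 2 by norm_num))
  have := h2.unique h3
  linarith

variable (hpers : PersistentlyExciting μ
  (fun t ω => extInput nb (sched p ω) (fun s => u s ω) t) m) (hm : Fin ny → Fin nu → nb < m)

include hpers hm

/-- The true parameter is the only stationary point. -/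
theorem SignalAssumptions.eq_of_hasFDerivAt (hθ₀ : θ₀ ∈ stableParams μ p)
    (hθ : θ ∈ stableParams μ p)
    (h : HasFDerivAt V (0 : Params ny nu np nb nc →L[ℝ] ℝ) θ) : θ = θ₀ := by
  have h1 := H.eq_fst_of_hasFDerivAt hy hV hpers hm hθ h
  have h2 : θ.1 = θ₀.1 := by rw [h1]
  have h3 := H.eq_snd_of_integral_dirErr hθ₀ hθ (H.sum_integral_dirErr_eq_zero hy hV hθ h2 h)
  exact Prod.ext h2 h3.symm

end StationaryPoints

end LPVMAX

/-- With at least one scheduling signal each power of `1 + np` in the sum is at least `2`, so the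
order of excitation exceeds the number of lags of the process filter beyond lag zero. -/
theorem LPVMAX.lt_excitation_order {ny nu np nb : ℕ} (hnp : 0 < np) (hnb : 0 < nb) (hny : 0 < ny)
    (hnu : 0 < nu) : nb < ny * (∑ i ∈ Finset.Icc 1 nb, (1 + np) ^ i) * nu := by
  have h1 : nb * 2 ≤ ∑ i ∈ Finset.Icc 1 nb, (1 + np) ^ i := by
    have := Finset.card_nsmul_le_sum (Finset.Icc 1 nb) (fun i => (1 + np) ^ i) 2 fun i hi => by
      rw [Finset.mem_Icc] at hi
      exact (show 2 ≤ 1 + np by omega).trans (Nat.le_self_pow (by omega) _)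
    simpa using this
  have h2 : ∑ i ∈ Finset.Icc 1 nb, (1 + np) ^ i
      ≤ ny * (∑ i ∈ Finset.Icc 1 nb, (1 + np) ^ i) * nu :=
    (Nat.le_mul_of_pos_left _ hny).trans (Nat.le_mul_of_pos_right _ hnu)
  omega

theorem mainTheorem1
    {Ω : Type*} [MeasurableSpace Ω] (μ : Measure Ω) [IsProbabilityMeasure μ]
    (ny nu np nb nc nb' nc' : ℕ)
    (hnp : 0 < np) (hnb : 0 < nb) (hnc : 0 < nc) (hb : nb ≤ nb') (hc : nc ≤ nc')
    (e : ℤ → Ω → Fin ny → ℝ) (p : ℤ → Ω → Fin np → ℝ) (u : ℤ → Ω → Fin nu → ℝ)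
    (Se : Matrix (Fin ny) (Fin ny) ℝ)
    (he : LPVMAX.IsNoise μ e Se)
    (hu : LPVMAX.IsInput μ u p)
    (hue : LPVMAX.Uncorrelated μ u e p)
    (hp : LPVMAX.IsWhiteScheduling μ p (6 + nc'))
    (hpe : IndepFun (fun ω (t : ℤ) => p t ω) (fun ω (t : ℤ) => e t ω) μ)
    (hpersist : LPVMAX.PersistentlyExciting μ
      (fun t ω => LPVMAX.extInput nb' (fun s => p s ω) (fun s => u s ω) t)
      (ny * (∑ i ∈ Finset.Icc 1 nb', (1 + np) ^ i) * nu))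
    (θs : LPVMAX.Params ny nu np nb nc)
    (hθs : θs ∈ LPVMAX.stableParams μ p)
    (y : ℤ → Ω → Fin ny → ℝ)
    (hy : ∀ t ω, y t ω =
      LPVMAX.output θs (fun s => p s ω) (fun s => u s ω) (fun s => e s ω) t)
    (V : LPVMAX.Params ny nu np nb' nc' → ℝ)
    (hV : LPVMAX.IsAsymptoticLoss μ p u y V) :
    IsLeast (V '' LPVMAX.stableParams μ p) Se.trace ∧
    (∀ θ ∈ LPVMAX.stableParams μ p, V θ = Se.trace ↔ θ = LPVMAX.pad nb' nc' θs) ∧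
    (∀ θ ∈ LPVMAX.stableParams μ p,
      HasFDerivAt V (0 : LPVMAX.Params ny nu np nb' nc' →L[ℝ] ℝ) θ ↔
        θ = LPVMAX.pad nb' nc' θs) ∧
    (∀ D : Set (LPVMAX.Params ny nu np nb' nc'), IsCompact D →
      D ⊆ LPVMAX.stableParams μ p → LPVMAX.pad nb' nc' θs ∈ D →
      (∀ᵐ ω ∂μ, TendstoUniformlyOn (fun N θ => LPVMAX.empLoss p u y N θ ω) V atTop D) →
      ∀ θhat : ℕ → Ω → LPVMAX.Params ny nu np nb' nc',
        (∀ N, ∀ᵐ ω ∂μ, θhat N ω ∈ D ∧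
          IsMinOn (fun θ => LPVMAX.empLoss p u y N θ ω) D (θhat N ω)) →
        ∀ᵐ ω ∂μ, Tendsto (fun N => θhat N ω) atTop (𝓝 (LPVMAX.pad nb' nc' θs))) := by
  have H : LPVMAX.SignalAssumptions μ p e Se u :=
    ⟨hp.mono_order (by omega), he, hu, hue, hpe⟩
  have hθ₀ : LPVMAX.pad nb' nc' θs ∈ LPVMAX.stableParams μ p :=
    LPVMAX.pad_mem_stableParams hc hθs
  have hy' : ∀ t ω, y t ω = LPVMAX.output (LPVMAX.pad nb' nc' θs) (fun s => p s ω)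
      (fun s => u s ω) (fun s => e s ω) t := fun t ω => by
    rw [hy, LPVMAX.output_pad θs hb hc]
  -- Without outputs or without inputs the order of excitation is zero, but then there are no
  -- process coefficients to identify. So the inequality is asked for only in the presence of
  -- channels `i` and `a`.
  have hm : Fin ny → Fin nu → nb' < ny * (∑ i ∈ Finset.Icc 1 nb', (1 + np) ^ i) * nu :=
    fun i a => LPVMAX.lt_excitation_order hnp (by omega) i.pos a.pos
  have htrue := H.loss_true hy' hV hθ₀
  have hle : ∀ θ ∈ LPVMAX.stableParams μ p, Se.trace ≤ V θ := fun θ hθ =>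
    H.trace_le_loss hy' hV hθ
  have huniq : ∀ θ ∈ LPVMAX.stableParams μ p, V θ = Se.trace → θ = LPVMAX.pad nb' nc' θs :=
    fun θ hθ h => H.eq_of_loss_eq hy' hV hpersist hm hθ h
  refine ⟨⟨⟨_, hθ₀, htrue⟩, ?_⟩, fun θ hθ => ⟨huniq θ hθ, ?_⟩, fun θ hθ => ⟨fun h => ?_, ?_⟩, ?_⟩
  · rintro _ ⟨θ, hθ, rfl⟩
    exact hle θ hθ
  · rintro rfl
    exact htrue
  · exact H.eq_of_hasFDerivAt hy' hV hpersist hm hθ₀ hθ h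
  · rintro rfl
    exact H.hasFDerivAt_loss hy' hV hθ₀
  · intro D hD hDs hmem hunif θhat hmin
    filter_upwards [hunif, ae_all_iff.2 hmin] with ω h1 h2
    refine LPVMAX.tendsto_of_isMinOn_of_tendstoUniformlyOn hD
      (fun θ hθ => (H.continuousAt_loss hy' hV (hDs hθ)).continuousWithinAt) hmem
      (fun θ hθ hne => ?_) h1 (fun N => (h2 N).1) fun N => (h2 N).2
    rw [htrue]
    exact (hle θ (hDs hθ)).lt_of_ne fun h => hne (huniq θ (hDs hθ) h.symm)
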